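/- **Conventions.** Manifolds are smooth, Hausdorff, second countable, of pure finite dimension and without boundary. A *Courant algebroid* over $M$ is a smooth vector bundle $E\to M$ with an $\mathbb R$-bilinear bracket $*$ on $\Gamma(E)$ satisfying $A*(B*C)=(A*B)*C+B*(A*C)$, a smooth non-degenerate symmetric pairing $\langle\cdot,\cdot\rangle$ and a smooth bundle map $a:E\to TM$ with $$a(A)\langle B,C\rangle=\langle A,B*C+C*B\rangle=\langle A*B,C\rangle+\langle B,A*C\rangle .$$ Let $a^*:T^*M\to E$, $\xi\mapsto\hat\xi$, be given by $2\langle\hat\xi,e\rangle=\xi(a(e))$. An *extended manifold* $(M,\mathcal TM)$ is a manifold with a Courant algebroid $\mathcal TM$ for which $0\to T^*M\xrightarrow{a^*}\mathcal TM\xrightarrow{a}TM\to0$ is exact. A *splitting* is a smooth bundle map $s:TM\to\mathcal TM$ with $a\circ s=\mathrm{id}$ and isotropic image; its *twisting form* is the 3-form $H(X,Y,Z)=2\langle s(X),s(Y)*s(Z)\rangle$. For $B\in\Omega^2(M)$ write $(s+\iota_\bullet B)(X)=s(X)+\widehat{\iota_XB}$. $-\mathcal TM$ is $\mathcal TM$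 with the pairing replaced by its negative (same bracket and anchor). Over $M\times N$ the bundle $\pi_1^*(-\mathcal TM)\oplus\pi_2^*\mathcal TN$ carries the product Courant algebroid structure (bracket and pairing vanish between the two summands), with Courant bracket $[A,B]=A*B-B*A$. A *morphism* $\tilde f=(f,\mathcal E):(M,\mathcal TM)\to(N,\mathcal TN)$ is a smooth map $f:M\to N$ with a smooth subbundle $\mathcal E\subset -\mathcal TM\oplus f^*\mathcal TN$ over the graph of $f$, which the anchor maps onto the tangent bundle of the graph, which is isotropic and is involutive (if sections $A,B$ over $M\times N$ restrict to sections of $\mathcal E$ over the graph, then so does $[A,B]$), and which is maximal with respect to inclusion among such subbundles. Given splittings $s_M,s_N$, we say that $\tilde f$ *is given by* $b\in\Omega^2(M)$ if for all $x \in M$ $$\mathcal E_x=\{(s_M(X)+\widehat{f^*\eta}+\widehat{\iota_Xb},\ s_N(f_*X)+\hat\eta)\;:\;X\in T_xM,\ \eta\in T^*_{f(x)}N\}.$$ **Proposition.** 0. Every extended manifold $M$ has a splitting; for each splitting $s$ and $B\in\Omega^2(M)$, $s+\iota_\bullet B$ is a splitting; and the twisting form of $s$ is a well-defined smooth 3-form.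 1. Let $M,N$ be extended manifolds with splittings $s_M,s_N$ and twisting forms $H_M,H_N$. Every morphism $\tilde f:M\to N$ extending a map $f$ is given by a unique $b_{\tilde f}\in\Omega^2(M)$, and $H_M=f^*H_N-db_{\tilde f}$. Conversely, for every smooth $f:M\to N$ and every $b\in\Omega^2(M)$ with $H_M=f^*H_N-db$ there is a unique morphism extending $f$ that is given by $b$. 2. Let $B_M\in\Omega^2(M)$, $B_N\in\Omega^2(N)$. If $\tilde f$ is given by $b$ with respect to $s_M,s_N$, then with respect to $s_M+\iota_\bullet B_M$, $s_N+\iota_\bullet B_N$ it is given by $b-B_M+f^*B_N$. 3. For morphisms $\tilde f:M\to N$, $\tilde g:N\to P$ and any splittings $s_M,s_N,s_P$, there is a unique morphism $\tilde g\circ\tilde f$ which extends $g\circ f$ and is given by $b_{\tilde f}+f^*b_{\tilde g}$; it does not depend on the splittings. 4. Extended manifolds and their morphisms, with this composition, form a category $\mathcal ESmth$; the identity of $M$ extends $\mathrm{id}_M$ and is given by the 2-form $0$ with respect to any splitting of $M$ (the same splitting at source and target). -/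

import Mathlib

open scoped Manifold ContDiff Bundle
open Bundle

universe u

noncomputable section

namespace ExtGeom

/-! ### Smooth manifolds carrying a vector bundle -/

/-- A smooth manifold (Hausdorff, second countable, without boundary, of pure dimension `dim`)
together with a smooth real vector bundle of rank `2 * dim`. -/
structure BundleMfd : Type (u + 1) where
  dim : ℕ
  carrier : Type u
  [top : TopologicalSpace carrier]
  [charted : ChartedSpace (EuclideanSpace ℝ (Fin dim)) carrier]
  [smooth : IsManifold (𝓡 dim) ∞ carrier]
  [t2 : T2Space carrier]
  [secondCountable : SecondCountableTopology carrier]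
  fiber : carrier → Type u
  [fiberAdd : ∀ x, AddCommGroup (fiber x)]
  [fiberModule : ∀ x, Module ℝ (fiber x)]
  [fiberTop : ∀ x, TopologicalSpace (fiber x)]
  [totalTop : TopologicalSpace (TotalSpace (EuclideanSpace ℝ (Fin (2 * dim))) fiber)]
  [fiberBundle : FiberBundle (EuclideanSpace ℝ (Fin (2 * dim))) fiber]
  [vectorBundle : VectorBundle ℝ (EuclideanSpace ℝ (Fin (2 * dim))) fiber]
  [smoothBundle : ContMDiffVectorBundle ∞ (EuclideanSpace ℝ (Fin (2 * dim))) fiber (𝓡 dim)]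

namespace BundleMfd

attribute [instance] top charted smooth t2 secondCountable fiberAdd fiberModule fiberTop totalTop
  fiberBundle vectorBundle smoothBundle

/-- The model fibre. -/
abbrev Model (V : BundleMfd.{u}) : Type := EuclideanSpace ℝ (Fin (2 * V.dim))

/-- The model with corners of the underlying manifold. -/
abbrev I (V : BundleMfd.{u}) := 𝓡 V.dim

/-- The tangent space `T_x M`. -/
abbrev T (V : BundleMfd.{u}) (x : V.carrier) : Type := TangentSpace V.I x

/-- The space `Γ(E)` of smooth sections. -/
abbrev Sec (V : BundleMfd.{u}) : Type u := ContMDiffSection V.I V.Model ∞ V.fiber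

/-- The space of smooth vector fields. -/
abbrev VField (V : BundleMfd.{u}) : Type u :=
  ContMDiffSection V.I (EuclideanSpace ℝ (Fin V.dim)) ∞ V.T

instance (V : BundleMfd.{u}) (x : V.carrier) : FiniteDimensional ℝ (V.fiber x) :=
  VectorBundle.finiteDimensional ℝ V.Model V.fiber x

end BundleMfd

/-! ### Differential forms -/

/-- A (not necessarily smooth) field of alternating `k`-forms on the manifold. -/
abbrev FormField (V : BundleMfd.{u}) (k : ℕ) : Type u := ∀ x : V.carrier, V.T x [⋀^Fin k]→L[ℝ] ℝ

namespace FormField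

/-- The expression of a `k`-form in the chart centred at `x₀`: the pullback of the form by the
inverse of the chart. -/
def inChart {V : BundleMfd.{u}} {k : ℕ} (α : FormField V k) (x₀ : V.carrier)
    (y : EuclideanSpace ℝ (Fin V.dim)) : EuclideanSpace ℝ (Fin V.dim) [⋀^Fin k]→L[ℝ] ℝ :=
  (α ((extChartAt V.I x₀).symm y)).compContinuousLinearMap
    (mfderiv 𝓘(ℝ, EuclideanSpace ℝ (Fin V.dim)) V.I (extChartAt V.I x₀).symm y)

/-- A form is smooth if all its expressions in charts are. -/
def IsSmooth {V : BundleMfd.{u}} {k : ℕ} (α : FormField V k) : Prop :=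
  ∀ x₀ : V.carrier, ContDiffOn ℝ ∞ (α.inChart x₀) (extChartAt V.I x₀).target

/-- The exterior derivative, computed at `x` in the chart centred at `x`. -/
def d {V : BundleMfd.{u}} {k : ℕ} (α : FormField V k) : FormField V (k + 1) := fun x =>
  (extDeriv (α.inChart x) (extChartAt V.I x x)).compContinuousLinearMap
    (mfderiv V.I 𝓘(ℝ, EuclideanSpace ℝ (Fin V.dim)) (extChartAt V.I x) x)

/-- The pullback `f^* α`. -/
def pullback {V W : BundleMfd.{u}} {k : ℕ} (f : V.carrier → W.carrier) (α : FormField W k) :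
    FormField V k := fun x =>
  (α (f x)).compContinuousLinearMap (mfderiv V.I W.I f x)

/-- The contraction `ι_X α = α(X, ·)` of a 2-form with a tangent vector. -/
def contract {V : BundleMfd.{u}} (α : FormField V 2) (x : V.carrier) (X : V.T x) :
    Module.Dual ℝ (V.T x) where
  toFun Y := α x ![X, Y]
  map_add' Y Z := by
    have h : ∀ Y' : V.T x, ![X, Y'] = Function.update ![X, 0] 1 Y' := fun Y' => by
      funext i; fin_cases i <;> rfl
    rw [h (Y + Z), h Y, h Z, (α x).map_update_add]
  map_smul' c Y := by
    have h : ∀ Y' : V.T x, ![X, Y'] = Function.update ![X, 0] 1 Y' := fun Y' => by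
      funext i; fin_cases i <;> rfl
    rw [h (c • Y), h Y, (α x).map_update_smul, RingHom.id_apply]

end FormField

/-! ### Courant algebroids and extended tangent bundles -/

/-- A Courant algebroid structure on the given vector bundle: Loday bracket, non-degenerate
symmetric pairing and anchor. -/
structure CourantAlgebroid (V : BundleMfd.{u}) where
  bracket : V.Sec →ₗ[ℝ] V.Sec →ₗ[ℝ] V.Sec
  pairing : ∀ x : V.carrier, LinearMap.BilinForm ℝ (V.fiber x)
  anchor : ∀ x : V.carrier, V.fiber x →ₗ[ℝ] V.T x
  jacobi : ∀ A B C : V.Sec,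
    bracket A (bracket B C) = bracket (bracket A B) C + bracket B (bracket A C)
  pairing_smooth : ∀ A B : V.Sec,
    ContMDiff V.I 𝓘(ℝ, ℝ) ∞ (fun x => pairing x (A x) (B x))
  pairing_symm : ∀ x u v, pairing x u v = pairing x v u
  pairing_nondegenerate : ∀ x, (pairing x).Nondegenerate
  anchor_smooth : ContMDiff (V.I.prod 𝓘(ℝ, V.Model)) V.I.tangent ∞
    (fun e : TotalSpace V.Model V.fiber => (⟨e.1, anchor e.1 e.2⟩ : TangentBundle V.I V.carrier))
  anchor_pairing_left : ∀ (A B C : V.Sec) (x : V.carrier),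
    mfderiv V.I 𝓘(ℝ, ℝ) (fun y => pairing y (B y) (C y)) x (anchor x (A x))
      = pairing x (A x) ((bracket B C + bracket C B) x)
  anchor_pairing_right : ∀ (A B C : V.Sec) (x : V.carrier),
    mfderiv V.I 𝓘(ℝ, ℝ) (fun y => pairing y (B y) (C y)) x (anchor x (A x))
      = pairing x (bracket A B x) (C x) + pairing x (B x) (bracket A C x)

namespace CourantAlgebroid

/-- The map `a^* : T^*_x M → E_x`, `ξ ↦ ξ^`, dual to the anchor with respect to twice the pairing:
`2⟨ξ^, e⟩ = ξ(a(e))`. -/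
def coanchor {V : BundleMfd.{u}} (A : CourantAlgebroid V) (x : V.carrier) :
    Module.Dual ℝ (V.T x) →ₗ[ℝ] V.fiber x :=
  (1 / 2 : ℝ) • (((A.pairing x).toDual (A.pairing_nondegenerate x)).symm.toLinearMap ∘ₗ
    (A.anchor x).dualMap)

theorem two_mul_pairing_coanchor {V : BundleMfd.{u}} (A : CourantAlgebroid V) (x : V.carrier)
    (ξ : Module.Dual ℝ (V.T x)) (e : V.fiber x) :
    2 * A.pairing x (A.coanchor x ξ) e = ξ (A.anchor x e) := by
  simp [coanchor, LinearMap.BilinForm.apply_toDual_symm_apply]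

theorem mfderiv_neg_apply {V : BundleMfd.{u}} (g : V.carrier → ℝ) (x : V.carrier) (X : V.T x) :
    (mfderiv V.I 𝓘(ℝ, ℝ) (fun y => -g y) x X : ℝ) = -(mfderiv V.I 𝓘(ℝ, ℝ) g x X : ℝ) := by
  have h : mfderiv V.I 𝓘(ℝ, ℝ) (fun y => -g y) x = -mfderiv V.I 𝓘(ℝ, ℝ) g x :=
    mfderiv_neg
  rw [h]
  rfl

/-- The reversed structure: same bracket and anchor, opposite pairing. -/
def reverse {V : BundleMfd.{u}} (A : CourantAlgebroid V) : CourantAlgebroid V where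
  bracket := A.bracket
  pairing x := -A.pairing x
  anchor := A.anchor
  jacobi := A.jacobi
  pairing_smooth B C := by simpa using (A.pairing_smooth B C).neg
  pairing_symm x u v := by simp [A.pairing_symm x u v]
  pairing_nondegenerate x := by
    obtain ⟨h₁, h₂⟩ := A.pairing_nondegenerate x
    exact ⟨fun u hu => h₁ u fun v => by simpa using hu v,
      fun u hu => h₂ u fun v => by simpa using hu v⟩
  anchor_smooth := A.anchor_smooth
  anchor_pairing_left B C D x := by
    refine (mfderiv_neg_apply _ x _).trans ((congrArg Neg.neg (A.anchor_pairing_left B C D x)).trans ?_)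
    rfl
  anchor_pairing_right B C D x := by
    refine (mfderiv_neg_apply _ x _).trans
      ((congrArg Neg.neg (A.anchor_pairing_right B C D x)).trans ?_)
    exact neg_add _ _

end CourantAlgebroid

end ExtGeom

/-- An extended manifold: a smooth manifold with an extended tangent bundle, i.e. a Courant
algebroid for which `0 → T^*M → E → TM → 0` is exact. -/
structure ExtMfd : Type (u + 1) extends ExtGeom.BundleMfd.{u} where
  courant : ExtGeom.CourantAlgebroid toBundleMfd
  coanchor_injective : ∀ x, Function.Injective (courant.coanchor x)
  exact : ∀ x, Function.Exact (courant.coanchor x) (courant.anchor x)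
  anchor_surjective : ∀ x, Function.Surjective (courant.anchor x)

namespace ExtGeom

/-! ### Isotropic splittings and their twisting forms -/

/-- A (smooth) isotropic splitting `s : TM → E` of the anchor. -/
structure Splitting (M : ExtMfd.{u}) where
  toFun : ∀ x : M.carrier, M.T x →ₗ[ℝ] M.fiber x
  smooth : ContMDiff M.I.tangent (M.I.prod 𝓘(ℝ, M.Model)) ∞
    (fun v : TangentBundle M.I M.carrier => (⟨v.1, toFun v.1 v.2⟩ : TotalSpace M.Model M.fiber))
  anchor_apply : ∀ x X, M.courant.anchor x (toFun x X) = X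
  isotropic : ∀ x X Y, M.courant.pairing x (toFun x X) (toFun x Y) = 0

namespace Splitting

/-- The section `s(X)` attached to a vector field `X`. -/
def onField {M : ExtMfd.{u}} (s : Splitting M) (X : M.VField) : M.Sec where
  toFun x := s.toFun x (X x)
  contMDiff_toFun := s.smooth.comp X.contMDiff_toFun

/-- `H` is the twisting 3-form of `s`: `H(X, Y, Z) = 2⟨s(X), s(Y) * s(Z)⟩`. -/
def IsTwistingForm {M : ExtMfd.{u}} (s : Splitting M) (H : FormField M.toBundleMfd 3) : Prop :=
  H.IsSmooth ∧ ∀ (X Y Z : M.VField) (x : M.carrier),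
    H x ![X x, Y x, Z x] =
      2 * M.courant.pairing x (s.onField X x) (M.courant.bracket (s.onField Y) (s.onField Z) x)

/-- `s'` is the splitting `X ↦ s(X) + ι_X B`. -/
def IsShift {M : ExtMfd.{u}} (s : Splitting M) (B : FormField M.toBundleMfd 2)
    (s' : Splitting M) : Prop :=
  ∀ x X, s'.toFun x X = s.toFun x X + M.courant.coanchor x (B.contract x X)

end Splitting

/-! ### The product of two Courant algebroids -/

/-- A smooth section of `π₁^* E ⊕ π₂^* F` over the product of the base manifolds of `E` and `F`. -/
structure ProdSec (V W : BundleMfd.{u}) where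
  fst : ∀ p : V.carrier × W.carrier, V.fiber p.1
  snd : ∀ p : V.carrier × W.carrier, W.fiber p.2
  smooth_fst : ContMDiff (V.I.prod W.I) (V.I.prod 𝓘(ℝ, V.Model)) ∞
    (fun p => (⟨p.1, fst p⟩ : TotalSpace V.Model V.fiber))
  smooth_snd : ContMDiff (V.I.prod W.I) (W.I.prod 𝓘(ℝ, W.Model)) ∞
    (fun p => (⟨p.2, snd p⟩ : TotalSpace W.Model W.fiber))

namespace ProdSec

/-- The restriction of the first component to the slice `V × {y}`, a section of `E`. -/
def sliceFst {V W : BundleMfd.{u}} (A : ProdSec V W) (y : W.carrier) : V.Sec where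
  toFun x := A.fst (x, y)
  contMDiff_toFun := A.smooth_fst.comp (contMDiff_id.prodMk contMDiff_const)

/-- The restriction of the second component to the slice `{x} × W`, a section of `F`. -/
def sliceSnd {V W : BundleMfd.{u}} (A : ProdSec V W) (x : V.carrier) : W.Sec where
  toFun y := A.snd (x, y)
  contMDiff_toFun := A.smooth_snd.comp (contMDiff_const.prodMk contMDiff_id)

end ProdSec

/-- The derivative at `y` of a function on the base of `W` with values in the fixed vector
space `E_x`. (The linear coordinates on `E_x` used here do not affect the result.) -/
def fiberDeriv (V W : BundleMfd.{u}) (x : V.carrier) (g : W.carrier → V.fiber x) (y : W.carrier) :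
    W.T y →ₗ[ℝ] V.fiber x :=
  let e : V.fiber x ≃L[ℝ] V.Model := VectorBundle.continuousLinearEquivAt ℝ V.Model V.fiber x
  e.symm.toLinearEquiv.toLinearMap ∘ₗ
    (mfderiv W.I 𝓘(ℝ, V.Model) (fun z => e (g z)) y).toLinearMap

section Product

variable {V W : BundleMfd.{u}}

/-- The pairing of `π₁^* E ⊕ π₂^* F`, at the point `(x, y)`. -/
def prodPairing (A : CourantAlgebroid V) (C : CourantAlgebroid W) (x : V.carrier) (y : W.carrier)
    (u v : V.fiber x × W.fiber y) : ℝ :=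
  A.pairing x u.1 v.1 + C.pairing y u.2 v.2

/-- The Loday bracket of `π₁^* E ⊕ π₂^* F`, at the point `(x, y)`. This is the extension to all
sections, by the two Leibniz rules `P * (hQ) = h (P * Q) + (a(P)h) Q` and
`(hP) * Q = h (P * Q) - (a(Q)h) P + 2⟨P, Q⟩ a^*(dh)`, of the bracket which agrees with those of `E`
and `F` on pulled back sections and vanishes between `π₁^* E` and `π₂^* F`. -/
def prodBracket (A : CourantAlgebroid V) (C : CourantAlgebroid W) (P Q : ProdSec V W)
    (x : V.carrier) (y : W.carrier) : V.fiber x × W.fiber y :=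
  (A.bracket (P.sliceFst y) (Q.sliceFst y) x
      + fiberDeriv V W x (fun z => Q.fst (x, z)) y (C.anchor y (P.snd (x, y)))
      - fiberDeriv V W x (fun z => P.fst (x, z)) y (C.anchor y (Q.snd (x, y)))
      + (2 : ℝ) • A.coanchor x
          ((C.pairing y).flip (Q.snd (x, y)) ∘ₗ fiberDeriv W V y (fun z => P.snd (z, y)) x),
    C.bracket (P.sliceSnd x) (Q.sliceSnd x) y
      + fiberDeriv W V y (fun z => Q.snd (z, y)) x (A.anchor x (P.fst (x, y)))
      - fiberDeriv W V y (fun z => P.snd (z, y)) x (A.anchor x (Q.fst (x, y)))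
      + (2 : ℝ) • C.coanchor y
          ((A.pairing x).flip (Q.fst (x, y)) ∘ₗ fiberDeriv V W x (fun z => P.fst (x, z)) y))

/-- The Courant bracket `[P, Q] = P * Q - Q * P` on the product. -/
def prodCourantBracket (A : CourantAlgebroid V) (C : CourantAlgebroid W) (P Q : ProdSec V W)
    (x : V.carrier) (y : W.carrier) : V.fiber x × W.fiber y :=
  prodBracket A C P Q x y - prodBracket A C Q P x y

end Product

/-! ### Isotropic extended structures on the graph of a map, and morphisms -/

/-- A family of subspaces `𝓔_x ⊆ E_x ⊕ F_{f(x)}` is a smooth subbundle of `E ⊕ f^* F`: locally it has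
a smooth frame. -/
def IsSmoothSubbundle (V W : BundleMfd.{u}) (f : V.carrier → W.carrier)
    (𝓔 : ∀ x, Submodule ℝ (V.fiber x × W.fiber (f x))) : Prop :=
  ∀ x₀ : V.carrier, ∃ U : Set V.carrier, IsOpen U ∧ x₀ ∈ U ∧ ∃ (k : ℕ)
    (b : Fin k → ∀ x, V.fiber x × W.fiber (f x)),
    (∀ i, ContMDiffOn V.I (V.I.prod 𝓘(ℝ, V.Model)) ∞
      (fun x => (⟨x, (b i x).1⟩ : TotalSpace V.Model V.fiber)) U) ∧
    (∀ i, ContMDiffOn V.I (W.I.prod 𝓘(ℝ, W.Model)) ∞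
      (fun x => (⟨f x, (b i x).2⟩ : TotalSpace W.Model W.fiber)) U) ∧
    ∀ x ∈ U, LinearIndependent ℝ (fun i => b i x) ∧
      Submodule.span ℝ (Set.range fun i => b i x) = 𝓔 x

/-- `𝓔` is an isotropic extended structure on the graph of `f : M → N` in the product
of `(M, -TM)` and `(N, TN)`. Since the annihilator of `Ann(T graph f) ⊆ T^*(M × N)` is the preimage
of `T graph f` under the anchor, the condition `𝓔 ⊆ Ann(Ann(T graph f))` is the field `tangent`. -/
structure IsIsotropicExtended (M N : ExtMfd.{u}) (f : M.carrier → N.carrier)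
    (𝓔 : ∀ x, Submodule ℝ (M.fiber x × N.fiber (f x))) : Prop where
  subbundle : IsSmoothSubbundle M.toBundleMfd N.toBundleMfd f 𝓔
  tangent : ∀ x, ∀ e ∈ 𝓔 x,
    N.courant.anchor (f x) e.2 = mfderiv M.I N.I f x (M.courant.anchor x e.1)
  surjective : ∀ x (X : M.T x), ∃ e ∈ 𝓔 x, M.courant.anchor x e.1 = X
  isotropic : ∀ x, ∀ e ∈ 𝓔 x, ∀ e' ∈ 𝓔 x,
    prodPairing M.courant.reverse N.courant x (f x) e e' = 0
  involutive : ∀ P Q : ProdSec M.toBundleMfd N.toBundleMfd,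
    (∀ x, (P.fst (x, f x), P.snd (x, f x)) ∈ 𝓔 x) →
    (∀ x, (Q.fst (x, f x), Q.snd (x, f x)) ∈ 𝓔 x) →
    ∀ x, prodCourantBracket M.courant.reverse N.courant P Q x (f x) ∈ 𝓔 x

/-- A morphism of extended manifolds: a smooth map with a maximal isotropic extended structure on
its graph. -/
@[ext] structure Morph (M N : ExtMfd.{u}) : Type u where
  map : M.carrier → N.carrier
  str : ∀ x, Submodule ℝ (M.fiber x × N.fiber (map x))
  smooth : ContMDiff M.I N.I ∞ map
  maximal : Maximal (IsIsotropicExtended M N map) str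

namespace Morph

/-- With respect to the splittings `sM` and `sN`, the morphism `φ` extending `f` is given by the
2-form `b`, i.e. its extended structure is
`{(s_M(X) + (f^*η)^ + (ι_X b)^, s_N(f_* X) + η^) | X ∈ T_x M, η ∈ T^*_{f(x)} N}`. -/
def IsGivenBy {M N : ExtMfd.{u}} (φ : Morph M N) (sM : Splitting M) (sN : Splitting N)
    (b : FormField M.toBundleMfd 2) : Prop :=
  b.IsSmooth ∧ ∀ (x : M.carrier) (e : M.fiber x × N.fiber (φ.map x)), e ∈ φ.str x ↔
    ∃ (X : M.T x) (η : Module.Dual ℝ (N.T (φ.map x))),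
      e.1 = sM.toFun x X
        + M.courant.coanchor x (η ∘ₗ (mfderiv M.I N.I φ.map x).toLinearMap)
        + M.courant.coanchor x (b.contract x X) ∧
      e.2 = sN.toFun (φ.map x) (mfderiv M.I N.I φ.map x X) + N.courant.coanchor (φ.map x) η

/-- `χ` is the composition of `φ` and `ψ` with respect to the given splittings:
it extends `g ∘ f` and is given by the 2-form `b_f + f^* b_g`. -/
def IsCompositeFor {M N P : ExtMfd.{u}} (sM : Splitting M) (sN : Splitting N) (sP : Splitting P)
    (φ : Morph M N) (ψ : Morph N P) (χ : Morph M P) : Prop :=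
  χ.map = ψ.map ∘ φ.map ∧ ∀ b c, φ.IsGivenBy sM sN b → ψ.IsGivenBy sN sP c →
    χ.IsGivenBy sM sP (b + FormField.pullback φ.map c)

end Morph

end ExtGeom

end

/-! A splitting `s` identifies the extended tangent bundle with `TM ⊕ T*M`: an element `e` has the
vector part `a(e)` and the covector part `s.cov x e = 2⟨e, s(·)⟩`. Isotropy of `s` turns twice the
pairing into `ξ(X') + ξ'(X)`, and the axioms force the Loday bracket to be the Dorfman bracket
twisted by a 3-form `H` (`Splitting.bracket_pairing`). Replacing `s` by `s + ι B` replaces `H` by `H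
+ dB` (`Splitting.IsShift.twistForm_eq`). A smooth right inverse of the anchor, glued by a partition
of unity and then corrected by half its own Gram form, gives a splitting (`nonempty_splitting`).

Shifting `s_M` by `b` reduces everything to the structure with `b = 0`, `graphStr`. It is
Lagrangian, i.e. its own orthogonal (`prodPairing_graphStr`, `mem_graphStr_of_perp`). The central
computation (`prodPairing_prodBracket`, `prodPairing_prodCourantBracket`) pairs the bracket of two
sections tangent to it with a third element. All derivative terms cancel, because the defining
relations can be differentiated along the graph and the second derivative of `f` is symmetric. What
remains is `f^*H_N - H_M` on the three vector parts. So the graph structure is involutive iff `H_M =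
f^*H_N`, and being Lagrangian it is then maximal.

Conversely, let `𝓔` be any isotropic extended structure. The amount by which an element of `𝓔` fails
to lie in the graph structure is a covector. By isotropy this covector depends only on the vector
part, and alternatingly so, which gives a smooth 2-form `b` with `𝓔` contained in the graph
structure of the shifted splitting (`IsIsotropicExtended.exists_form`). This inclusion already
forces the equation for the twisting forms (`IsIsotropicExtended.twistForm_eq`), so the larger graph
structure is admissible, and maximality gives equality.

Composition is composition of linear relations and the identity is the diagonal. Neither mentions a
splitting, so independence and the category laws are immediate. Splittings enter only to show
maximality, where the forms add up because `d` commutes with pullback. -/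

noncomputable section

open Set Filter Topology

/-! ### Smooth linear systems, frames and smoothness along maps -/

namespace SmoothBundle

section LinearSolve

variable {ES HS S : Type*} [NormedAddCommGroup ES] [NormedSpace ℝ ES] [TopologicalSpace HS]
  {J : ModelWithCorners ℝ ES HS} [TopologicalSpace S] [ChartedSpace HS S]
  {F₁ F₂ : Type*} [NormedAddCommGroup F₁] [NormedSpace ℝ F₁] [FiniteDimensional ℝ F₁]
  [NormedAddCommGroup F₂] [NormedSpace ℝ F₂]

/-- A family of linear maps on a finite-dimensional space is smooth if its values are. -/
theorem contMDiffAt_clm_of_apply {L : S → F₁ →L[ℝ] F₂} {s₀ : S}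
    (h : ∀ v, ContMDiffAt J 𝓘(ℝ, F₂) ∞ (fun s => L s v) s₀) :
    ContMDiffAt J 𝓘(ℝ, F₁ →L[ℝ] F₂) ∞ L s₀ := by
  let b := Module.finBasis ℝ F₁
  have hL : L = fun s => ∑ i, ContinuousLinearMap.smulRightL ℝ F₁ F₂
      (LinearMap.toContinuousLinearMap (b.coord i)) (L s (b i)) := by
    funext s
    ext v
    conv_lhs => rw [← b.sum_repr v, map_sum]
    simp
  rw [hL]
  refine contMDiffAt_finsetSum fun i _ => ?_
  exact (ContinuousLinearMap.contMDiff _).contMDiffAt.comp s₀ (h (b i))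

/-- Solutions of smooth invertible linear systems are smooth. -/
theorem contMDiffAt_of_clm_apply {L : S → F₁ →L[ℝ] F₂} {s₀ : S}
    (hL : ContMDiffAt J 𝓘(ℝ, F₁ →L[ℝ] F₂) ∞ L s₀) (hinv : Function.Bijective (L s₀))
    {w : S → F₁} (hw : ContMDiffAt J 𝓘(ℝ, F₂) ∞ (fun s => L s (w s)) s₀) :
    ContMDiffAt J 𝓘(ℝ, F₁) ∞ w s₀ := by
  have : CompleteSpace F₁ := FiniteDimensional.complete ℝ F₁
  let e₀ : F₁ ≃ₗ[ℝ] F₂ := LinearEquiv.ofBijective (L s₀ : F₁ →ₗ[ℝ] F₂) hinv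
  have : FiniteDimensional ℝ F₂ := e₀.finiteDimensional
  let e : F₁ ≃L[ℝ] F₂ := e₀.toContinuousLinearEquiv
  have he : (e : F₁ →L[ℝ] F₂) = L s₀ := by ext v; rfl
  have hinvs : ContMDiffAt J 𝓘(ℝ, F₂ →L[ℝ] F₁) ∞ (fun s => ContinuousLinearMap.inverse (L s)) s₀ := by
    have h1 : ContDiffAt ℝ ∞ (ContinuousLinearMap.inverse : (F₁ →L[ℝ] F₂) → _) (L s₀) := by
      rw [← he]; exact contDiffAt_map_inverse e
    exact h1.contMDiffAt.comp s₀ hL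
  -- Invertibility is an open condition, so `w = L⁻¹(L w)` near `s₀`.
  refine (hinvs.clm_apply hw).congr_of_eventuallyEq ?_
  have hn : range ((↑) : (F₁ ≃L[ℝ] F₂) → F₁ →L[ℝ] F₂) ∈ 𝓝 (L s₀) := by
    rw [← he]; exact ContinuousLinearEquiv.nhds e
  filter_upwards [hL.continuousAt hn] with s hs
  obtain ⟨e', he'⟩ := hs
  rw [← he']
  simp

end LinearSolve

section Bump

variable {EB HB B : Type*} [NormedAddCommGroup EB] [NormedSpace ℝ EB] [FiniteDimensional ℝ EB]
  [TopologicalSpace HB] {IB : ModelWithCorners ℝ EB HB} [TopologicalSpace B] [ChartedSpace HB B]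
  [IsManifold IB ∞ B] [T2Space B]

variable (IB) in
/-- Every neighbourhood contains the support of a smooth function that is `1` near the point. -/
theorem exists_bump {x₀ : B} {U : Set B} (hU : U ∈ 𝓝 x₀) :
    ∃ χ : B → ℝ, ContMDiff IB 𝓘(ℝ, ℝ) ∞ χ ∧ (∀ᶠ x in 𝓝 x₀, χ x = 1) ∧ tsupport χ ⊆ U := by
  obtain ⟨f, -, hf⟩ := (SmoothBumpFunction.nhds_basis_tsupport (I := IB) x₀).mem_iff.1 hU
  exact ⟨f, f.contMDiff, f.eventuallyEq_one, hf⟩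

end Bump

section Frame

variable {EB HB B : Type*} [NormedAddCommGroup EB] [NormedSpace ℝ EB] [FiniteDimensional ℝ EB]
  [TopologicalSpace HB] (IB : ModelWithCorners ℝ EB HB) [TopologicalSpace B] [ChartedSpace HB B]
  [IsManifold IB ∞ B] [T2Space B]
  (F : Type*) [NormedAddCommGroup F] [NormedSpace ℝ F]
  (E : B → Type*) [∀ x, AddCommGroup (E x)] [∀ x, Module ℝ (E x)] [∀ x, TopologicalSpace (E x)]
  [TopologicalSpace (TotalSpace F E)] [FiberBundle F E] [VectorBundle ℝ F E]
  [ContMDiffVectorBundle ∞ F E IB]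

omit [NormedSpace ℝ F] [∀ x, AddCommGroup (E x)] [∀ x, Module ℝ (E x)] [VectorBundle ℝ F E]
  [ContMDiffVectorBundle ∞ F E IB] in
include IB in
theorem exists_bump_baseSet (x₀ : B) :
    ∃ χ : B → ℝ, ContMDiff IB 𝓘(ℝ, ℝ) ∞ χ ∧ (∀ᶠ x in 𝓝 x₀, χ x = 1) ∧
      tsupport χ ⊆ (trivializationAt F E x₀).baseSet :=
  exists_bump IB ((trivializationAt F E x₀).open_baseSet.mem_nhds
    (FiberBundle.mem_baseSet_trivializationAt F E x₀))

/-- Smooth global sections which near `x₀` are constant in the preferred trivialization. -/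
def frame (x₀ : B) : F →ₗ[ℝ] ContMDiffSection IB F ∞ E where
  toFun v :=
    { toFun := fun x => (exists_bump_baseSet IB F E x₀).choose x •
        (trivializationAt F E x₀).symmₗ ℝ x v
      contMDiff_toFun := by
        have h := (exists_bump_baseSet IB F E x₀).choose_spec
        refine ContMDiffOn.smul_section_of_tsupport h.1.contMDiffOn
          (trivializationAt F E x₀).open_baseSet h.2.2 ?_
        rw [(trivializationAt F E x₀).contMDiffOn_section_baseSet_iff]
        refine (contMDiffOn_const (c := v)).congr fun x hx => ?_
        simp [(trivializationAt F E x₀).coe_symmₗ hx, (trivializationAt F E x₀).apply_mk_symm hx] }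
  map_add' v w := by
    ext x
    simp [ContMDiffSection.coe_add]
  map_smul' c v := by
    ext x
    simp [ContMDiffSection.coe_smul, smul_comm c]

/-- The linear map from the model fibre to a fibre given by the frame. -/
def frameAt (x₀ x : B) : F →ₗ[ℝ] E x where
  toFun v := frame IB F E x₀ v x
  map_add' v w := by rw [map_add]; rfl
  map_smul' c v := by rw [map_smul]; rfl

@[simp] theorem frameAt_apply (x₀ x : B) (v : F) : frameAt IB F E x₀ x v = frame IB F E x₀ v x := rfl

theorem frame_eventually (x₀ : B) : ∀ᶠ x in 𝓝 x₀, x ∈ (trivializationAt F E x₀).baseSet ∧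
    ∀ v, frame IB F E x₀ v x = (trivializationAt F E x₀).symm x v := by
  have h := (exists_bump_baseSet IB F E x₀).choose_spec
  filter_upwards [h.2.1, (trivializationAt F E x₀).open_baseSet.mem_nhds
    (FiberBundle.mem_baseSet_trivializationAt F E x₀)] with x hx hx'
  refine ⟨hx', fun v => ?_⟩
  change (exists_bump_baseSet IB F E x₀).choose x • (trivializationAt F E x₀).symmₗ ℝ x v = _
  rw [hx, one_smul, (trivializationAt F E x₀).coe_symmₗ hx']

theorem frame_coord_eventually (x₀ : B) : ∀ᶠ x in 𝓝 x₀, ∀ u : E x,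
    frame IB F E x₀ (trivializationAt F E x₀ ⟨x, u⟩).2 x = u := by
  filter_upwards [frame_eventually IB F E x₀] with x hx u
  rw [hx.2, (trivializationAt F E x₀).symm_apply_apply_mk hx.1]

theorem coord_frame_eventually (x₀ : B) : ∀ᶠ x in 𝓝 x₀, ∀ v : F,
    (trivializationAt F E x₀ ⟨x, frame IB F E x₀ v x⟩).2 = v := by
  filter_upwards [frame_eventually IB F E x₀] with x hx v
  rw [hx.2, (trivializationAt F E x₀).apply_mk_symm hx.1]

theorem frameAt_bijective_eventually (x₀ : B) :
    ∀ᶠ x in 𝓝 x₀, Function.Bijective (frameAt IB F E x₀ x) := by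
  filter_upwards [frame_coord_eventually IB F E x₀, coord_frame_eventually IB F E x₀] with x h1 h2
  exact ⟨Function.LeftInverse.injective (g := fun u => (trivializationAt F E x₀ ⟨x, u⟩).2) h2,
    fun u => ⟨_, h1 u⟩⟩

/-- Every vector extends to a smooth global section. -/
theorem exists_section (x₀ : B) (u : E x₀) : ∃ A : ContMDiffSection IB F ∞ E, A x₀ = u :=
  ⟨_, (frame_coord_eventually IB F E x₀).self_of_nhds u⟩

end Frame

section Along

variable {ES HS S : Type*} [NormedAddCommGroup ES] [NormedSpace ℝ ES] [TopologicalSpace HS]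
  {J : ModelWithCorners ℝ ES HS} [TopologicalSpace S] [ChartedSpace HS S]
  {EB HB B : Type*} [NormedAddCommGroup EB] [NormedSpace ℝ EB] [FiniteDimensional ℝ EB]
  [TopologicalSpace HB] {IB : ModelWithCorners ℝ EB HB} [TopologicalSpace B] [ChartedSpace HB B]
  [IsManifold IB ∞ B] [T2Space B]
  {F : Type*} [NormedAddCommGroup F] [NormedSpace ℝ F] [FiniteDimensional ℝ F]
  {E : B → Type*} [∀ x, AddCommGroup (E x)] [∀ x, Module ℝ (E x)] [∀ x, TopologicalSpace (E x)]
  [TopologicalSpace (TotalSpace F E)] [FiberBundle F E] [VectorBundle ℝ F E]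
  [ContMDiffVectorBundle ∞ F E IB]
  {F' : Type*} [NormedAddCommGroup F'] [NormedSpace ℝ F']
  {g : S → B} {s₀ : S}

/-- A family of linear maps on the fibres along `g` which is smooth on global sections is smooth on
sections along `g`. -/
theorem contMDiffAt_linear_apply {σ : ∀ s, E (g s)}
    (hσ : ContMDiffAt J (IB.prod 𝓘(ℝ, F)) ∞ (fun s => (⟨g s, σ s⟩ : TotalSpace F E)) s₀)
    (Λ : ∀ s, E (g s) →ₗ[ℝ] F')
    (hΛ : ∀ A : ContMDiffSection IB F ∞ E, ContMDiffAt J 𝓘(ℝ, F') ∞ (fun s => Λ s (A (g s))) s₀) :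
    ContMDiffAt J 𝓘(ℝ, F') ∞ (fun s => Λ s (σ s)) s₀ := by
  obtain ⟨hg, hc⟩ := contMDiffAt_totalSpace.1 hσ
  simp only at hg hc
  let b := Module.finBasis ℝ F
  -- Expanding `σ` in the frame leaves smooth coefficients times `Λ` of global sections.
  have hsum : (fun s => Λ s (σ s)) =ᶠ[𝓝 s₀] fun s =>
      ∑ i, LinearMap.toContinuousLinearMap (b.coord i) (trivializationAt F E (g s₀) ⟨g s, σ s⟩).2 •
        Λ s (frame IB F E (g s₀) (b i) (g s)) := by
    filter_upwards [hg.continuousAt.eventually (frame_coord_eventually IB F E (g s₀))] with s hs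
    conv_lhs => rw [← hs (σ s), ← b.sum_repr (trivializationAt F E (g s₀) ⟨g s, σ s⟩).2]
    rw [← frameAt_apply, map_sum, map_sum]
    simp
  refine ContMDiffAt.congr_of_eventuallyEq ?_ hsum
  refine contMDiffAt_finsetSum fun i _ => ?_
  exact ((ContinuousLinearMap.contMDiff _).contMDiffAt.comp s₀ hc).smul (hΛ _)

/-- If a family of linear maps along `g` is smooth on global sections and invertible at `s₀`, then
a section along `g` with smooth image is smooth. -/
theorem contMDiffAt_of_linear_apply {σ : ∀ s, E (g s)} (hg : ContMDiffAt J IB ∞ g s₀)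
    (Λ : ∀ s, E (g s) →ₗ[ℝ] F')
    (hΛ : ∀ A : ContMDiffSection IB F ∞ E, ContMDiffAt J 𝓘(ℝ, F') ∞ (fun s => Λ s (A (g s))) s₀)
    (hinv : Function.Bijective (Λ s₀))
    (hσ : ContMDiffAt J 𝓘(ℝ, F') ∞ (fun s => Λ s (σ s)) s₀) :
    ContMDiffAt J (IB.prod 𝓘(ℝ, F)) ∞ (fun s => (⟨g s, σ s⟩ : TotalSpace F E)) s₀ := by
  rw [contMDiffAt_totalSpace]
  refine ⟨hg, ?_⟩
  refine contMDiffAt_of_clm_apply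
    (L := fun s => LinearMap.toContinuousLinearMap (Λ s ∘ₗ frameAt IB F E (g s₀) (g s)))
    (contMDiffAt_clm_of_apply fun v => hΛ (frame IB F E (g s₀) v)) ?_ ?_
  · exact hinv.comp (frameAt_bijective_eventually IB F E (g s₀)).self_of_nhds
  · refine hσ.congr_of_eventuallyEq ?_
    filter_upwards [hg.continuousAt.eventually (frame_coord_eventually IB F E (g s₀))] with s hs
    change Λ s (frame IB F E (g s₀) _ (g s)) = _
    rw [hs]

end Along

end SmoothBundle

/-! ### Coordinate fields and derivatives in preferred charts -/

namespace ExtGeom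

namespace BundleMfd

/-- The model space of the base. -/
abbrev Coord (V : BundleMfd.{u}) : Type := EuclideanSpace ℝ (Fin V.dim)

/-- Global vector fields which are constant in the preferred chart near a point. -/
def constField {V : BundleMfd.{u}} (x₀ : V.carrier) : V.T x₀ →ₗ[ℝ] V.VField :=
  SmoothBundle.frame V.I V.Coord V.T x₀

/-- The coordinates of a tangent vector in the preferred chart at `x₀`. -/
def coordT {V : BundleMfd.{u}} (x₀ x : V.carrier) (X : V.T x) : V.Coord :=
  (trivializationAt V.Coord V.T x₀ ⟨x, X⟩).2

/-- The derivative at `x` of a function with values in a normed space, in the preferred chart. -/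
def dAt {V : BundleMfd.{u}} {F : Type*} [NormedAddCommGroup F] [NormedSpace ℝ F]
    (g : V.carrier → F) (x : V.carrier) : V.T x →L[ℝ] F :=
  (fderiv ℝ (g ∘ (extChartAt V.I x).symm) (extChartAt V.I x x) : V.Coord →L[ℝ] F)

variable {V : BundleMfd.{u}} {F : Type*} [NormedAddCommGroup F] [NormedSpace ℝ F]

theorem mfderiv_eq_dAt {g : V.carrier → F} {x : V.carrier}
    (hg : MDifferentiableAt V.I 𝓘(ℝ, F) g x) (X : V.T x) :
    (mfderiv V.I 𝓘(ℝ, F) g x X : F) = dAt g x X := by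
  rw [hg.mfderiv, dAt]
  simp only [writtenInExtChartAt, extChartAt_model_space_eq_id, ModelWithCorners.range_eq_univ,
    fderivWithin_univ]
  rfl

theorem contDiffAt_comp_symm {g : V.carrier → F} {x : V.carrier}
    (hg : ContMDiffAt V.I 𝓘(ℝ, F) ∞ g x) :
    ContDiffAt ℝ ∞ (g ∘ (extChartAt V.I x).symm) (extChartAt V.I x x) := by
  have h := (contMDiffAt_iff.1 hg).2
  simp only [ModelWithCorners.range_eq_univ, contDiffWithinAt_univ,
    extChartAt_model_space_eq_id] at h
  exact h

theorem eventually_symm {x : V.carrier} {p : V.carrier → Prop} (h : ∀ᶠ y in 𝓝 x, p y) :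
    ∀ᶠ z in 𝓝 (extChartAt V.I x x), p ((extChartAt V.I x).symm z) := by
  have := continuousAt_extChartAt_symm (I := V.I) x
  rw [ContinuousAt, extChartAt_to_inv] at this
  exact this.eventually h

theorem dAt_congr {g g' : V.carrier → F} {x : V.carrier} (h : g =ᶠ[𝓝 x] g') :
    dAt g x = dAt g' x :=
  Filter.EventuallyEq.fderiv_eq (eventually_symm h)

theorem coordT_eq {x₀ x : V.carrier} (hx : x ∈ (chartAt V.Coord x₀).source) (X : V.T x) :
    coordT x₀ x X = mfderiv V.I 𝓘(ℝ, V.Coord) (extChartAt V.I x₀) x X := by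
  have hb : x ∈ (trivializationAt V.Coord V.T x₀).baseSet := by simpa using hx
  have h1 := DFunLike.congr_fun
    (TangentBundle.continuousLinearMapAt_trivializationAt (I := V.I) hx) X
  have h2 := congrFun ((trivializationAt V.Coord V.T x₀).coe_linearMapAt_of_mem (R := ℝ) hb) X
  exact h2.symm.trans h1

theorem coordT_self (x : V.carrier) (X : V.T x) : coordT x x X = X := by
  rw [coordT_eq (mem_chart_source _ x), mfderiv_extChartAt_self]
  rfl

/-- The preferred trivialization of the tangent bundle is the derivative of the chart. Hence, where
the cut-off is 1, the constant fields are the coordinate fields and invert `coordT`. -/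
theorem constField_eventually (x₀ : V.carrier) : ∀ᶠ x in 𝓝 x₀,
    x ∈ (chartAt V.Coord x₀).source ∧ (∀ v, coordT x₀ x (constField x₀ v x) = v) ∧
    (∀ X, constField x₀ (coordT x₀ x X) x = X) ∧
    ∀ v, constField x₀ v x = mfderiv 𝓘(ℝ, V.Coord) V.I (extChartAt V.I x₀).symm
      (extChartAt V.I x₀ x) v := by
  filter_upwards [SmoothBundle.frame_eventually V.I V.Coord V.T x₀,
    SmoothBundle.frame_coord_eventually V.I V.Coord V.T x₀,
    SmoothBundle.coord_frame_eventually V.I V.Coord V.T x₀] with x h1 h2 h3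
  have hx : x ∈ (chartAt V.Coord x₀).source := by simpa using h1.1
  refine ⟨hx, h3, h2, fun v => ?_⟩
  have := TangentBundle.symmL_trivializationAt (I := V.I) hx
  rw [ModelWithCorners.range_eq_univ, mfderivWithin_univ] at this
  exact (h1.2 v).trans (((trivializationAt V.Coord V.T x₀).symmL_apply (R := ℝ) h1.1 v).symm.trans
    (DFunLike.congr_fun this v))

theorem constField_self (x₀ : V.carrier) (v : V.Coord) : constField x₀ v x₀ = v := by
  have := (constField_eventually x₀).self_of_nhds.2.1 v
  rwa [coordT_self] at this

end BundleMfd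

end ExtGeom

/-! ### Smoothness of differential forms -/

instance ContinuousAlternatingMap.finiteDimensional_real {E ι : Type*} [NormedAddCommGroup E]
    [NormedSpace ℝ E] [FiniteDimensional ℝ E] [Fintype ι] : FiniteDimensional ℝ (E [⋀^ι]→L[ℝ] ℝ) := by
  let Φ : (E [⋀^ι]→L[ℝ] ℝ) →ₗ[ℝ] MultilinearMap ℝ (fun _ : ι => E) ℝ :=
    { toFun := fun α => α.toContinuousMultilinearMap.toMultilinearMap
      map_add' := fun _ _ => rfl
      map_smul' := fun _ _ => rfl }
  refine FiniteDimensional.of_injective Φ fun α β h => ?_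
  ext v
  exact congrArg (fun f : MultilinearMap ℝ (fun _ : ι => E) ℝ => f v) h

/-- Evaluation of alternating maps at a fixed family of vectors. -/
def ContinuousAlternatingMap.evalCLM {E ι : Type*} [NormedAddCommGroup E] [NormedSpace ℝ E]
    [FiniteDimensional ℝ E] [Fintype ι] (v : ι → E) : (E [⋀^ι]→L[ℝ] ℝ) →L[ℝ] ℝ :=
  LinearMap.toContinuousLinearMap
    { toFun := fun α => α v
      map_add' := fun _ _ => rfl
      map_smul' := fun _ _ => rfl }

/-- A family of alternating forms is smooth if its values are. -/
theorem contMDiffAt_alternating_of_apply {ES HS S E ι : Type*} [NormedAddCommGroup ES]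
    [NormedSpace ℝ ES] [TopologicalSpace HS] {J : ModelWithCorners ℝ ES HS} [TopologicalSpace S]
    [ChartedSpace HS S] [NormedAddCommGroup E] [NormedSpace ℝ E] [FiniteDimensional ℝ E] [Fintype ι]
    {α : S → E [⋀^ι]→L[ℝ] ℝ} {s₀ : S} (h : ∀ v, ContMDiffAt J 𝓘(ℝ, ℝ) ∞ (fun s => α s v) s₀) :
    ContMDiffAt J 𝓘(ℝ, E [⋀^ι]→L[ℝ] ℝ) ∞ α s₀ := by
  classical
  let b := Module.finBasis ℝ E
  -- An alternating form is determined by its values on tuples of basis vectors. A linear left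
  -- inverse of this embedding recovers the family from finitely many smooth functions.
  let Φ : (E [⋀^ι]→L[ℝ] ℝ) →ₗ[ℝ] ((ι → Fin (Module.finrank ℝ E)) → ℝ) :=
    LinearMap.pi fun r => (ContinuousAlternatingMap.evalCLM fun i => b (r i)).toLinearMap
  have hΦ : LinearMap.ker Φ = ⊥ := by
    rw [LinearMap.ker_eq_bot]
    intro β γ hβγ
    apply ContinuousAlternatingMap.toAlternatingMap_injective
    refine Module.Basis.ext_alternating b fun v _ => ?_
    exact congrFun hβγ v
  obtain ⟨Ψ, hΨ⟩ := Φ.exists_leftInverse_of_injective hΦ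
  have hα : α = fun s => LinearMap.toContinuousLinearMap Ψ (Φ (α s)) := by
    funext s
    exact (LinearMap.congr_fun hΨ (α s)).symm
  rw [hα]
  refine (ContinuousLinearMap.contMDiff _).contMDiffAt.comp s₀ ?_
  rw [contMDiffAt_pi_space]
  exact fun r => h _

namespace ExtGeom

open BundleMfd

variable {V W : BundleMfd.{u}} {k : ℕ}

/-- The differential of a smooth map takes smooth vector fields along a map to such. -/
theorem contMDiffAt_mfderiv_along {ES HS S : Type*} [NormedAddCommGroup ES] [NormedSpace ℝ ES]
    [TopologicalSpace HS] {J : ModelWithCorners ℝ ES HS} [TopologicalSpace S] [ChartedSpace HS S]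
    {f : V.carrier → W.carrier} (hf : ContMDiff V.I W.I ∞ f) {g : S → V.carrier} {s₀ : S}
    {X : ∀ s, V.T (g s)}
    (hX : ContMDiffAt J V.I.tangent ∞ (fun s => (⟨g s, X s⟩ : TangentBundle V.I V.carrier)) s₀) :
    ContMDiffAt J W.I.tangent ∞
      (fun s => (⟨f (g s), mfderiv V.I W.I f (g s) (X s)⟩ : TangentBundle W.I W.carrier)) s₀ := by
  have h := (hf.contMDiff_tangentMap (m := ∞) (by simp)).contMDiffAt.comp s₀ hX
  exact h

namespace FormField

/-- Every tangent space is definitionally the model space, so one tuple of coordinates serves both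
points and no transport along `h` is needed. -/
theorem apply_congr_point (α : FormField V k) {p x : V.carrier} (h : p = x) (v : Fin k → V.Coord) :
    α p v = α x v := by
  subst h; rfl

theorem inChart_apply (α : FormField V k) (x₀ : V.carrier) : ∀ᶠ x in 𝓝 x₀, ∀ v : Fin k → V.Coord,
    α.inChart x₀ (extChartAt V.I x₀ x) v = α x (fun i => constField x₀ (v i) x) := by
  filter_upwards [constField_eventually x₀] with x hx v
  have h1 : α.inChart x₀ (extChartAt V.I x₀ x) v =
      α ((extChartAt V.I x₀).symm (extChartAt V.I x₀ x)) fun i =>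
        mfderiv 𝓘(ℝ, V.Coord) V.I (extChartAt V.I x₀).symm (extChartAt V.I x₀ x) (v i) := rfl
  rw [h1]
  refine (apply_congr_point α ((extChartAt V.I x₀).left_inv (by simpa using hx.1)) _).trans ?_
  exact congrArg (α x) (funext fun i => (hx.2.2.2 (v i)).symm)

/-- A form which is smooth on constant fields is smooth on vector fields along a map. -/
theorem contMDiffAt_apply_of_const {ES HS S : Type*} [NormedAddCommGroup ES] [NormedSpace ℝ ES]
    [TopologicalSpace HS] {J : ModelWithCorners ℝ ES HS} [TopologicalSpace S] [ChartedSpace HS S]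
    {α : FormField V k} {g : S → V.carrier} {s₀ : S}
    (h : ∀ v : Fin k → V.Coord, ContMDiffAt V.I 𝓘(ℝ, ℝ) ∞
      (fun x => α x (fun i => constField (g s₀) (v i) x)) (g s₀))
    (hg : ContMDiffAt J V.I ∞ g s₀) {X : Fin k → ∀ s, V.T (g s)}
    (hX : ∀ i, ContMDiffAt J V.I.tangent ∞
      (fun s => (⟨g s, X i s⟩ : TangentBundle V.I V.carrier)) s₀) :
    ContMDiffAt J 𝓘(ℝ, ℝ) ∞ (fun s => α (g s) (fun i => X i s)) s₀ := by
  classical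
  let b := Module.finBasis ℝ V.Coord
  have hc : ∀ i, ContMDiffAt J 𝓘(ℝ, V.Coord) ∞ (fun s => coordT (g s₀) (g s) (X i s)) s₀ :=
    fun i => (contMDiffAt_totalSpace.1 (hX i)).2
  have hsum : (fun s => α (g s) (fun i => X i s)) =ᶠ[𝓝 s₀] fun s =>
      ∑ r : Fin k → Fin (Module.finrank ℝ V.Coord),
        (∏ i, LinearMap.toContinuousLinearMap (b.coord (r i)) (coordT (g s₀) (g s) (X i s))) *
          α (g s) (fun i => constField (g s₀) (b (r i)) (g s)) := by
    filter_upwards [hg.continuousAt.eventually (constField_eventually (g s₀))] with s hs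
    have h1 : ∀ i, X i s = ∑ j, b.coord j (coordT (g s₀) (g s) (X i s)) •
        constField (g s₀) (b j) (g s) := fun i => by
      conv_lhs => rw [← hs.2.2.1 (X i s), ← b.sum_repr (coordT (g s₀) (g s) (X i s))]
      change (SmoothBundle.frame V.I V.Coord V.T (g s₀) (∑ j, _ • b j)) (g s) = _
      rw [map_sum]
      have h2 : ∀ (t : Finset (Fin (Module.finrank ℝ V.Coord)))
          (A : Fin (Module.finrank ℝ V.Coord) → V.VField), (∑ j ∈ t, A j) (g s) =
            ∑ j ∈ t, A j (g s) := fun t A => by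
        induction t using Finset.induction_on with
        | empty => rfl
        | insert j t hj ih =>
          rw [Finset.sum_insert hj, Finset.sum_insert hj, ← ih]; rfl
      rw [h2]
      refine Finset.sum_congr rfl fun j _ => ?_
      exact congrArg (fun A : V.VField => A (g s)) (map_smul
        (SmoothBundle.frame V.I V.Coord V.T (g s₀)) _ (b j))
    have h2 : (fun i => X i s) = fun i => ∑ j, b.coord j (coordT (g s₀) (g s) (X i s)) •
        constField (g s₀) (b j) (g s) := funext h1
    rw [h2]
    refine ((α (g s)).toContinuousMultilinearMap.toMultilinearMap.map_sum _).trans ?_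
    refine Finset.sum_congr rfl fun r _ => ?_
    exact (α (g s)).toContinuousMultilinearMap.toMultilinearMap.map_smul_univ _ _
  refine ContMDiffAt.congr_of_eventuallyEq ?_ hsum
  refine contMDiffAt_finsetSum fun r _ => ?_
  refine ContMDiffAt.mul ?_ ((h _).comp s₀ hg)
  refine contMDiffAt_finsetProd fun i _ => ?_
  exact (ContinuousLinearMap.contMDiff _).contMDiffAt.comp s₀ (hc i)

theorem IsSmooth.contDiffAt_inChart {α : FormField V k} (hα : α.IsSmooth) (x₀ : V.carrier) :
    ContDiffAt ℝ ∞ (α.inChart x₀) (extChartAt V.I x₀ x₀) :=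
  (hα x₀).contDiffAt ((isOpen_extChartAt_target x₀).mem_nhds (mem_extChartAt_target x₀))

/-- A form is smooth iff its values on constant fields are smooth. -/
theorem isSmooth_iff_const {α : FormField V k} : α.IsSmooth ↔ ∀ (x₀ : V.carrier)
    (v : Fin k → V.Coord), ContMDiffAt V.I 𝓘(ℝ, ℝ) ∞
      (fun x => α x (fun i => constField x₀ (v i) x)) x₀ := by
  constructor
  · intro hα x₀ v
    refine ContMDiffAt.congr_of_eventuallyEq ?_
      ((inChart_apply α x₀).mono fun x hx => (hx v).symm)
    have h1 : ContMDiffAt V.I 𝓘(ℝ, V.Coord [⋀^Fin k]→L[ℝ] ℝ) ∞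
        (fun x => α.inChart x₀ (extChartAt V.I x₀ x)) x₀ :=
      (hα.contDiffAt_inChart x₀).contMDiffAt.comp x₀ contMDiffAt_extChartAt
    exact (ContinuousAlternatingMap.evalCLM v).contMDiff.contMDiffAt.comp x₀ h1
  · intro h x₀ y hy
    refine ContDiffAt.contDiffWithinAt ?_
    rw [← contMDiffAt_iff_contDiffAt]
    refine contMDiffAt_alternating_of_apply fun v => ?_
    have hx : (extChartAt V.I x₀).symm y ∈ (chartAt V.Coord x₀).source := by
      simpa using (extChartAt V.I x₀).map_target hy
    have hg : ContMDiffAt 𝓘(ℝ, V.Coord) V.I ∞ (extChartAt V.I x₀).symm y :=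
      (contMDiffOn_extChartAt_symm x₀).contMDiffAt ((isOpen_extChartAt_target x₀).mem_nhds hy)
    -- The coefficients of the chart expression are values of `α` on the coordinate fields along the
    -- inverse chart. These fields are smooth since they are constant in the trivialization at `x₀`.
    refine contMDiffAt_apply_of_const (h _) hg fun i => ?_
    rw [(trivializationAt V.Coord V.T x₀).contMDiffAt_iff]
    · refine ⟨hg, (contMDiffAt_const (c := v i)).congr_of_eventuallyEq ?_⟩
      filter_upwards [(isOpen_extChartAt_target x₀).mem_nhds hy] with z hz
      have hz' : (extChartAt V.I x₀).symm z ∈ (chartAt V.Coord x₀).source := by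
        simpa using (extChartAt V.I x₀).map_target hz
      have h1 := coordT_eq hz' (mfderiv 𝓘(ℝ, V.Coord) V.I (extChartAt V.I x₀).symm z (v i))
      refine h1.trans ?_
      have h2 := mfderiv_extChartAt_comp_mfderivWithin_extChartAt_symm (I := V.I) hz
      rw [ModelWithCorners.range_eq_univ, mfderivWithin_univ] at h2
      exact DFunLike.congr_fun h2 (v i)
    · simpa using hx

theorem IsSmooth.contMDiffAt_apply {ES HS S : Type*} [NormedAddCommGroup ES] [NormedSpace ℝ ES]
    [TopologicalSpace HS] {J : ModelWithCorners ℝ ES HS} [TopologicalSpace S] [ChartedSpace HS S]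
    {α : FormField V k} (hα : α.IsSmooth) {g : S → V.carrier} {s₀ : S}
    (hg : ContMDiffAt J V.I ∞ g s₀) {X : Fin k → ∀ s, V.T (g s)}
    (hX : ∀ i, ContMDiffAt J V.I.tangent ∞
      (fun s => (⟨g s, X i s⟩ : TangentBundle V.I V.carrier)) s₀) :
    ContMDiffAt J 𝓘(ℝ, ℝ) ∞ (fun s => α (g s) (fun i => X i s)) s₀ :=
  contMDiffAt_apply_of_const (isSmooth_iff_const.1 hα _) hg hX

theorem IsSmooth.add {α β : FormField V k} (hα : α.IsSmooth) (hβ : β.IsSmooth) :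
    IsSmooth (α + β : FormField V k) :=
  isSmooth_iff_const.2 fun x₀ v =>
    (isSmooth_iff_const.1 hα x₀ v).add (isSmooth_iff_const.1 hβ x₀ v)

theorem IsSmooth.sub {α β : FormField V k} (hα : α.IsSmooth) (hβ : β.IsSmooth) :
    IsSmooth (α - β : FormField V k) :=
  isSmooth_iff_const.2 fun x₀ v =>
    (isSmooth_iff_const.1 hα x₀ v).sub (isSmooth_iff_const.1 hβ x₀ v)

theorem isSmooth_zero : IsSmooth (0 : FormField V k) :=
  isSmooth_iff_const.2 fun _ _ => contMDiffAt_const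

theorem IsSmooth.pullback {f : V.carrier → W.carrier} (hf : ContMDiff V.I W.I ∞ f)
    {α : FormField W k} (hα : α.IsSmooth) : IsSmooth (FormField.pullback f α) :=
  isSmooth_iff_const.2 fun _ v => hα.contMDiffAt_apply hf.contMDiffAt fun i =>
    contMDiffAt_mfderiv_along (g := id) hf (constField _ (v i)).contMDiff_toFun.contMDiffAt

end FormField

end ExtGeom

/-! ### The exterior derivative and its naturality -/

namespace ExtGeom

open BundleMfd

namespace FormField

variable {V W P : BundleMfd.{u}} {k : ℕ}

theorem d_eq (α : FormField V k) (x : V.carrier) (v : Fin (k + 1) → V.Coord) :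
    α.d x v = extDeriv (α.inChart x) (extChartAt V.I x x) v := by
  change extDeriv (α.inChart x) (extChartAt V.I x x)
    (fun i => mfderiv V.I 𝓘(ℝ, V.Coord) (extChartAt V.I x) x (v i)) = _
  rw [mfderiv_extChartAt_self]
  rfl

theorem fderiv_inChart (α : FormField V k) (x : V.carrier) (v : Fin k → V.Coord) :
    fderiv ℝ (fun y => α.inChart x y v) (extChartAt V.I x x) =
      dAt (fun y => α y fun i => constField x (v i) y) x := by
  refine Filter.EventuallyEq.fderiv_eq ?_
  filter_upwards [eventually_symm (inChart_apply α x),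
    (isOpen_extChartAt_target x).mem_nhds (mem_extChartAt_target (I := V.I) x)] with y hy hy'
  have := hy v
  rw [(extChartAt V.I x).right_inv hy'] at this
  exact this

/-- Coordinate fields commute, so no bracket terms occur in the invariant formula for `d`. -/
theorem d_apply {α : FormField V k} (hα : α.IsSmooth) (x : V.carrier)
    (v : Fin (k + 1) → V.T x) :
    α.d x v = ∑ i, (-1) ^ i.val •
      dAt (fun y => α y fun j => constField x (i.removeNth v j) y) x (v i) := by
  refine (d_eq α x v).trans
    ((extDeriv_apply ((hα.contDiffAt_inChart x).differentiableAt (by simp)) v).trans ?_)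
  refine Finset.sum_congr rfl fun i _ => congrArg _ ?_
  exact DFunLike.congr_fun (fderiv_inChart α x (i.removeNth v)) (v i)

theorem d_apply_two {α : FormField V 2} (hα : α.IsSmooth) (x : V.carrier) (X Y Z : V.T x) :
    α.d x ![X, Y, Z] = dAt (fun y => α y ![constField x Y y, constField x Z y]) x X
      - dAt (fun y => α y ![constField x X y, constField x Z y]) x Y
      + dAt (fun y => α y ![constField x X y, constField x Y y]) x Z := by
  refine (d_apply hα x ![X, Y, Z]).trans ?_
  have h : ∀ (i : Fin 3) (v w : V.T x), i.removeNth ![X, Y, Z] = ![v, w] →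
      (fun y => α y fun j => constField x (i.removeNth ![X, Y, Z] j) y) =
        fun y => α y ![constField x v y, constField x w y] := by
    intro i v w h
    funext y
    refine congrArg (α y) (funext fun j => ?_)
    rw [h]
    fin_cases j <;> rfl
  rw [Fin.sum_univ_three, h 0 Y Z (by ext j; fin_cases j <;> rfl),
    h 1 X Z (by ext j; fin_cases j <;> rfl), h 2 X Y (by ext j; fin_cases j <;> rfl)]
  simp [sub_eq_add_neg]

theorem d_add {α β : FormField V k} (hα : α.IsSmooth) (hβ : β.IsSmooth) :
    FormField.d (α + β : FormField V k) = α.d + β.d := by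
  funext x
  ext v
  have h : FormField.inChart (α + β : FormField V k) x = α.inChart x + β.inChart x := rfl
  refine (d_eq _ x v).trans ?_
  rw [h, extDeriv_add ((hα.contDiffAt_inChart x).differentiableAt (by simp))
    ((hβ.contDiffAt_inChart x).differentiableAt (by simp))]
  exact congrArg₂ (· + ·) (d_eq α x v).symm (d_eq β x v).symm

theorem d_zero : FormField.d (0 : FormField V k) = 0 := by
  have h := d_add (V := V) (k := k) isSmooth_zero isSmooth_zero
  rw [add_zero] at h
  exact left_eq_add.1 h

theorem pullback_add (f : V.carrier → W.carrier) (α β : FormField W k) :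
    pullback f (α + β : FormField W k) = pullback f α + pullback f β := rfl

theorem pullback_id (α : FormField V k) : pullback id α = α := by
  funext x
  ext v
  change α x (fun i => mfderiv V.I V.I id x (v i)) = α x v
  rw [mfderiv_id]
  rfl

theorem pullback_comp {f : V.carrier → W.carrier} {g : W.carrier → P.carrier}
    (hf : ContMDiff V.I W.I ∞ f) (hg : ContMDiff W.I P.I ∞ g) (α : FormField P k) :
    pullback (g ∘ f) α = pullback f (pullback g α) := by
  funext x
  ext v
  change α (g (f x)) (fun i => mfderiv V.I P.I (g ∘ f) x (v i)) = _
  rw [mfderiv_comp x ((hg _).mdifferentiableAt (by simp)) ((hf _).mdifferentiableAt (by simp))]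
  rfl

/-- The exterior derivative commutes with pullback. -/
theorem d_pullback {f : V.carrier → W.carrier} (hf : ContMDiff V.I W.I ∞ f) {α : FormField W k}
    (hα : α.IsSmooth) : (pullback f α).d = pullback f α.d := by
  funext x
  ext v
  let fh : V.Coord → W.Coord := extChartAt W.I (f x) ∘ f ∘ (extChartAt V.I x).symm
  have hfh : ContDiffAt ℝ ∞ fh (extChartAt V.I x x) := by
    have h := (contMDiffAt_iff.1 (hf x)).2
    simp only [ModelWithCorners.range_eq_univ, contDiffWithinAt_univ] at h
    exact h
  have hfx : fh (extChartAt V.I x x) = extChartAt W.I (f x) (f x) := by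
    simp [fh]
  have hfd : mfderiv V.I W.I f x = fderiv ℝ fh (extChartAt V.I x x) := by
    rw [((hf x).mdifferentiableAt (by simp)).mfderiv]
    simp only [writtenInExtChartAt, ModelWithCorners.range_eq_univ, fderivWithin_univ]
    rfl
  -- In charts the pullback of `α` is the pullback of its chart expression by the chart expression
  -- `fh` of `f`, by the chain rule. This reduces the claim to naturality of `extDeriv` on vector
  -- spaces.
  have heq : (pullback f α).inChart x =ᶠ[𝓝 (extChartAt V.I x x)] fun y =>
      (α.inChart (f x) (fh y)).compContinuousLinearMap (fderiv ℝ fh y) := by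
    have h2 : ∀ᶠ z in 𝓝 x, f z ∈ (extChartAt W.I (f x)).source :=
      hf.continuous.continuousAt.eventually
        (extChartAt_source_mem_nhds (I := W.I) (f x))
    filter_upwards [eventually_symm h2,
      (isOpen_extChartAt_target x).mem_nhds (mem_extChartAt_target (I := V.I) x)] with y h2 h4
    ext v
    have e1 : (pullback f α).inChart x y v = α (f ((extChartAt V.I x).symm y)) fun i =>
      mfderiv V.I W.I f ((extChartAt V.I x).symm y)
        (mfderiv 𝓘(ℝ, V.Coord) V.I (extChartAt V.I x).symm y (v i)) := rfl
    have e2 : (α.inChart (f x) (fh y)).compContinuousLinearMap (fderiv ℝ fh y) v =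
      α ((extChartAt W.I (f x)).symm (fh y)) fun i =>
        mfderiv 𝓘(ℝ, W.Coord) W.I (extChartAt W.I (f x)).symm (fh y) (fderiv ℝ fh y (v i)) := rfl
    rw [e1, e2]
    have e3 : (extChartAt W.I (f x)).symm (fh y) = f ((extChartAt V.I x).symm y) :=
      (extChartAt W.I (f x)).left_inv h2
    refine Eq.trans ?_ (apply_congr_point α e3 _).symm
    refine congrArg (α _) (funext fun i => ?_)
    have hsymm : MDifferentiableAt 𝓘(ℝ, V.Coord) V.I (extChartAt V.I x).symm y :=
      ((contMDiffOn_extChartAt_symm (n := ∞) x).contMDiffAt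
        ((isOpen_extChartAt_target x).mem_nhds h4)).mdifferentiableAt (by simp)
    have hfz : MDifferentiableAt V.I W.I f ((extChartAt V.I x).symm y) :=
      (hf _).mdifferentiableAt (by simp)
    have hk : MDifferentiableAt W.I 𝓘(ℝ, W.Coord) (extChartAt W.I (f x))
        (f ((extChartAt V.I x).symm y)) := mdifferentiableAt_extChartAt (by simpa using h2)
    have hmf : (fderiv ℝ fh y (v i) : W.Coord) = mfderiv W.I 𝓘(ℝ, W.Coord) (extChartAt W.I (f x))
        (f ((extChartAt V.I x).symm y)) (mfderiv V.I W.I f ((extChartAt V.I x).symm y)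
          (mfderiv 𝓘(ℝ, V.Coord) V.I (extChartAt V.I x).symm y (v i))) := by
      have c0 : (fderiv ℝ fh y (v i) : W.Coord) = mfderiv 𝓘(ℝ, V.Coord) 𝓘(ℝ, W.Coord) fh y (v i) :=
        DFunLike.congr_fun mfderiv_eq_fderiv.symm (v i)
      have c1 := DFunLike.congr_fun (mfderiv_comp y (hk.comp _ hfz :
        MDifferentiableAt V.I 𝓘(ℝ, W.Coord) (extChartAt W.I (f x) ∘ f) _) hsymm) (v i)
      have c2 := DFunLike.congr_fun (mfderiv_comp _ hk hfz)
        (mfderiv 𝓘(ℝ, V.Coord) V.I (extChartAt V.I x).symm y (v i))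
      exact c0.trans (c1.trans c2)
    have h5 := mfderivWithin_extChartAt_symm_comp_mfderiv_extChartAt' (I := W.I) h2
    rw [ModelWithCorners.range_eq_univ, mfderivWithin_univ] at h5
    rw [hmf]
    exact (DFunLike.congr_fun h5 _).symm
  rw [show (pullback f α).d x v = _ from d_eq _ x v, heq.extDeriv_eq]
  rw [extDeriv_pullback (r := ∞) (by
    rw [hfx]; exact (hα.contDiffAt_inChart _).differentiableAt (by simp)) hfh
    (by simpa using (WithTop.coe_le_coe.2 le_top : ((2 : ℕ∞) : WithTop ℕ∞) ≤ ((⊤ : ℕ∞) : WithTop ℕ∞)))]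
  rw [hfx]
  refine Eq.trans ?_ (d_eq α (f x) (fun i => mfderiv V.I W.I f x (v i))).symm
  rw [hfd]
  rfl

end FormField

end ExtGeom

/-! ### Consequences of the Courant algebroid axioms -/

namespace ExtGeom

namespace BundleMfd

variable {V : BundleMfd.{u}} {F : Type*} [NormedAddCommGroup F] [NormedSpace ℝ F]

theorem dAt_const_mul {g : V.carrier → ℝ} {x : V.carrier} (c : ℝ)
    (hg : ContMDiffAt V.I 𝓘(ℝ, ℝ) ∞ g x) : dAt (fun y => c * g y) x = c • dAt g x :=
  fderiv_const_mul ((contDiffAt_comp_symm hg).differentiableAt (by simp)) c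

theorem dAt_mul {g h : V.carrier → ℝ} {x : V.carrier}
    (hg : ContMDiffAt V.I 𝓘(ℝ, ℝ) ∞ g x) (hh : ContMDiffAt V.I 𝓘(ℝ, ℝ) ∞ h x) (X : V.T x) :
    dAt (fun y => g y * h y) x X = g x * dAt h x X + h x * dAt g x X := by
  have := DFunLike.congr_fun (fderiv_mul ((contDiffAt_comp_symm hg).differentiableAt (by simp))
    ((contDiffAt_comp_symm hh).differentiableAt (by simp))) X
  refine this.trans ?_
  simp only [Function.comp, extChartAt_to_inv]
  rfl

theorem dAt_const (c : F) (x : V.carrier) : dAt (fun _ => c) x = 0 := by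
  have : ((fun _ : V.carrier => c) ∘ (extChartAt V.I x).symm) = fun _ => c := rfl
  rw [dAt, this, fderiv_const_apply]
  rfl

theorem dAt_clm {G : Type*} [NormedAddCommGroup G] [NormedSpace ℝ G] (L : F →L[ℝ] G)
    {g : V.carrier → F} {x : V.carrier} (hg : ContMDiffAt V.I 𝓘(ℝ, F) ∞ g x) (X : V.T x) :
    dAt (fun y => L (g y)) x X = L (dAt g x X) := by
  have h := (L.hasFDerivAt.comp (extChartAt V.I x x)
    ((contDiffAt_comp_symm hg).differentiableAt (by simp)).hasFDerivAt).fderiv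
  exact DFunLike.congr_fun h X

theorem contMDiffAt_dAt_along {ES HS S : Type*} [NormedAddCommGroup ES] [NormedSpace ℝ ES]
    [TopologicalSpace HS] {J : ModelWithCorners ℝ ES HS} [TopologicalSpace S] [ChartedSpace HS S]
    {h : V.carrier → F} (hh : ContMDiff V.I 𝓘(ℝ, F) ∞ h) {g : S → V.carrier} {s₀ : S}
    {X : ∀ s, V.T (g s)}
    (hX : ContMDiffAt J V.I.tangent ∞ (fun s => (⟨g s, X s⟩ : TangentBundle V.I V.carrier)) s₀) :
    ContMDiffAt J 𝓘(ℝ, F) ∞ (fun s => dAt h (g s) (X s)) s₀ := by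
  have h1 := (hh.contMDiff_tangentMap (m := ∞) (by simp)).contMDiffAt.comp s₀ hX
  have h2 := (contMDiff_snd_tangentBundle_modelSpace F 𝓘(ℝ, F) (n := ∞)).contMDiffAt.comp s₀ h1
  refine h2.congr_of_eventuallyEq (Eventually.of_forall fun s => ?_)
  exact (mfderiv_eq_dAt ((hh _).mdifferentiableAt (by simp)) (X s)).symm

theorem contMDiffAt_coordT_along {ES HS S : Type*} [NormedAddCommGroup ES] [NormedSpace ℝ ES]
    [TopologicalSpace HS] {J : ModelWithCorners ℝ ES HS} [TopologicalSpace S] [ChartedSpace HS S]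
    {g : S → V.carrier} {s₀ : S} {X : ∀ s, V.T (g s)}
    (hX : ContMDiffAt J V.I.tangent ∞ (fun s => (⟨g s, X s⟩ : TangentBundle V.I V.carrier)) s₀) :
    ContMDiffAt J 𝓘(ℝ, V.Coord) ∞ (fun s => coordT (g s₀) (g s) (X s)) s₀ :=
  (contMDiffAt_totalSpace.1 hX).2

/-- The product of a section with a smooth function. -/
def smulSec (h : V.carrier → ℝ) (hh : ContMDiff V.I 𝓘(ℝ, ℝ) ∞ h) (A : V.Sec) : V.Sec where
  toFun x := h x • A x
  contMDiff_toFun := hh.smul_section A.contMDiff_toFun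

@[simp] theorem smulSec_apply (h : V.carrier → ℝ) (hh : ContMDiff V.I 𝓘(ℝ, ℝ) ∞ h) (A : V.Sec)
    (x : V.carrier) : smulSec h hh A x = h x • A x := rfl

@[simp] theorem add_apply' (A B : V.Sec) (x : V.carrier) : (A + B) x = A x + B x := rfl
@[simp] theorem sub_apply' (A B : V.Sec) (x : V.carrier) : (A - B) x = A x - B x := rfl

/-- Global functions which agree with the preferred chart near a point. -/
theorem exists_chartFun (x₀ : V.carrier) : ∃ κ : V.carrier → V.Coord,
    ContMDiff V.I 𝓘(ℝ, V.Coord) ∞ κ ∧ ∀ᶠ y in 𝓝 x₀, ∀ X : V.T y, dAt κ y X = coordT x₀ y X := by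
  obtain ⟨χ, hχ, hχ1, hχs⟩ := SmoothBundle.exists_bump V.I
    (extChartAt_source_mem_nhds (I := V.I) x₀)
  let κ : V.carrier → V.Coord := fun x => χ x • extChartAt V.I x₀ x
  have hκ : ContMDiff V.I 𝓘(ℝ, V.Coord) ∞ κ := by
    intro x
    by_cases hx : x ∈ tsupport χ
    · exact (hχ x).smul (contMDiffAt_extChartAt' (by simpa using hχs hx))
    · refine (contMDiffAt_const (c := (0 : V.Coord))).congr_of_eventuallyEq ?_
      filter_upwards [(isClosed_tsupport χ).isOpen_compl.mem_nhds hx] with y hy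
      simp [κ, image_eq_zero_of_notMem_tsupport hy]
  refine ⟨κ, hκ, ?_⟩
  filter_upwards [hχ1.eventually_nhds, extChartAt_source_mem_nhds (I := V.I) x₀] with y hy hys X
  have hys' : y ∈ (chartAt V.Coord x₀).source := by simpa using hys
  rw [coordT_eq hys']
  have h1 : κ =ᶠ[𝓝 y] extChartAt V.I x₀ := hy.mono fun z hz => by simp [κ, hz]
  rw [dAt_congr h1]
  exact (mfderiv_eq_dAt (mdifferentiableAt_extChartAt hys') X).symm

theorem exists_sec (x : V.carrier) (u : V.fiber x) : ∃ A : V.Sec, A x = u :=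
  SmoothBundle.exists_section V.I V.Model V.fiber x u

end BundleMfd

open BundleMfd

namespace CourantAlgebroid

variable {V : BundleMfd.{u}} (C : CourantAlgebroid V)

section Along

variable {ES HS S : Type*} [NormedAddCommGroup ES] [NormedSpace ℝ ES]
  [TopologicalSpace HS] {J : ModelWithCorners ℝ ES HS} [TopologicalSpace S] [ChartedSpace HS S]
  {g : S → V.carrier} {s₀ : S}

/-- The axiom covers global sections only. The pairing is bilinear, so the arguments can be replaced
by sections along `g` one at a time. -/
theorem contMDiffAt_pairing {σ τ : ∀ s, V.fiber (g s)}
    (hσ : ContMDiffAt J (V.I.prod 𝓘(ℝ, V.Model)) ∞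
      (fun s => (⟨g s, σ s⟩ : TotalSpace V.Model V.fiber)) s₀)
    (hτ : ContMDiffAt J (V.I.prod 𝓘(ℝ, V.Model)) ∞
      (fun s => (⟨g s, τ s⟩ : TotalSpace V.Model V.fiber)) s₀) :
    ContMDiffAt J 𝓘(ℝ, ℝ) ∞ (fun s => C.pairing (g s) (σ s) (τ s)) s₀ := by
  have hg : ContMDiffAt J V.I ∞ g s₀ := (contMDiffAt_totalSpace.1 hσ).1
  refine SmoothBundle.contMDiffAt_linear_apply hτ (fun s => C.pairing (g s) (σ s)) fun A => ?_
  refine SmoothBundle.contMDiffAt_linear_apply hσ (fun s => (C.pairing (g s)).flip (A (g s)))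
    fun B => ?_
  exact (C.pairing_smooth B A).contMDiffAt.comp s₀ hg

theorem contMDiffAt_anchor {σ : ∀ s, V.fiber (g s)}
    (hσ : ContMDiffAt J (V.I.prod 𝓘(ℝ, V.Model)) ∞
      (fun s => (⟨g s, σ s⟩ : TotalSpace V.Model V.fiber)) s₀) :
    ContMDiffAt J V.I.tangent ∞
      (fun s => (⟨g s, C.anchor (g s) (σ s)⟩ : TangentBundle V.I V.carrier)) s₀ :=
  C.anchor_smooth.contMDiffAt.comp s₀ hσ

/-- A section along a map is smooth if its pairings with smooth sections are. -/
theorem contMDiffAt_of_pairing {σ : ∀ s, V.fiber (g s)} (hg : ContMDiffAt J V.I ∞ g s₀)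
    (h : ∀ A : V.Sec, ContMDiffAt J 𝓘(ℝ, ℝ) ∞ (fun s => C.pairing (g s) (σ s) (A (g s))) s₀) :
    ContMDiffAt J (V.I.prod 𝓘(ℝ, V.Model)) ∞
      (fun s => (⟨g s, σ s⟩ : TotalSpace V.Model V.fiber)) s₀ := by
  let φ : ∀ s, V.Model →ₗ[ℝ] V.fiber (g s) := fun s =>
    SmoothBundle.frameAt V.I V.Model V.fiber (g s₀) (g s)
  let Λ : ∀ s, V.fiber (g s) →ₗ[ℝ] (V.Model →L[ℝ] ℝ) := fun s =>
    (LinearMap.toContinuousLinearMap (𝕜 := ℝ) (E := V.Model) (F' := ℝ)).toLinearMap ∘ₗ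
      ((φ s).dualMap ∘ₗ C.pairing (g s))
  have hΛ : ∀ s u v, Λ s u v = C.pairing (g s) u (φ s v) := fun _ _ _ => rfl
  refine SmoothBundle.contMDiffAt_of_linear_apply hg Λ ?_ ?_ ?_
  · intro A
    refine SmoothBundle.contMDiffAt_clm_of_apply fun v => ?_
    exact (C.pairing_smooth A (SmoothBundle.frame V.I V.Model V.fiber (g s₀) v)).contMDiffAt.comp
      s₀ hg
  · have hφ := (SmoothBundle.frameAt_bijective_eventually V.I V.Model V.fiber
      (g s₀)).self_of_nhds
    have h1 : Function.Bijective (C.pairing (g s₀)) :=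
      ((C.pairing (g s₀)).toDual (C.pairing_nondegenerate _)).bijective
    have h2 : Function.Bijective (φ s₀).dualMap :=
      (LinearEquiv.ofBijective (φ s₀) hφ).dualMap.bijective
    exact (LinearMap.toContinuousLinearMap (𝕜 := ℝ) (E := V.Model) (F' := ℝ)).bijective.comp
      (h2.comp h1)
  · exact SmoothBundle.contMDiffAt_clm_of_apply fun v =>
      h (SmoothBundle.frame V.I V.Model V.fiber (g s₀) v)

end Along

/-- The vector field underlying a section. -/
def anchorField (A : V.Sec) : V.VField where
  toFun x := C.anchor x (A x)
  contMDiff_toFun := fun x => C.contMDiffAt_anchor (g := id) (A.contMDiff_toFun x)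

theorem pairing_ext {x : V.carrier} {u v : V.fiber x}
    (h : ∀ B : V.Sec, C.pairing x u (B x) = C.pairing x v (B x)) : u = v := by
  have h0 : u - v = 0 := (C.pairing_nondegenerate x).1 _ fun w => by
    obtain ⟨B, rfl⟩ := exists_sec x w
    simp [h B]
  exact sub_eq_zero.1 h0

theorem mdifferentiableAt_pairing (A B : V.Sec) (x : V.carrier) :
    MDifferentiableAt V.I 𝓘(ℝ, ℝ) (fun y => C.pairing y (A y) (B y)) x :=
  (C.pairing_smooth A B x).mdifferentiableAt (by simp)

theorem dAt_pairing_left (A B D : V.Sec) (x : V.carrier) :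
    dAt (fun y => C.pairing y (B y) (D y)) x (C.anchor x (A x)) =
      C.pairing x (A x) (C.bracket B D x + C.bracket D B x) :=
  (mfderiv_eq_dAt (C.mdifferentiableAt_pairing B D x) _).symm.trans (C.anchor_pairing_left A B D x)

theorem dAt_pairing_right (A B D : V.Sec) (x : V.carrier) :
    dAt (fun y => C.pairing y (B y) (D y)) x (C.anchor x (A x)) =
      C.pairing x (C.bracket A B x) (D x) + C.pairing x (B x) (C.bracket A D x) :=
  (mfderiv_eq_dAt (C.mdifferentiableAt_pairing B D x) _).symm.trans (C.anchor_pairing_right A B D x)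

/-- The Leibniz rule in the second argument. -/
theorem bracket_smulSec (A B : V.Sec) (h : V.carrier → ℝ) (hh : ContMDiff V.I 𝓘(ℝ, ℝ) ∞ h)
    (x : V.carrier) : C.bracket A (smulSec h hh B) x =
      h x • C.bracket A B x + dAt h x (C.anchor x (A x)) • B x := by
  -- The function `a(A)(h⟨B, D⟩)` is computed by the invariance axiom and by the product rule, and
  -- non-degeneracy removes `D`.
  refine C.pairing_ext fun D => ?_
  have h1 := C.dAt_pairing_right A (smulSec h hh B) D x
  have h2 := C.dAt_pairing_right A B D x
  have h3 : (fun y => C.pairing y (smulSec h hh B y) (D y)) =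
      fun y => h y * C.pairing y (B y) (D y) := by
    funext y; simp
  rw [h3] at h1
  have h4 := dAt_mul (hh x) (C.pairing_smooth B D x) (C.anchor x (A x))
  rw [h4, h2] at h1
  simp only [smulSec_apply, map_smul, LinearMap.smul_apply, map_add, LinearMap.add_apply,
    smul_eq_mul] at h1 ⊢
  linarith

theorem contMDiff_dAt_anchor (A : V.Sec) {h : V.carrier → ℝ} (hh : ContMDiff V.I 𝓘(ℝ, ℝ) ∞ h) :
    ContMDiff V.I 𝓘(ℝ, ℝ) ∞ fun y => dAt h y (C.anchor y (A y)) := fun x =>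
  contMDiffAt_dAt_along (g := id) hh ((C.anchorField A).contMDiff_toFun x)

/-- The anchor intertwines the bracket with the commutator of derivations. -/
theorem dAt_anchor_bracket (A B : V.Sec) {h : V.carrier → ℝ} (hh : ContMDiff V.I 𝓘(ℝ, ℝ) ∞ h)
    (x : V.carrier) : dAt h x (C.anchor x (C.bracket A B x)) =
      dAt (fun y => dAt h y (C.anchor y (B y))) x (C.anchor x (A x)) -
      dAt (fun y => dAt h y (C.anchor y (A y))) x (C.anchor x (B x)) := by
  -- The argument needs a section that does not vanish at `x`. It exists only if the rank `2 * dim`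
  -- is positive; in dimension 0 all derivatives vanish.
  rcases Nat.eq_zero_or_pos V.dim with h0 | h0
  · have : Subsingleton V.Coord := by
      rw [BundleMfd.Coord, h0]; infer_instance
    have : Subsingleton (V.T x) := this
    have hz : ∀ (L : V.T x →L[ℝ] ℝ) (v : V.T x), L v = 0 := fun L v => by
      rw [Subsingleton.elim v 0, map_zero]
    rw [hz, hz, hz, sub_zero]
  · have : Nontrivial V.Model := by
      have : NeZero (2 * V.dim) := ⟨by omega⟩
      infer_instance
    obtain ⟨v, hv⟩ := exists_ne (0 : V.Model)
    obtain ⟨D, hD⟩ : ∃ D : V.Sec, D x ≠ 0 := by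
      refine ⟨SmoothBundle.frame V.I V.Model V.fiber x v, fun h => hv ?_⟩
      exact (SmoothBundle.frameAt_bijective_eventually V.I V.Model V.fiber
        x).self_of_nhds.1 (h.trans (map_zero _).symm)
    -- The Leibniz rule applied twice. In the Jacobi identity for `A`, `B`, `hD` the terms with
    -- brackets of `D` cancel against those for `A`, `B`, `D`, and the claimed difference is left as
    -- the coefficient of `D x`.
    have hexp : ∀ A B : V.Sec, C.bracket A (C.bracket B (smulSec h hh D)) x =
        h x • C.bracket A (C.bracket B D) x + dAt h x (C.anchor x (A x)) • C.bracket B D x +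
        (dAt h x (C.anchor x (B x)) • C.bracket A D x +
          dAt (fun y => dAt h y (C.anchor y (B y))) x (C.anchor x (A x)) • D x) := by
      intro A B
      have h1 : C.bracket B (smulSec h hh D) = smulSec h hh (C.bracket B D) +
          smulSec _ (C.contMDiff_dAt_anchor B hh) D := by
        ext y
        exact C.bracket_smulSec B D h hh y
      rw [h1, map_add, add_apply', C.bracket_smulSec, C.bracket_smulSec]
    have hj := congrArg (fun S : V.Sec => S x) (C.jacobi A B (smulSec h hh D))
    have hj' := congrArg (fun S : V.Sec => S x) (C.jacobi A B D)
    simp only [add_apply'] at hj hj'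
    rw [hexp A B, hexp B A, C.bracket_smulSec, hj'] at hj
    have key : (dAt h x (C.anchor x (C.bracket A B x)) -
      (dAt (fun y => dAt h y (C.anchor y (B y))) x (C.anchor x (A x)) -
      dAt (fun y => dAt h y (C.anchor y (A y))) x (C.anchor x (B x)))) • D x = 0 := by
      have h2 := sub_eq_zero.2 hj
      rw [← neg_eq_zero]
      refine Eq.trans ?_ h2
      module
    exact sub_eq_zero.1 ((smul_eq_zero.1 key).resolve_right hD)

/-- The anchor of a bracket in the preferred chart. -/
theorem anchor_bracket (A B : V.Sec) (x₀ : V.carrier) :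
    coordT x₀ x₀ (C.anchor x₀ (C.bracket A B x₀)) =
      dAt (fun y => coordT x₀ y (C.anchor y (B y))) x₀ (C.anchor x₀ (A x₀)) -
      dAt (fun y => coordT x₀ y (C.anchor y (A y))) x₀ (C.anchor x₀ (B x₀)) := by
  obtain ⟨κ, hκ, hd⟩ := exists_chartFun x₀
  have hX : ∀ A : V.Sec, ContMDiffAt V.I 𝓘(ℝ, V.Coord) ∞
      (fun y => coordT x₀ y (C.anchor y (A y))) x₀ := fun A =>
    contMDiffAt_coordT_along (g := id) ((C.anchorField A).contMDiff_toFun x₀)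
  have hcomp : ∀ (L : V.Coord →L[ℝ] ℝ) (y : V.carrier) (X : V.T y),
      dAt (fun z => L (κ z)) y X = L (dAt κ y X) := fun L y X => dAt_clm L (hκ y) X
  -- The derivation identity is applied to the functions `L ∘ κ`, whose differentials read off
  -- linear functionals of the chart components.
  have key : ∀ L : V.Coord →L[ℝ] ℝ, L (coordT x₀ x₀ (C.anchor x₀ (C.bracket A B x₀))) =
      L (dAt (fun y => coordT x₀ y (C.anchor y (B y))) x₀ (C.anchor x₀ (A x₀)) -
      dAt (fun y => coordT x₀ y (C.anchor y (A y))) x₀ (C.anchor x₀ (B x₀))) := by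
    intro L
    have h := C.dAt_anchor_bracket A B (h := fun z => L (κ z)) (L.contMDiff.comp hκ) x₀
    have h2 : ∀ A B : V.Sec, dAt (fun y => dAt (fun z => L (κ z)) y (C.anchor y (B y))) x₀
        (C.anchor x₀ (A x₀)) =
        L (dAt (fun y => coordT x₀ y (C.anchor y (B y))) x₀ (C.anchor x₀ (A x₀))) := by
      intro A B
      rw [← dAt_clm L (hX B)]
      refine DFunLike.congr_fun (dAt_congr ?_) _
      filter_upwards [hd] with y hy
      rw [hcomp]
      exact congrArg L (hy _)
    rw [h2, h2, hcomp] at h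
    rw [map_sub, ← h]
    exact congrArg L (hd.self_of_nhds _).symm
  refine (EuclideanSpace.basisFun (Fin V.dim) ℝ).toBasis.ext_elem fun i => ?_
  exact key (LinearMap.toContinuousLinearMap
    ((EuclideanSpace.basisFun (Fin V.dim) ℝ).toBasis.coord i))

end CourantAlgebroid

end ExtGeom

/-! ### Alternating forms from multilinear maps -/

section Alternating

variable {E : Type*} [NormedAddCommGroup E] [NormedSpace ℝ E] [FiniteDimensional ℝ E]

/-- The alternating form attached to an alternating bilinear map. -/
def ContinuousAlternatingMap.ofBilinear (f : E →ₗ[ℝ] E →ₗ[ℝ] ℝ) (h : ∀ x, f x x = 0) :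
    E [⋀^Fin 2]→L[ℝ] ℝ where
  toFun v := f (v 0) (v 1)
  map_update_add' v i x y := by
    fin_cases i <;> simp
  map_update_smul' v i c x := by
    fin_cases i <;> simp
  map_eq_zero_of_eq' v i j hv hij := by
    fin_cases i <;> fin_cases j <;> simp at hij hv <;> simp [hv, h]
  cont := by
    let g : E →L[ℝ] E →L[ℝ] ℝ := LinearMap.toContinuousLinearMap
      ((LinearMap.toContinuousLinearMap (𝕜 := ℝ) (E := E) (F' := ℝ)).toLinearMap ∘ₗ f)
    change Continuous fun v : Fin 2 → E => g (v 0) (v 1)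
    fun_prop

theorem LinearMap.continuous_trilinear {X : Type*} [TopologicalSpace X]
    (f : E →ₗ[ℝ] E →ₗ[ℝ] E →ₗ[ℝ] ℝ) {a b c : X → E} (ha : Continuous a) (hb : Continuous b)
    (hc : Continuous c) : Continuous fun x => f (a x) (b x) (c x) := by
  let B := Module.finBasis ℝ E
  have h : (fun x => f (a x) (b x) (c x)) = fun x => ∑ i, B.coord i (a x) * f (B i) (b x) (c x) := by
    funext x
    conv_lhs => rw [← B.sum_repr (a x), map_sum, LinearMap.sum_apply, LinearMap.sum_apply]
    simp
  rw [h]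
  refine continuous_finsetSum _ fun i _ =>
    ((B.coord i).continuous_of_finiteDimensional.comp ha).mul ?_
  let g : E →L[ℝ] E →L[ℝ] ℝ := LinearMap.toContinuousLinearMap
    ((LinearMap.toContinuousLinearMap (𝕜 := ℝ) (E := E) (F' := ℝ)).toLinearMap ∘ₗ f (B i))
  change Continuous fun x => g (b x) (c x)
  fun_prop

/-- The alternating form attached to an alternating trilinear map. -/
def ContinuousAlternatingMap.ofTrilinear (f : E →ₗ[ℝ] E →ₗ[ℝ] E →ₗ[ℝ] ℝ)
    (h₁ : ∀ x y, f x x y = 0) (h₂ : ∀ x y, f x y y = 0) (h₃ : ∀ x y, f x y x = 0) :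
    E [⋀^Fin 3]→L[ℝ] ℝ where
  toFun v := f (v 0) (v 1) (v 2)
  map_update_add' v i x y := by
    rename_i inst
    obtain rfl := Subsingleton.elim inst (instDecidableEqFin 3)
    match i with
    | 0 => simp [Function.update_self, Function.update_of_ne]
    | 1 => simp [Function.update_self, Function.update_of_ne]
    | 2 => simp [Function.update_self, Function.update_of_ne]
  map_update_smul' v i c x := by
    rename_i inst
    obtain rfl := Subsingleton.elim inst (instDecidableEqFin 3)
    match i with
    | 0 => simp [Function.update_self, Function.update_of_ne]
    | 1 => simp [Function.update_self, Function.update_of_ne]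
    | 2 => simp [Function.update_self, Function.update_of_ne]
  map_eq_zero_of_eq' v i j hv hij := by
    fin_cases i <;> fin_cases j <;> simp at hij hv <;> simp [hv, h₁, h₂, h₃]
  cont := f.continuous_trilinear (continuous_apply 0) (continuous_apply 1) (continuous_apply 2)

end Alternating

/-! ### Vector and covector parts, and the twisting form -/

open ExtGeom ExtGeom.BundleMfd

namespace ExtMfd

variable (M : ExtMfd.{u})

@[simp] theorem anchor_coanchor (x : M.carrier) (ξ : Module.Dual ℝ (M.T x)) :
    M.courant.anchor x (M.courant.coanchor x ξ) = 0 :=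
  (M.exact x _).2 ⟨ξ, rfl⟩

theorem exists_coanchor {x : M.carrier} {e : M.fiber x} (h : M.courant.anchor x e = 0) :
    ∃ ξ, M.courant.coanchor x ξ = e :=
  (M.exact x e).1 h

theorem pairing_coanchor (x : M.carrier) (ξ : Module.Dual ℝ (M.T x)) (e : M.fiber x) :
    2 * M.courant.pairing x (M.courant.coanchor x ξ) e = ξ (M.courant.anchor x e) :=
  M.courant.two_mul_pairing_coanchor x ξ e

end ExtMfd

namespace ExtGeom

namespace Splitting

variable {M : ExtMfd.{u}} (s : Splitting M)

/-- The covector part `Y ↦ 2⟨e, s(Y)⟩` of an element of the extended tangent bundle. -/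
def cov (x : M.carrier) : M.fiber x →ₗ[ℝ] Module.Dual ℝ (M.T x) :=
  (2 : ℝ) • (s.toFun x).dualMap ∘ₗ M.courant.pairing x

theorem cov_apply (x : M.carrier) (e : M.fiber x) (Y : M.T x) :
    s.cov x e Y = 2 * M.courant.pairing x e (s.toFun x Y) := rfl

@[simp] theorem cov_toFun (x : M.carrier) (X : M.T x) : s.cov x (s.toFun x X) = 0 := by
  ext Y
  rw [cov_apply, s.isotropic]; simp

@[simp] theorem cov_coanchor (x : M.carrier) (ξ : Module.Dual ℝ (M.T x)) :
    s.cov x (M.courant.coanchor x ξ) = ξ := by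
  ext Y
  rw [cov_apply, M.pairing_coanchor, s.anchor_apply]

/-- By exactness `e - s(a(e))` comes from a covector, and `s.cov` detects which one because the
image of `s` is isotropic. -/
theorem decomp (x : M.carrier) (e : M.fiber x) :
    e = s.toFun x (M.courant.anchor x e) + M.courant.coanchor x (s.cov x e) := by
  obtain ⟨ξ, hξ⟩ := M.exists_coanchor (x := x) (e := e - s.toFun x (M.courant.anchor x e))
    (by rw [map_sub, s.anchor_apply, sub_self])
  have h1 : e = s.toFun x (M.courant.anchor x e) + M.courant.coanchor x ξ := by rw [hξ]; abel
  have h2 : s.cov x e = ξ := by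
    have := congrArg (s.cov x) h1
    rwa [map_add, cov_toFun, zero_add, cov_coanchor] at this
  rw [h2]; exact h1

theorem ext_parts {x : M.carrier} {e e' : M.fiber x}
    (h : M.courant.anchor x e = M.courant.anchor x e') (h' : s.cov x e = s.cov x e') : e = e' := by
  rw [s.decomp x e, s.decomp x e', h, h']

/-- In terms of the parts, twice the pairing is the canonical symmetric pairing of `TM ⊕ T*M`. -/
theorem two_mul_pairing (x : M.carrier) (e e' : M.fiber x) :
    2 * M.courant.pairing x e e' =
      s.cov x e (M.courant.anchor x e') + s.cov x e' (M.courant.anchor x e) := by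
  conv_lhs => rw [s.decomp x e', map_add, mul_add]
  rw [← cov_apply, M.courant.pairing_symm x e (M.courant.coanchor x _), M.pairing_coanchor]

theorem contMDiffAt_toFun_along {ES HS S : Type*} [NormedAddCommGroup ES] [NormedSpace ℝ ES]
    [TopologicalSpace HS] {J : ModelWithCorners ℝ ES HS} [TopologicalSpace S] [ChartedSpace HS S]
    {g : S → M.carrier} {s₀ : S} {X : ∀ z, M.T (g z)}
    (hX : ContMDiffAt J M.I.tangent ∞ (fun z => (⟨g z, X z⟩ : TangentBundle M.I M.carrier)) s₀) :
    ContMDiffAt J (M.I.prod 𝓘(ℝ, M.Model)) ∞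
      (fun z => (⟨g z, s.toFun (g z) (X z)⟩ : TotalSpace M.Model M.fiber)) s₀ :=
  s.smooth.contMDiffAt.comp s₀ hX

@[simp] theorem onField_apply (X : M.VField) (x : M.carrier) : s.onField X x = s.toFun x (X x) := rfl

theorem onField_add (X Y : M.VField) : s.onField (X + Y) = s.onField X + s.onField Y := by
  ext x
  exact (s.toFun x).map_add _ _

theorem onField_smul (c : ℝ) (X : M.VField) : s.onField (c • X) = c • s.onField X := by
  ext x
  exact (s.toFun x).map_smul c _

/-- `onField` as a linear map. -/
def onFieldₗ : M.VField →ₗ[ℝ] M.Sec where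
  toFun := s.onField
  map_add' := s.onField_add
  map_smul' := s.onField_smul

/-- The expression `2⟨s(X), s(Y) * s(Z)⟩`. -/
def twist (X Y Z : M.VField) (x : M.carrier) : ℝ :=
  2 * M.courant.pairing x (s.onField X x) (M.courant.bracket (s.onField Y) (s.onField Z) x)

/-- The symmetric part of the bracket is controlled by the derivative of the pairing, which is
constantly zero on the image of `s`. -/
theorem twist_swap₂₃ (X Y Z : M.VField) (x : M.carrier) : s.twist X Y Z x = -s.twist X Z Y x := by
  have h := M.courant.dAt_pairing_left (s.onField X) (s.onField Y) (s.onField Z) x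
  have h0 : (fun y => M.courant.pairing y (s.onField Y y) (s.onField Z y)) = fun _ => (0 : ℝ) :=
    funext fun y => s.isotropic _ _ _
  rw [h0, dAt_const, map_add] at h
  simp only [twist]
  have : (0 : ℝ) = _ := h
  linarith

/-- Invariance of the pairing under the bracket, again with vanishing left side by isotropy. -/
theorem twist_swap₁₃ (X Y Z : M.VField) (x : M.carrier) : s.twist X Y Z x = -s.twist Z Y X x := by
  have h := M.courant.dAt_pairing_right (s.onField Y) (s.onField Z) (s.onField X) x
  have h0 : (fun y => M.courant.pairing y (s.onField Z y) (s.onField X y)) = fun _ => (0 : ℝ) :=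
    funext fun y => s.isotropic _ _ _
  rw [h0, dAt_const, M.courant.pairing_symm x (M.courant.bracket _ _ x)] at h
  simp only [twist]
  have : (0 : ℝ) = _ := h
  linarith

theorem twist_swap₁₂ (X Y Z : M.VField) (x : M.carrier) : s.twist X Y Z x = -s.twist Y X Z x := by
  rw [twist_swap₁₃, twist_swap₂₃, twist_swap₁₃ s Z X Y, neg_neg]

theorem twist_congr₁ {X X' : M.VField} (Y Z : M.VField) {x : M.carrier} (h : X x = X' x) :
    s.twist X Y Z x = s.twist X' Y Z x := by
  simp only [twist, onField_apply, h]

/-- Tensoriality is evident in the first slot, where nothing is differentiated, and antisymmetry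
carries it to the other two. -/
theorem twist_congr {X X' Y Y' Z Z' : M.VField} {x : M.carrier} (hX : X x = X' x) (hY : Y x = Y' x)
    (hZ : Z x = Z' x) : s.twist X Y Z x = s.twist X' Y' Z' x := by
  rw [s.twist_congr₁ Y Z hX, s.twist_swap₁₂, s.twist_congr₁ _ Z hY, ← s.twist_swap₁₂,
    s.twist_swap₁₃, s.twist_congr₁ _ _ hZ, ← s.twist_swap₁₃]

/-- The twisting form of a splitting. -/
def twistForm : FormField M.toBundleMfd 3 := fun x =>
  -- A linear choice of extensions of tangent vectors at `x`. By tensoriality the choice has no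
  -- effect on the value.
  let L : M.T x →ₗ[ℝ] M.Sec := s.onFieldₗ ∘ₗ constField x
  let f : M.Coord →ₗ[ℝ] M.Coord →ₗ[ℝ] M.Coord →ₗ[ℝ] ℝ :=
    { toFun := fun X =>
        { toFun := fun Y =>
            { toFun := fun Z => 2 * M.courant.pairing x (L X x) (M.courant.bracket (L Y) (L Z) x)
              map_add' := fun Z Z' => by
                rw [show L (Z + Z') = L Z + L Z' from map_add L Z Z', map_add, add_apply', map_add]
                ring
              map_smul' := fun c Z => by
                rw [show L (c • Z) = c • L Z from map_smul L c Z, map_smul,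
                  ContMDiffSection.coe_smul, Pi.smul_apply, map_smul]
                simp; ring }
          map_add' := fun Y Y' => by
            ext Z
            simp only [LinearMap.coe_mk, AddHom.coe_mk, LinearMap.add_apply]
            rw [show L (Y + Y') = L Y + L Y' from map_add L Y Y', map_add, LinearMap.add_apply,
              add_apply', map_add]
            ring
          map_smul' := fun c Y => by
            ext Z
            simp only [LinearMap.coe_mk, AddHom.coe_mk, LinearMap.smul_apply]
            rw [show L (c • Y) = c • L Y from map_smul L c Y, map_smul, LinearMap.smul_apply,
              ContMDiffSection.coe_smul, Pi.smul_apply, map_smul]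
            simp; ring }
      map_add' := fun X X' => by
        ext Y Z
        simp only [LinearMap.coe_mk, AddHom.coe_mk, LinearMap.add_apply]
        rw [show L (X + X') = L X + L X' from map_add L X X', add_apply', map_add,
          LinearMap.add_apply]
        ring
      map_smul' := fun c X => by
        ext Y Z
        simp only [LinearMap.coe_mk, AddHom.coe_mk, LinearMap.smul_apply]
        rw [show L (c • X) = c • L X from map_smul L c X,
          ContMDiffSection.coe_smul, Pi.smul_apply, map_smul, LinearMap.smul_apply]
        simp; ring }
  ContinuousAlternatingMap.ofTrilinear (E := M.Coord) f
    (fun X Y => self_eq_neg.1 (s.twist_swap₁₂ (constField x X) (constField x X) (constField x Y) x))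
    (fun X Y => self_eq_neg.1 (s.twist_swap₂₃ (constField x X) (constField x Y) (constField x Y) x))
    (fun X Y => self_eq_neg.1 (s.twist_swap₁₃ (constField x X) (constField x Y) (constField x X) x))

theorem twistForm_apply (X Y Z : M.VField) (x : M.carrier) :
    s.twistForm x ![X x, Y x, Z x] = s.twist X Y Z x := by
  have h : s.twistForm x ![X x, Y x, Z x] =
    s.twist (constField x (X x)) (constField x (Y x)) (constField x (Z x)) x := rfl
  rw [h]
  exact s.twist_congr (constField_self _ _) (constField_self _ _) (constField_self _ _)

theorem isTwistingForm_twistForm : s.IsTwistingForm s.twistForm := by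
  refine ⟨FormField.isSmooth_iff_const.2 fun x₀ v => ?_, fun X Y Z x => s.twistForm_apply X Y Z x⟩
  have h : (fun x => s.twistForm x fun i => constField x₀ (v i) x) = fun x =>
      s.twist (constField x₀ (v 0)) (constField x₀ (v 1)) (constField x₀ (v 2)) x := by
    funext x
    rw [← twistForm_apply]
    refine congrArg (s.twistForm x) (funext fun i => ?_)
    fin_cases i <;> rfl
  rw [h]
  exact contMDiffAt_const.mul (M.courant.pairing_smooth _ _ x₀)

theorem IsTwistingForm.eq {H : FormField M.toBundleMfd 3} (h : s.IsTwistingForm H) :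
    H = s.twistForm := by
  funext x
  ext v
  have hv : v = ![constField x (v 0) x, constField x (v 1) x, constField x (v 2) x] := by
    funext i
    fin_cases i <;> exact (constField_self x _).symm
  rw [hv, h.2, s.twistForm_apply]
  rfl

end Splitting

end ExtGeom

/-! ### The bracket as a twisted Dorfman bracket -/

namespace ExtGeom

open BundleMfd

namespace BundleMfd

theorem dAt_clm_apply {V : BundleMfd.{u}} {F G : Type*} [NormedAddCommGroup F] [NormedSpace ℝ F]
    [NormedAddCommGroup G] [NormedSpace ℝ G] {p : V.carrier → F →L[ℝ] G} {q : V.carrier → F}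
    {x : V.carrier} (hp : ContMDiffAt V.I 𝓘(ℝ, F →L[ℝ] G) ∞ p x)
    (hq : ContMDiffAt V.I 𝓘(ℝ, F) ∞ q x) (X : V.T x) :
    dAt (fun y => p y (q y)) x X = p x (dAt q x X) + dAt p x X (q x) := by
  have h := DFunLike.congr_fun (fderiv_clm_apply
    ((contDiffAt_comp_symm hp).differentiableAt (by simp))
    ((contDiffAt_comp_symm hq).differentiableAt (by simp))) X
  refine h.trans ?_
  simp only [Function.comp, extChartAt_to_inv]
  rfl

theorem dAt_apply_const {V : BundleMfd.{u}} {F G : Type*} [NormedAddCommGroup F] [NormedSpace ℝ F]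
    [NormedAddCommGroup G] [NormedSpace ℝ G] {p : V.carrier → F →L[ℝ] G}
    {x : V.carrier} (hp : ContMDiffAt V.I 𝓘(ℝ, F →L[ℝ] G) ∞ p x) (v : F) (X : V.T x) :
    dAt (fun y => p y v) x X = dAt p x X v := by
  rw [dAt_clm_apply hp contMDiffAt_const, dAt_const]
  simp

end BundleMfd

namespace Splitting

variable {M : ExtMfd.{u}} (s : Splitting M)

/-- The coordinates, in the preferred chart at `x`, of the covector part of an element of the
extended tangent space at `y`. -/
def covC (x y : M.carrier) : M.fiber y →ₗ[ℝ] (M.Coord →L[ℝ] ℝ) :=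
  (LinearMap.toContinuousLinearMap (𝕜 := ℝ) (E := M.Coord) (F' := ℝ)).toLinearMap ∘ₗ
    ((SmoothBundle.frameAt M.I M.Coord M.T x y).dualMap ∘ₗ s.cov y)

theorem covC_apply (x y : M.carrier) (e : M.fiber y) (v : M.Coord) :
    s.covC x y e v = s.cov y e (constField x v y) := rfl

theorem covC_self (x : M.carrier) (e : M.fiber x) (X : M.T x) : s.covC x x e X = s.cov x e X := by
  exact congrArg (s.cov x e) (constField_self x X)

theorem contMDiffAt_covC {ES HS S : Type*} [NormedAddCommGroup ES] [NormedSpace ℝ ES]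
    [TopologicalSpace HS] {J : ModelWithCorners ℝ ES HS} [TopologicalSpace S] [ChartedSpace HS S]
    {g : S → M.carrier} {s₀ : S} (x : M.carrier) {σ : ∀ z, M.fiber (g z)}
    (hσ : ContMDiffAt J (M.I.prod 𝓘(ℝ, M.Model)) ∞
      (fun z => (⟨g z, σ z⟩ : TotalSpace M.Model M.fiber)) s₀) :
    ContMDiffAt J 𝓘(ℝ, M.Coord →L[ℝ] ℝ) ∞ (fun z => s.covC x (g z) (σ z)) s₀ := by
  refine SmoothBundle.contMDiffAt_clm_of_apply fun v => ?_
  have hg : ContMDiffAt J M.I ∞ g s₀ := (contMDiffAt_totalSpace.1 hσ).1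
  exact contMDiffAt_const.mul (M.courant.contMDiffAt_pairing hσ (s.contMDiffAt_toFun_along
    ((constField x v).contMDiff_toFun.contMDiffAt.comp s₀ hg)))

theorem contMDiffAt_covC_sec (x : M.carrier) (A : M.Sec) (y : M.carrier) :
    ContMDiffAt M.I 𝓘(ℝ, M.Coord →L[ℝ] ℝ) ∞ (fun z => s.covC x z (A z)) y :=
  s.contMDiffAt_covC (g := id) x (A.contMDiff_toFun y)

theorem contMDiffAt_coordT_anchor (A : M.Sec) (x : M.carrier) :
    ContMDiffAt M.I 𝓘(ℝ, M.Coord) ∞ (fun y => coordT x y (M.courant.anchor y (A y))) x :=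
  contMDiffAt_coordT_along (g := id) ((M.courant.anchorField A).contMDiff_toFun x)

/-- The part of the bracket formula which involves a section in the image of the coanchor. -/
theorem bracket_pairing_of_anchor_eq_zero (A B : M.Sec)
    (hB : ∀ y, M.courant.anchor y (B y) = 0) (x : M.carrier) (Z : M.T x) :
    2 * M.courant.pairing x (M.courant.bracket A B x) (s.toFun x Z) =
      dAt (fun y => s.covC x y (B y)) x (M.courant.anchor x (A x)) Z +
      s.cov x (B x) (dAt (fun y => coordT x y (M.courant.anchor y (A y))) x Z) := by
  let S : M.Sec := s.onField (constField x Z)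
  have hS : S x = s.toFun x Z := congrArg (s.toFun x) (constField_self x Z)
  have hSa : ∀ y, M.courant.anchor y (S y) = constField x Z y := fun y => s.anchor_apply _ _
  have h1 := M.courant.dAt_pairing_right A B S x
  have h2 := M.courant.anchor_bracket A S x
  -- The test section lifts a coordinate field, so only the derivative of `a(A)` survives in the
  -- anchor of `A * S`.
  have h3 : dAt (fun y => coordT x y (M.courant.anchor y (S y))) x = 0 := by
    refine (dAt_congr ?_).trans (dAt_const (F := M.Coord) Z x)
    filter_upwards [constField_eventually x] with y hy
    rw [hSa]
    exact hy.2.1 Z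
  have h4 : M.courant.anchor x (S x) = Z := by rw [hS, s.anchor_apply]
  rw [h3, h4, coordT_self] at h2
  have h5 : 2 * M.courant.pairing x (B x) (M.courant.bracket A S x) =
      -s.cov x (B x) (dAt (fun y => coordT x y (M.courant.anchor y (A y))) x Z) := by
    rw [s.two_mul_pairing, hB, map_zero, add_zero]
    refine (congrArg (s.cov x (B x)) h2).trans ?_
    refine (congrArg (s.cov x (B x)) (zero_sub _)).trans ?_
    exact map_neg (s.cov x (B x)) _
  have h6 : 2 * dAt (fun y => M.courant.pairing y (B y) (S y)) x (M.courant.anchor x (A x)) =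
      dAt (fun y => s.covC x y (B y)) x (M.courant.anchor x (A x)) Z := by
    refine Eq.trans ?_ (dAt_apply_const (s.contMDiffAt_covC_sec x B x) Z _)
    have := DFunLike.congr_fun (dAt_const_mul (2 : ℝ) (M.courant.pairing_smooth B S x))
      (M.courant.anchor x (A x))
    exact this.symm
  rw [← hS]
  linarith

/-- The Loday bracket in terms of the vector and covector parts. -/
theorem bracket_pairing (A B : M.Sec) (x : M.carrier) (r : M.fiber x) :
    2 * M.courant.pairing x (M.courant.bracket A B x) r =
      s.twistForm x ![M.courant.anchor x (A x), M.courant.anchor x (B x), M.courant.anchor x r] +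
      dAt (fun y => s.covC x y (B y)) x (M.courant.anchor x (A x)) (M.courant.anchor x r) -
      dAt (fun y => s.covC x y (A y)) x (M.courant.anchor x (B x)) (M.courant.anchor x r) +
      dAt (fun y => s.covC x y (A y)) x (M.courant.anchor x r) (M.courant.anchor x (B x)) +
      s.cov x (B x) (dAt (fun y => coordT x y (M.courant.anchor y (A y))) x
        (M.courant.anchor x r)) +
      s.cov x r (dAt (fun y => coordT x y (M.courant.anchor y (B y))) x (M.courant.anchor x (A x)) -
        dAt (fun y => coordT x y (M.courant.anchor y (A y))) x (M.courant.anchor x (B x))) := by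
  set Z : M.T x := M.courant.anchor x r with hZ
  -- `A0` and `B0` are the vector parts pushed back by `s`; the remainders have zero anchor. Then `A
  -- * B = A0 * B0 + A * (B - B0) + (A - A0) * B0`. The first summand gives the twist, and the
  -- second is covered by `bracket_pairing_of_anchor_eq_zero`. The third becomes of that kind after
  -- exchanging its arguments, at the cost of the derivative of their pairing.
  let A0 : M.Sec := s.onField (M.courant.anchorField A)
  let B0 : M.Sec := s.onField (M.courant.anchorField B)
  have hA0 : ∀ y, M.courant.anchor y (A0 y) = M.courant.anchor y (A y) :=
    fun y => s.anchor_apply _ _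
  have hB0 : ∀ y, M.courant.anchor y (B0 y) = M.courant.anchor y (B y) :=
    fun y => s.anchor_apply _ _
  have hA1 : ∀ y, M.courant.anchor y ((A - A0) y) = 0 := fun y => by
    rw [sub_apply', map_sub, hA0, sub_self]
  have hB1 : ∀ y, M.courant.anchor y ((B - B0) y) = 0 := fun y => by
    rw [sub_apply', map_sub, hB0, sub_self]
  have hcA0 : ∀ y, s.cov y (A0 y) = 0 := fun y => s.cov_toFun _ _
  have hcB0 : ∀ y, s.cov y (B0 y) = 0 := fun y => s.cov_toFun _ _
  have hcA : ∀ y, s.cov y ((A - A0) y) = s.cov y (A y) := fun y => by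
    rw [sub_apply', map_sub, hcA0, sub_zero]
  have hcB : ∀ y, s.cov y ((B - B0) y) = s.cov y (B y) := fun y => by
    rw [sub_apply', map_sub, hcB0, sub_zero]
  have hCA : (fun y => s.covC x y ((A - A0) y)) = fun y => s.covC x y (A y) := by
    funext y
    ext v
    rw [covC_apply, covC_apply, hcA]
  have hCB : (fun y => s.covC x y ((B - B0) y)) = fun y => s.covC x y (B y) := by
    funext y
    ext v
    rw [covC_apply, covC_apply, hcB]
  have e1 := s.bracket_pairing_of_anchor_eq_zero A (B - B0) hB1 x Z
  have e2 := s.bracket_pairing_of_anchor_eq_zero B0 (A - A0) hA1 x Z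
  have e3 := M.courant.dAt_pairing_left (s.onField (constField x Z)) (A - A0) B0 x
  have hS : s.onField (constField x Z) x = s.toFun x Z :=
    congrArg (s.toFun x) (constField_self x Z)
  have e4 : 2 * M.courant.pairing x (M.courant.bracket A0 B0 x) (s.toFun x Z) =
      s.twistForm x ![M.courant.anchor x (A x), M.courant.anchor x (B x), Z] := by
    have h := s.twistForm_apply (M.courant.anchorField A) (M.courant.anchorField B)
      (constField x Z) x
    have h' : s.twist (constField x Z) (M.courant.anchorField A) (M.courant.anchorField B) x =
      2 * M.courant.pairing x (s.onField (constField x Z) x) (M.courant.bracket A0 B0 x) := rfl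
    rw [s.twist_swap₁₃, s.twist_swap₂₃, neg_neg] at h
    have h2 := (congrArg (fun Z' => s.twistForm x ![M.courant.anchor x (A x),
      M.courant.anchor x (B x), Z']) (constField_self x Z)).symm.trans h
    rw [h2, M.courant.pairing_symm, ← hS, ← h']
  have e5 : 2 * dAt (fun y => M.courant.pairing y ((A - A0) y) (B0 y)) x Z =
      dAt (fun y => s.covC x y (A y)) x Z (M.courant.anchor x (B x)) +
      s.cov x (A x) (dAt (fun y => coordT x y (M.courant.anchor y (B y))) x Z) := by
    have h1 := DFunLike.congr_fun (dAt_const_mul (2 : ℝ)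
      (M.courant.pairing_smooth (A - A0) B0 x)) Z
    refine h1.symm.trans ?_
    have h2 := dAt_clm_apply (s.contMDiffAt_covC_sec x A x) (contMDiffAt_coordT_anchor B x) Z
    rw [coordT_self, add_comm] at h2
    refine (DFunLike.congr_fun (dAt_congr ?_) Z).trans
      (h2.trans (congrArg (_ + ·) (s.covC_self x (A x) _)))
    filter_upwards [constField_eventually x] with y hy
    rw [s.two_mul_pairing, hA1, map_zero, add_zero, hcA, hB0, covC_apply, hy.2.2.1]
  have hbr : M.courant.bracket A B = M.courant.bracket A0 B0 + M.courant.bracket A (B - B0) +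
      M.courant.bracket (A - A0) B0 := by
    simp only [map_sub, LinearMap.sub_apply]
    abel
  have hAx : dAt (fun y => coordT x y (M.courant.anchor y (B0 y))) x =
      dAt (fun y => coordT x y (M.courant.anchor y (B y))) x := by
    congr 1
    funext y
    rw [hB0]
  rw [hCB, hcB] at e1
  rw [hCA, hcA, hB0, hAx] at e2
  rw [hS, s.anchor_apply, map_add] at e3
  have e6 : 2 * M.courant.pairing x (M.courant.bracket A B x) (s.toFun x Z) =
      s.twistForm x ![M.courant.anchor x (A x), M.courant.anchor x (B x), Z] +
      dAt (fun y => s.covC x y (B y)) x (M.courant.anchor x (A x)) Z -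
      dAt (fun y => s.covC x y (A y)) x (M.courant.anchor x (B x)) Z +
      dAt (fun y => s.covC x y (A y)) x Z (M.courant.anchor x (B x)) +
      s.cov x (B x) (dAt (fun y => coordT x y (M.courant.anchor y (A y))) x Z) := by
    rw [M.courant.pairing_symm x (s.toFun x Z), M.courant.pairing_symm x (s.toFun x Z)] at e3
    rw [hbr, add_apply', add_apply', map_add, map_add, LinearMap.add_apply, LinearMap.add_apply]
    linarith
  have e7 := s.two_mul_pairing x (M.courant.bracket A B x) r
  rw [← s.cov_apply] at e6
  rw [e7, ← hZ, e6]
  refine congrArg (_ + ·) (congrArg (s.cov x r) ?_)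
  exact (coordT_self x _).symm.trans (M.courant.anchor_bracket A B x)

end Splitting

end ExtGeom

/-! ### Shifting a splitting by a 2-form -/

namespace ExtGeom

open BundleMfd

namespace BundleMfd

theorem dAt_neg {V : BundleMfd.{u}} {F : Type*} [NormedAddCommGroup F] [NormedSpace ℝ F]
    (g : V.carrier → F) (x : V.carrier) : dAt (fun y => -g y) x = -dAt g x :=
  fderiv_fun_neg

end BundleMfd

namespace FormField

variable {V : BundleMfd.{u}}

theorem contract_add (α : FormField V 2) (x : V.carrier) (X Y : V.T x) :
    α.contract x (X + Y) = α.contract x X + α.contract x Y := by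
  ext Z
  have h : ∀ X' : V.T x, ![X', Z] = Function.update ![0, Z] 0 X' := fun X' => by
    funext i; fin_cases i <;> rfl
  change α x ![X + Y, Z] = α x ![X, Z] + α x ![Y, Z]
  rw [h (X + Y), h X, h Y, (α x).map_update_add]

theorem contract_smul (α : FormField V 2) (x : V.carrier) (c : ℝ) (X : V.T x) :
    α.contract x (c • X) = c • α.contract x X := by
  ext Z
  have h : ∀ X' : V.T x, ![X', Z] = Function.update ![0, Z] 0 X' := fun X' => by
    funext i; fin_cases i <;> rfl
  change α x ![c • X, Z] = c • α x ![X, Z]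
  rw [h (c • X), h X, (α x).map_update_smul]

/-- The contraction as a linear map. -/
def contractₗ (α : FormField V 2) (x : V.carrier) : V.T x →ₗ[ℝ] Module.Dual ℝ (V.T x) where
  toFun := α.contract x
  map_add' := α.contract_add x
  map_smul' := α.contract_smul x

theorem contract_swap (α : FormField V 2) (x : V.carrier) (X Y : V.T x) :
    α.contract x X Y = -α.contract x Y X := by
  have h := (α x).map_swap ![Y, X] (i := 0) (j := 1) (by simp)
  refine (congrArg (α x) ?_).trans h
  funext i
  fin_cases i <;> rfl

theorem contract_form_add (α β : FormField V 2) (x : V.carrier) (X : V.T x) :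
    FormField.contract (α + β : FormField V 2) x X = α.contract x X + β.contract x X := rfl

theorem contract_form_sub (α β : FormField V 2) (x : V.carrier) (X : V.T x) :
    FormField.contract (α - β : FormField V 2) x X = α.contract x X - β.contract x X := rfl

theorem contract_pullback {W : BundleMfd.{u}} (f : V.carrier → W.carrier) (α : FormField W 2)
    (x : V.carrier) (X : V.T x) : (pullback f α).contract x X =
      α.contract (f x) (mfderiv V.I W.I f x X) ∘ₗ (mfderiv V.I W.I f x).toLinearMap := by
  ext Y
  change α (f x) (mfderiv V.I W.I f x ∘ ![X, Y]) = α (f x) ![_, _]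
  congr 1
  funext i
  fin_cases i <;> rfl

theorem contract_injective {α β : FormField V 2} (h : ∀ x X, α.contract x X = β.contract x X) :
    α = β := by
  funext x
  ext v
  have hv : v = ![v 0, v 1] := by
    funext i
    fin_cases i <;> rfl
  rw [hv]
  exact DFunLike.congr_fun (h x (v 0)) (v 1)

theorem IsSmooth.contMDiffAt_contract {ES HS S : Type*} [NormedAddCommGroup ES] [NormedSpace ℝ ES]
    [TopologicalSpace HS] {J : ModelWithCorners ℝ ES HS} [TopologicalSpace S] [ChartedSpace HS S]
    {α : FormField V 2} (hα : α.IsSmooth) {g : S → V.carrier} {s₀ : S}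
    {X Y : ∀ s, V.T (g s)}
    (hX : ContMDiffAt J V.I.tangent ∞
      (fun s => (⟨g s, X s⟩ : TangentBundle V.I V.carrier)) s₀)
    (hY : ContMDiffAt J V.I.tangent ∞
      (fun s => (⟨g s, Y s⟩ : TangentBundle V.I V.carrier)) s₀) :
    ContMDiffAt J 𝓘(ℝ, ℝ) ∞ (fun s => α.contract (g s) (X s) (Y s)) s₀ := by
  have hg : ContMDiffAt J V.I ∞ g s₀ := (contMDiffAt_totalSpace.1 hX).1
  refine (hα.contMDiffAt_apply hg (X := ![X, Y]) fun i => ?_).congr_of_eventuallyEq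
    (Eventually.of_forall fun s => ?_)
  · fin_cases i
    · exact hX
    · exact hY
  · change α (g s) ![X s, Y s] = α (g s) _
    congr 1
    funext i
    fin_cases i <;> rfl

end FormField

namespace Splitting

variable {M : ExtMfd.{u}} (s : Splitting M)

theorem ext_toFun {s s' : Splitting M} (h : ∀ x X, s.toFun x X = s'.toFun x X) : s = s' := by
  cases s; cases s'
  congr
  funext x
  exact LinearMap.ext (h x)

/-- Smoothness is tested by pairing with sections `A`. The covector summand contributes half of
`ξ(a(A))`, so `ξ` only has to be smooth on vector fields. -/
theorem contMDiffAt_toFun_add_coanchor {ES HS S : Type*} [NormedAddCommGroup ES] [NormedSpace ℝ ES]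
    [TopologicalSpace HS] {J : ModelWithCorners ℝ ES HS} [TopologicalSpace S] [ChartedSpace HS S]
    {g : S → M.carrier} {s₀ : S} {X : ∀ z, M.T (g z)} {ξ : ∀ z, Module.Dual ℝ (M.T (g z))}
    (hX : ContMDiffAt J M.I.tangent ∞ (fun z => (⟨g z, X z⟩ : TangentBundle M.I M.carrier)) s₀)
    (hξ : ∀ Y : M.VField, ContMDiffAt J 𝓘(ℝ, ℝ) ∞ (fun z => ξ z (Y (g z))) s₀) :
    ContMDiffAt J (M.I.prod 𝓘(ℝ, M.Model)) ∞ (fun z => (⟨g z, s.toFun (g z) (X z) +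
      M.courant.coanchor (g z) (ξ z)⟩ : TotalSpace M.Model M.fiber)) s₀ := by
  have hg : ContMDiffAt J M.I ∞ g s₀ := (contMDiffAt_totalSpace.1 hX).1
  refine M.courant.contMDiffAt_of_pairing hg fun A => ?_
  have h1 := M.courant.contMDiffAt_pairing (s.contMDiffAt_toFun_along hX)
    (A.contMDiff_toFun.contMDiffAt.comp s₀ hg)
  have h0 : ContMDiffAt J 𝓘(ℝ, ℝ) ∞ (fun _ : S => (1 / 2 : ℝ)) s₀ := contMDiffAt_const
  refine (h1.add (h0.mul (hξ (M.courant.anchorField A)))).congr_of_eventuallyEq (Eventually.of_forall fun z => ?_)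
  have h2 := M.pairing_coanchor (g z) (ξ z) (A (g z))
  change M.courant.pairing (g z) _ (A (g z)) = M.courant.pairing (g z) (s.toFun (g z) (X z)) (A (g z)) +
    1 / 2 * ξ z (M.courant.anchor (g z) (A (g z)))
  rw [map_add, LinearMap.add_apply, ← h2]
  ring

/-- The splitting `s + ι B`. -/
def shift (B : FormField M.toBundleMfd 2) (hB : B.IsSmooth) : Splitting M where
  toFun x := s.toFun x + M.courant.coanchor x ∘ₗ B.contractₗ x
  smooth := fun v => by
    have hid : ContMDiffAt M.I.tangent M.I.tangent ∞
        (fun v : TangentBundle M.I M.carrier => (⟨v.1, v.2⟩ : TangentBundle M.I M.carrier)) v :=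
      contMDiffAt_id
    refine s.contMDiffAt_toFun_add_coanchor hid fun Y => hB.contMDiffAt_contract hid ?_
    exact Y.contMDiff_toFun.contMDiffAt.comp v (contMDiffAt_totalSpace.1 hid).1
  anchor_apply x X := by
    simp [s.anchor_apply]
  isotropic x X Y := by
    have h := s.two_mul_pairing x (s.toFun x X + M.courant.coanchor x (B.contract x X))
      (s.toFun x Y + M.courant.coanchor x (B.contract x Y))
    simp only [map_add, cov_toFun, cov_coanchor, s.anchor_apply, M.anchor_coanchor,
      zero_add, add_zero] at h
    rw [B.contract_swap x X Y, neg_add_cancel] at h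
    have h' : M.courant.pairing x (s.toFun x X + M.courant.coanchor x (B.contract x X))
      (s.toFun x Y + M.courant.coanchor x (B.contract x Y)) = 0 := by
      simp only [map_add, LinearMap.add_apply]
      simpa using h
    exact h'

theorem isShift_shift (B : FormField M.toBundleMfd 2) (hB : B.IsSmooth) :
    s.IsShift B (s.shift B hB) := fun _ _ => rfl

/-- As `b` is alternating, the covector part changes by `-ι_{a(e)} b`: a larger splitting leaves a
smaller remainder. -/
theorem shift_cov {b : FormField M.toBundleMfd 2} (hb : b.IsSmooth) (x : M.carrier)
    (e : M.fiber x) (Y : M.T x) :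
    (s.shift b hb).cov x e Y = s.cov x e Y + b.contract x Y (M.courant.anchor x e) := by
  rw [Splitting.cov_apply]
  change 2 * M.courant.pairing x e (s.toFun x Y + M.courant.coanchor x (b.contract x Y)) = _
  rw [map_add, mul_add, M.courant.pairing_symm x e (M.courant.coanchor x _), M.pairing_coanchor]
  rfl

theorem shift_toFun {b : FormField M.toBundleMfd 2} (hb : b.IsSmooth) (x : M.carrier)
    (X : M.T x) : (s.shift b hb).toFun x X = s.toFun x X + M.courant.coanchor x (b.contract x X) :=
  rfl

variable {s} {s' : Splitting M} {B : FormField M.toBundleMfd 2}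

theorem IsShift.eq (h : s.IsShift B s') (hB : B.IsSmooth) : s' = s.shift B hB :=
  ext_toFun fun x X => h x X

theorem IsShift.cov_toFun (h : s.IsShift B s') (x : M.carrier) (X : M.T x) :
    s.cov x (s'.toFun x X) = B.contract x X := by
  rw [h, map_add, Splitting.cov_toFun, cov_coanchor, zero_add]

/-- The twisting form of a shifted splitting. -/
theorem IsShift.twistForm_eq (h : s.IsShift B s') (hB : B.IsSmooth) :
    s'.twistForm = s.twistForm + B.d := by
  funext x
  ext v
  have hv : v = ![v 0, v 1, v 2] := by
    funext i
    fin_cases i <;> rfl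
  generalize v 0 = X, v 1 = Y, v 2 = Z at hv
  subst hv
  -- With respect to `s` these sections have vector parts constant in the chart and covector parts
  -- `ι_X B`. In the bracket formula this leaves the old twist and three derivatives of coefficients
  -- of `B`, which form `dB`.
  let A : M.T x → M.Sec := fun X => s'.onField (constField x X)
  have hA : ∀ X y, M.courant.anchor y (A X y) = constField x X y := fun X y => s'.anchor_apply _ _
  have hA' : ∀ X, M.courant.anchor x (A X x) = X := fun X => (hA X x).trans (constField_self x X)
  have hc : ∀ X, dAt (fun y => coordT x y (M.courant.anchor y (A X y))) x = 0 := fun X => by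
    refine (dAt_congr ?_).trans (dAt_const (F := M.Coord) X x)
    filter_upwards [constField_eventually x] with y hy
    rw [hA]
    exact hy.2.1 X
  have hd : ∀ X Y Z : M.T x, dAt (fun y => s.covC x y (A X y)) x Y Z =
      dAt (fun y => B y ![constField x X y, constField x Z y]) x Y := fun X Y Z => by
    refine (dAt_apply_const (s.contMDiffAt_covC_sec x (A X) x) Z Y).symm.trans ?_
    congr 1
    congr 1
    funext y
    exact DFunLike.congr_fun (h.cov_toFun y (constField x X y)) (constField x Z y)
  have h1 := s.bracket_pairing (A Y) (A Z) x (A X x)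
  rw [hA', hA', hA', hc, hc, hd, hd, hd] at h1
  have h2 : s'.twistForm x ![X, Y, Z] =
    2 * M.courant.pairing x (A X x) (M.courant.bracket (A Y) (A Z) x) := rfl
  have h3 : s.twistForm x ![Y, Z, X] = s.twistForm x ![X, Y, Z] := by
    change s.twist (constField x Y) (constField x Z) (constField x X) x =
      s.twist (constField x X) (constField x Y) (constField x Z) x
    rw [s.twist_swap₁₃, s.twist_swap₂₃, neg_neg]
  have h4 : ∀ X Y Z : M.T x, dAt (fun y => B y ![constField x X y, constField x Z y]) x Y =
      -dAt (fun y => B y ![constField x Z y, constField x X y]) x Y := fun X Y Z => by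
    have : (fun y => B y ![constField x X y, constField x Z y]) =
        fun y => -(B y ![constField x Z y, constField x X y]) :=
      funext fun y => B.contract_swap y _ _
    rw [this]
    exact DFunLike.congr_fun (dAt_neg _ x) Y
  rw [M.courant.pairing_symm, ← h2, h3] at h1
  have h5 := B.d_apply_two hB x X Y Z
  have h6 : (s.twistForm + B.d : FormField M.toBundleMfd 3) x ![X, Y, Z] =
    s.twistForm x ![X, Y, Z] + B.d x ![X, Y, Z] := rfl
  rw [h6, h5, h1, h4 Z Y X, h4 Y Z X]
  have h7 : s.cov x (A Z x) ((0 : M.T x →L[ℝ] M.Coord) X) = 0 := map_zero (s.cov x (A Z x))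
  have h8 : s.cov x (A X x) ((0 : M.T x →L[ℝ] M.Coord) Y - (0 : M.T x →L[ℝ] M.Coord) Z) = 0 :=
    (congrArg (s.cov x (A X x)) (sub_self (0 : M.Coord))).trans (map_zero (s.cov x (A X x)))
  rw [h7, h8]
  ring

end Splitting

end ExtGeom

/-! ### Derivatives of maps in charts and along graphs -/

namespace ExtGeom

open BundleMfd

namespace BundleMfd

variable {V W : BundleMfd.{u}}

/-- The expression of a map in the preferred charts. -/
def chartMap (f : V.carrier → W.carrier) (x : V.carrier) : V.Coord → W.Coord :=
  extChartAt W.I (f x) ∘ f ∘ (extChartAt V.I x).symm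

/-- The derivative of the expression of a map in the preferred charts at `x`. -/
def dMap (f : V.carrier → W.carrier) (x x' : V.carrier) : V.Coord →L[ℝ] W.Coord :=
  fderiv ℝ (chartMap f x) (extChartAt V.I x x')




theorem contDiffAt_chartMap {f : V.carrier → W.carrier} (hf : ContMDiff V.I W.I ∞ f)
    (x : V.carrier) : ContDiffAt ℝ ∞ (chartMap f x) (extChartAt V.I x x) := by
  have h := (contMDiffAt_iff.1 (hf x)).2
  simp only [ModelWithCorners.range_eq_univ, contDiffWithinAt_univ] at h
  exact h

theorem contMDiffAt_dMap {f : V.carrier → W.carrier} (hf : ContMDiff V.I W.I ∞ f)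
    (x : V.carrier) : ContMDiffAt V.I 𝓘(ℝ, V.Coord →L[ℝ] W.Coord) ∞ (dMap f x) x :=
  ((contDiffAt_chartMap hf x).fderiv_right (m := ∞) (by simp)).contMDiffAt.comp x
    (contMDiffAt_extChartAt (n := ∞))

theorem dMap_self {f : V.carrier → W.carrier} (hf : ContMDiff V.I W.I ∞ f)
    (x : V.carrier) (X : V.T x) : dMap f x x X = mfderiv V.I W.I f x X := by
  rw [((hf x).mdifferentiableAt (by simp)).mfderiv]
  simp only [writtenInExtChartAt, ModelWithCorners.range_eq_univ, fderivWithin_univ]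
  rfl

/-- Symmetry of the second derivative of the chart expression. It is what makes the second-order
terms cancel in the bracket computation. -/
theorem dAt_dMap_symm {f : V.carrier → W.carrier} (hf : ContMDiff V.I W.I ∞ f)
    (x : V.carrier) (X Y : V.T x) :
    dAt (dMap f x) x X Y = dAt (dMap f x) x Y X := by
  have h : dAt (dMap f x) x =
      fderiv ℝ (fderiv ℝ (chartMap f x)) (extChartAt V.I x x) := by
    refine Filter.EventuallyEq.fderiv_eq ?_
    filter_upwards [(isOpen_extChartAt_target x).mem_nhds (mem_extChartAt_target (I := V.I) x)]
      with y hy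
    simp only [Function.comp, dMap]
    rw [(extChartAt V.I x).right_inv hy]
  rw [h]
  refine ((contDiffAt_chartMap hf x).isSymmSndFDerivAt ?_).eq X Y
  simpa using (WithTop.coe_le_coe.2 le_top : ((2 : ℕ∞) : WithTop ℕ∞) ≤ ((⊤ : ℕ∞) : WithTop ℕ∞))

/-- The chain rule at nearby points, in charts fixed at `x` and `f x`. An identity on a whole
neighbourhood is needed because it will be differentiated. -/
theorem dMap_eventually {f : V.carrier → W.carrier} (hf : ContMDiff V.I W.I ∞ f)
    (x : V.carrier) : ∀ᶠ x' in 𝓝 x, ∀ X : V.T x',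
    dMap f x x' (coordT x x' X) = coordT (f x) (f x') (mfderiv V.I W.I f x' X) := by
  have h2 : ∀ᶠ z in 𝓝 x, f z ∈ (chartAt W.Coord (f x)).source :=
    hf.continuous.continuousAt.eventually (chart_source_mem_nhds _ (f x))
  have h3 : ∀ᶠ z in 𝓝 x, ContDiffAt ℝ 1 (chartMap f x) (extChartAt V.I x z) :=
    (continuousAt_extChartAt (I := V.I) x).eventually
      (((contDiffAt_chartMap hf x).of_le (by simp)).eventually (by simp))
  filter_upwards [h2, h3, chart_source_mem_nhds V.Coord x] with x' h2 h3 h4 X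
  rw [coordT_eq h2]
  refine (congrArg _ (coordT_eq h4 X)).trans ?_
  have hfx : MDifferentiableAt V.I W.I f x' := (hf _).mdifferentiableAt (by simp)
  have hk : MDifferentiableAt W.I 𝓘(ℝ, W.Coord) (extChartAt W.I (f x)) (f x') :=
    mdifferentiableAt_extChartAt h2
  have hl : MDifferentiableAt V.I 𝓘(ℝ, V.Coord) (extChartAt V.I x) x' :=
    mdifferentiableAt_extChartAt h4
  have hc : MDifferentiableAt 𝓘(ℝ, V.Coord) 𝓘(ℝ, W.Coord) (chartMap f x) (extChartAt V.I x x') :=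
    h3.contMDiffAt.mdifferentiableAt (by simp)
  have c1 := DFunLike.congr_fun (mfderiv_comp x' hk hfx) X
  have c2 := DFunLike.congr_fun (mfderiv_comp x' hc hl) X
  have c3 : mfderiv 𝓘(ℝ, V.Coord) 𝓘(ℝ, W.Coord) (chartMap f x) (extChartAt V.I x x') =
    dMap f x x' := mfderiv_eq_fderiv
  have c4 : (chartMap f x ∘ extChartAt V.I x) =ᶠ[𝓝 x'] (extChartAt W.I (f x) ∘ f) := by
    filter_upwards [(chartAt V.Coord x).open_source.mem_nhds h4] with z hz
    simp only [Function.comp, chartMap]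
    rw [(extChartAt V.I x).left_inv (by simpa using hz)]
  have c5 := DFunLike.congr_fun (c4.mfderiv_eq (I := V.I) (I' := 𝓘(ℝ, W.Coord))) X
  rw [c3] at c2
  exact c2.symm.trans (c5.trans c1)



/-- A fixed linear map commutes with differentiation; in particular the coordinates chosen on the
fibre drop out. -/
theorem map_fiberDeriv (x : V.carrier) {G : Type*} [NormedAddCommGroup G] [NormedSpace ℝ G]
    (L : V.fiber x →ₗ[ℝ] G) {g : W.carrier → V.fiber x} {y : W.carrier}
    (hg : ContMDiffAt W.I (V.I.prod 𝓘(ℝ, V.Model)) ∞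
      (fun z => (⟨x, g z⟩ : TotalSpace V.Model V.fiber)) y) (Y : W.T y) :
    L (fiberDeriv V W x g y Y) = dAt (fun z => L (g z)) y Y := by
  let e : V.fiber x ≃L[ℝ] V.Model := VectorBundle.continuousLinearEquivAt ℝ V.Model V.fiber x
  have he : ContMDiffAt W.I 𝓘(ℝ, V.Model) ∞ (fun z => e (g z)) y := (contMDiffAt_totalSpace.1 hg).2
  let L' : V.Model →L[ℝ] G := LinearMap.toContinuousLinearMap
    (L ∘ₗ e.symm.toLinearEquiv.toLinearMap)
  have h1 : L (fiberDeriv V W x g y Y) =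
    L' (mfderiv W.I 𝓘(ℝ, V.Model) (fun z => e (g z)) y Y) := rfl
  rw [h1]
  refine (congrArg L' (mfderiv_eq_dAt (he.mdifferentiableAt (by simp)) Y)).trans ?_
  rw [← dAt_clm L' he]
  congr 2
  funext z
  exact congrArg L (e.symm_apply_apply _)

/-- The derivative along a graph in terms of the partial derivatives. -/
theorem dAt_graph {G : Type*} [NormedAddCommGroup G] [NormedSpace ℝ G]
    {F : V.carrier × W.carrier → G} {f : V.carrier → W.carrier} (hf : ContMDiff V.I W.I ∞ f)
    {x : V.carrier} (hF : ContMDiffAt (V.I.prod W.I) 𝓘(ℝ, G) ∞ F (x, f x)) (X : V.T x) :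
    dAt (fun x' => F (x', f x')) x X = dAt (fun x' => F (x', f x)) x X +
      dAt (fun y => F (x, y)) (f x) (mfderiv V.I W.I f x X) := by
  have hg : ContMDiffAt V.I (V.I.prod W.I) ∞ (fun x' => (x', f x')) x :=
    contMDiffAt_id.prodMk (hf x)
  have h1 : ContMDiffAt V.I 𝓘(ℝ, G) ∞ (fun x' => F (x', f x')) x := hF.comp x hg
  have h2 : ContMDiffAt V.I 𝓘(ℝ, G) ∞ (fun x' => F (x', f x)) x :=
    hF.comp x (contMDiffAt_id.prodMk contMDiffAt_const)
  have h3 : ContMDiffAt W.I 𝓘(ℝ, G) ∞ (fun y => F (x, y)) (f x) :=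
    hF.comp (f x) (contMDiffAt_const.prodMk contMDiffAt_id)
  have hfx : MDifferentiableAt V.I W.I f x := (hf x).mdifferentiableAt (by simp)
  rw [← mfderiv_eq_dAt (h1.mdifferentiableAt (by simp)),
    ← mfderiv_eq_dAt (h2.mdifferentiableAt (by simp)),
    ← mfderiv_eq_dAt (h3.mdifferentiableAt (by simp))]
  have e1 := DFunLike.congr_fun (mfderiv_comp x
    (hF.mdifferentiableAt (by simp) : MDifferentiableAt (V.I.prod W.I) 𝓘(ℝ, G) F (x, f x))
    (hg.mdifferentiableAt (by simp))) X
  have e2 := DFunLike.congr_fun (mfderiv_prodMk (mdifferentiableAt_id (I := V.I) (x := x)) hfx) X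
  let v : TangentSpace (V.I.prod W.I) (x, f x) :=
    ((X, mfderiv V.I W.I f x X) : V.Coord × W.Coord)
  have e3 := mfderiv_prod_eq_add_apply (I := V.I) (I' := W.I) (I'' := 𝓘(ℝ, G)) (f := F)
    (p := (x, f x)) (v := v) (hF.mdifferentiableAt (by simp))
  refine e1.trans ((congrArg _ (e2.trans ?_)).trans e3)
  change (mfderiv V.I V.I id x X, mfderiv V.I W.I f x X) = _
  rw [mfderiv_id]
  rfl

end BundleMfd

end ExtGeom

/-! ### One component of the bracket on the product -/

namespace ExtGeom

open BundleMfd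

namespace CourantAlgebroid

theorem reverse_coanchor {V : BundleMfd.{u}} (A : CourantAlgebroid V) (x : V.carrier)
    (ξ : Module.Dual ℝ (V.T x)) : A.reverse.coanchor x ξ = -A.coanchor x ξ := by
  refine A.reverse.pairing_ext fun B => ?_
  have h1 := A.reverse.two_mul_pairing_coanchor x ξ (B x)
  have h2 := A.two_mul_pairing_coanchor x ξ (B x)
  have h3 : A.reverse.pairing x (-A.coanchor x ξ) (B x) = A.pairing x (A.coanchor x ξ) (B x) := by
    change -(A.pairing x (-A.coanchor x ξ) (B x)) = _
    rw [map_neg, LinearMap.neg_apply, neg_neg]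
  have h4 : A.reverse.anchor x (B x) = A.anchor x (B x) := rfl
  rw [h4] at h1
  rw [h3]
  linarith

end CourantAlgebroid

namespace ProdSec

variable {V W : BundleMfd.{u}}

/-- The section obtained by exchanging the two factors. -/
def swap (P : ProdSec V W) : ProdSec W V where
  fst p := P.snd p.swap
  snd p := P.fst p.swap
  smooth_fst := P.smooth_snd.comp (contMDiff_snd.prodMk contMDiff_fst)
  smooth_snd := P.smooth_fst.comp (contMDiff_snd.prodMk contMDiff_fst)

end ProdSec

section Half

variable {M N : ExtMfd.{u}} (s : Splitting M) (t : Splitting N)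

/-- The covector part of the first component of a section, in the preferred chart at `x`. -/
def covFst (P : ProdSec M.toBundleMfd N.toBundleMfd) (x : M.carrier) (p : M.carrier × N.carrier) :
    M.Coord →L[ℝ] ℝ := s.covC x p.1 (P.fst p)

/-- The vector part of the first component of a section, in the preferred chart at `x`. -/
def vecFst (P : ProdSec M.toBundleMfd N.toBundleMfd) (x : M.carrier) (p : M.carrier × N.carrier) :
    M.Coord := coordT x p.1 (M.courant.anchor p.1 (P.fst p))

/-- The covector part of the second component of a section, in the preferred chart at `y`. -/
def covSnd (P : ProdSec M.toBundleMfd N.toBundleMfd) (y : N.carrier) (p : M.carrier × N.carrier) :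
    N.Coord →L[ℝ] ℝ := t.covC y p.2 (P.snd p)

/-- The vector part of the second component of a section, in the preferred chart at `y`. -/
def vecSnd (P : ProdSec M.toBundleMfd N.toBundleMfd) (y : N.carrier) (p : M.carrier × N.carrier) :
    N.Coord := coordT y p.2 (N.courant.anchor p.2 (P.snd p))

theorem contMDiffAt_covFst (P : ProdSec M.toBundleMfd N.toBundleMfd) (x : M.carrier)
    (p : M.carrier × N.carrier) :
    ContMDiffAt (M.I.prod N.I) 𝓘(ℝ, M.Coord →L[ℝ] ℝ) ∞ (covFst s P x) p :=
  s.contMDiffAt_covC (g := Prod.fst) x (P.smooth_fst p)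

theorem contMDiffAt_vecFst (P : ProdSec M.toBundleMfd N.toBundleMfd)
    (p : M.carrier × N.carrier) :
    ContMDiffAt (M.I.prod N.I) 𝓘(ℝ, M.Coord) ∞ (vecFst P p.1) p :=
  contMDiffAt_coordT_along (g := Prod.fst)
    (M.courant.contMDiffAt_anchor (g := Prod.fst) (P.smooth_fst p))

theorem contMDiffAt_covSnd (P : ProdSec M.toBundleMfd N.toBundleMfd) (y : N.carrier)
    (p : M.carrier × N.carrier) :
    ContMDiffAt (M.I.prod N.I) 𝓘(ℝ, N.Coord →L[ℝ] ℝ) ∞ (covSnd t P y) p :=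
  t.contMDiffAt_covC (g := Prod.snd) y (P.smooth_snd p)

theorem contMDiffAt_vecSnd (P : ProdSec M.toBundleMfd N.toBundleMfd)
    (p : M.carrier × N.carrier) :
    ContMDiffAt (M.I.prod N.I) 𝓘(ℝ, N.Coord) ∞ (vecSnd P p.2) p :=
  contMDiffAt_coordT_along (g := Prod.snd)
    (N.courant.contMDiffAt_anchor (g := Prod.snd) (P.smooth_snd p))

/-- Pairing with the derivative of a function with values in a fixed fibre. -/
theorem two_mul_pairing_fiberDeriv {W : BundleMfd.{u}} {x : M.carrier} {g : W.carrier → M.fiber x}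
    {y : W.carrier} (hg : ContMDiffAt W.I (M.I.prod 𝓘(ℝ, M.Model)) ∞
      (fun z => (⟨x, g z⟩ : TotalSpace M.Model M.fiber)) y) (Y : W.T y) (r : M.fiber x) :
    2 * M.courant.pairing x (fiberDeriv M.toBundleMfd W x g y Y) r =
      dAt (fun z => s.covC x x (g z)) y Y (M.courant.anchor x r) +
      s.covC x x r (dAt (fun z => coordT x x (M.courant.anchor x (g z))) y Y) := by
  rw [s.two_mul_pairing]
  have h1 := map_fiberDeriv x (s.covC x x) hg Y
  have h2 := map_fiberDeriv (G := M.Coord) x (M.courant.anchor x) hg Y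
  have h3 : (fun z => coordT x x (M.courant.anchor x (g z))) = fun z =>
    (M.courant.anchor x (g z) : M.Coord) := funext fun z => coordT_self _ _
  rw [h3, ← h1]
  refine congrArg₂ (· + ·) (s.covC_self x _ _).symm
    ((s.covC_self x r _).symm.trans (congrArg (s.covC x x r) h2))

theorem Splitting.bracket_pairing' (A B : M.Sec) (x : M.carrier) (r : M.fiber x) :
    2 * M.courant.pairing x (M.courant.bracket A B x) r =
      s.twistForm x ![M.courant.anchor x (A x), M.courant.anchor x (B x), M.courant.anchor x r] +
      dAt (fun y => s.covC x y (B y)) x (M.courant.anchor x (A x)) (M.courant.anchor x r) -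
      dAt (fun y => s.covC x y (A y)) x (M.courant.anchor x (B x)) (M.courant.anchor x r) +
      dAt (fun y => s.covC x y (A y)) x (M.courant.anchor x r) (M.courant.anchor x (B x)) +
      s.covC x x (B x) (dAt (fun y => coordT x y (M.courant.anchor y (A y))) x
        (M.courant.anchor x r)) +
      (s.covC x x r
          (dAt (fun y => coordT x y (M.courant.anchor y (B y))) x (M.courant.anchor x (A x))) -
        s.covC x x r
          (dAt (fun y => coordT x y (M.courant.anchor y (A y))) x (M.courant.anchor x (B x)))) := by
  refine (s.bracket_pairing A B x r).trans (congrArg₂ (· + ·)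
    (congrArg (_ + ·) (s.covC_self x (B x) _).symm) ?_)
  exact (s.covC_self x r _).symm.trans (map_sub (s.covC x x r) _ _)

/-- Reversing the pairing on `M` makes the coanchor term negative in both components of the product
bracket. Hence this formula serves for each factor, the second one by exchanging the factors.
Partial derivatives are grouped in pairs that combine to derivatives along the graph; the last two
terms are those which the other component lacks. -/
theorem two_mul_pairing_half (P Q : ProdSec M.toBundleMfd N.toBundleMfd) (x : M.carrier)
    (y : N.carrier) (r : M.fiber x) :
    2 * M.courant.pairing x (M.courant.bracket (P.sliceFst y) (Q.sliceFst y) x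
      + fiberDeriv M.toBundleMfd N.toBundleMfd x (fun z => Q.fst (x, z)) y
          (N.courant.anchor y (P.snd (x, y)))
      - fiberDeriv M.toBundleMfd N.toBundleMfd x (fun z => P.fst (x, z)) y
          (N.courant.anchor y (Q.snd (x, y)))
      - (2 : ℝ) • M.courant.coanchor x ((N.courant.pairing y).flip (Q.snd (x, y)) ∘ₗ
          fiberDeriv N.toBundleMfd M.toBundleMfd y (fun z => P.snd (z, y)) x)) r =
    s.twistForm x ![M.courant.anchor x (P.fst (x, y)), M.courant.anchor x (Q.fst (x, y)),
      M.courant.anchor x r] +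
    (dAt (fun x' => covFst s Q x (x', y)) x (M.courant.anchor x (P.fst (x, y)))
        (M.courant.anchor x r) +
      dAt (fun y' => covFst s Q x (x, y')) y (N.courant.anchor y (P.snd (x, y)))
        (M.courant.anchor x r)) -
    (dAt (fun x' => covFst s P x (x', y)) x (M.courant.anchor x (Q.fst (x, y)))
        (M.courant.anchor x r) +
      dAt (fun y' => covFst s P x (x, y')) y (N.courant.anchor y (Q.snd (x, y)))
        (M.courant.anchor x r)) +
    dAt (fun x' => covFst s P x (x', y)) x (M.courant.anchor x r)
      (M.courant.anchor x (Q.fst (x, y))) +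
    s.covC x x (Q.fst (x, y)) (dAt (fun x' => vecFst P x (x', y)) x (M.courant.anchor x r)) +
    (s.covC x x r (dAt (fun x' => vecFst Q x (x', y)) x (M.courant.anchor x (P.fst (x, y)))) +
      s.covC x x r (dAt (fun y' => vecFst Q x (x, y')) y (N.courant.anchor y (P.snd (x, y))))) -
    (s.covC x x r (dAt (fun x' => vecFst P x (x', y)) x (M.courant.anchor x (Q.fst (x, y)))) +
      s.covC x x r (dAt (fun y' => vecFst P x (x, y')) y (N.courant.anchor y (Q.snd (x, y))))) -
    (dAt (fun x' => covSnd t P y (x', y)) x (M.courant.anchor x r)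
        (N.courant.anchor y (Q.snd (x, y))) +
      t.covC y y (Q.snd (x, y))
        (dAt (fun x' => vecSnd P y (x', y)) x (M.courant.anchor x r))) := by
  have hf : ∀ P : ProdSec M.toBundleMfd N.toBundleMfd,
      ContMDiffAt N.I (M.I.prod 𝓘(ℝ, M.Model)) ∞
      (fun z => (⟨x, P.fst (x, z)⟩ : TotalSpace M.Model M.fiber)) y := fun P =>
    (P.smooth_fst (x, y)).comp y (contMDiffAt_const.prodMk contMDiffAt_id)
  have hg : ContMDiffAt M.I (N.I.prod 𝓘(ℝ, N.Model)) ∞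
      (fun z => (⟨y, P.snd (z, y)⟩ : TotalSpace N.Model N.fiber)) x :=
    (P.smooth_snd (x, y)).comp x (contMDiffAt_id.prodMk contMDiffAt_const)
  have h1 := s.bracket_pairing' (P.sliceFst y) (Q.sliceFst y) x r
  have h2 := two_mul_pairing_fiberDeriv s (hf Q) (N.courant.anchor y (P.snd (x, y))) r
  have h3 := two_mul_pairing_fiberDeriv s (hf P) (N.courant.anchor y (Q.snd (x, y))) r
  have h4 := M.pairing_coanchor x ((N.courant.pairing y).flip (Q.snd (x, y)) ∘ₗ
          fiberDeriv N.toBundleMfd M.toBundleMfd y (fun z => P.snd (z, y)) x) r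
  have h5 := two_mul_pairing_fiberDeriv t hg (M.courant.anchor x r) (Q.snd (x, y))
  have h4' : 2 * M.courant.pairing x (M.courant.coanchor x
      ((N.courant.pairing y).flip (Q.snd (x, y)) ∘ₗ
        fiberDeriv N.toBundleMfd M.toBundleMfd y (fun z => P.snd (z, y)) x)) r =
      N.courant.pairing y (fiberDeriv N.toBundleMfd M.toBundleMfd y (fun z => P.snd (z, y)) x
        (M.courant.anchor x r)) (Q.snd (x, y)) := h4
  simp only [map_sub, map_add, map_smul, LinearMap.sub_apply, LinearMap.add_apply,
    LinearMap.smul_apply, smul_eq_mul]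
  have key : ∀ (b c d e : ℝ) (B C D E : ℝ), 2 * b = B → 2 * c = C → 2 * d = D → 2 * (2 * e) = E →
      2 * (b + c - d - 2 * e) = B + C - D - E := fun b c d e B C D E h1 h2 h3 h4 => by linarith
  refine (key _ _ _ _ _ _ _ _ h1 h2 h3 ((congrArg (2 * ·) h4').trans h5)).trans ?_
  have e : ∀ (T q p p' a b c q2 b2 p2 c2 m v : ℝ), T + q - p + p' + a + (b - c) + (q2 + b2) -
      (p2 + c2) - (m + v) =
    T + (q + q2) - (p + p2) + p' + a + (b + b2) - (c + c2) - (m + v) := by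
    intros; ring
  exact e _ _ _ _ _ _ _ _ _ _ _ _ _

end Half

end ExtGeom

/-! ### The graph structure and its bracket -/

namespace ExtGeom

open BundleMfd

/-- The cancellation as pure linear algebra. `D` and `D'` stand for the first and second derivative
of `f`, index 1 and 2 for source and target. The hypotheses are the differentiated relations `cov₁ =
cov₂ ∘ D` and `vec₂ = D vec₁`, and each occurrence of `D'` meets one of opposite sign by symmetry.
-/
theorem graph_terms_cancel {E₁ E₂ : Type*} [NormedAddCommGroup E₁] [NormedSpace ℝ E₁]
    [NormedAddCommGroup E₂] [NormedSpace ℝ E₂] (D : E₁ →L[ℝ] E₂) (D' : E₁ →L[ℝ] E₁ →L[ℝ] E₂)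
    (hD : ∀ X Y, D' X Y = D' Y X) {q₁ r₁ : E₁ →L[ℝ] ℝ} {p₂ q₂ r₂ : E₂ →L[ℝ] ℝ}
    (hq : ∀ X, q₁ X = q₂ (D X)) (hr : ∀ X, r₁ X = r₂ (D X))
    {dp₁ dq₁ : E₁ →L[ℝ] E₁ →L[ℝ] ℝ} {dp₂ dq₂ : E₁ →L[ℝ] E₂ →L[ℝ] ℝ}
    (hdp : ∀ X Z, dp₁ X Z = p₂ (D' X Z) + dp₂ X (D Z))
    (hdq : ∀ X Z, dq₁ X Z = q₂ (D' X Z) + dq₂ X (D Z)) (XP XQ XR : E₁)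
    {da₁ db₁ : E₁ →L[ℝ] E₁} {da₂ db₂ : E₁ →L[ℝ] E₂}
    (hda : ∀ X, da₂ X = D (da₁ X) + D' X XP) (hdb : ∀ X, db₂ X = D (db₁ X) + D' X XQ) :
    -(dq₁ XP XR - dp₁ XQ XR + dp₁ XR XQ + q₁ (da₁ XR) + r₁ (db₁ XP) - r₁ (da₁ XQ)) +
      (dq₂ XP (D XR) - dp₂ XQ (D XR) + dp₂ XR (D XQ) + q₂ (da₂ XR) + r₂ (db₂ XP) - r₂ (da₂ XQ))
      = 0 := by
  rw [hda, hdb, hda, hdp, hdp, hdq, hq, hr, hr, map_add, map_add, map_add, hD XR XQ, hD XR XP,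
    hD XQ XP]
  ring

section Graph

variable {M N : ExtMfd.{u}} (s : Splitting M) (t : Splitting N)

/-- The graph structure `{(s(X) + (f^*η)^, t(f_* X) + η^)}` attached to a map and two splittings. -/
def graphStr (f : M.carrier → N.carrier) (x : M.carrier) :
    Submodule ℝ (M.fiber x × N.fiber (f x)) where
  carrier := {e | N.courant.anchor (f x) e.2 = mfderiv M.I N.I f x (M.courant.anchor x e.1) ∧
    ∀ X : M.T x, s.cov x e.1 X = t.cov (f x) e.2 (mfderiv M.I N.I f x X)}
  zero_mem' := by
    refine ⟨?_, fun X => ?_⟩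
    · change N.courant.anchor (f x) 0 = mfderiv M.I N.I f x (M.courant.anchor x 0)
      rw [map_zero, map_zero, map_zero]
    · change s.cov x 0 X = t.cov (f x) 0 _
      rw [map_zero, map_zero]
      rfl
  add_mem' := by
    rintro e e' ⟨h1, h2⟩ ⟨h1', h2'⟩
    refine ⟨?_, fun X => ?_⟩
    · change N.courant.anchor (f x) (e.2 + e'.2) =
        mfderiv M.I N.I f x (M.courant.anchor x (e.1 + e'.1))
      rw [map_add, map_add, map_add, h1, h1']
    · change s.cov x (e.1 + e'.1) X = t.cov (f x) (e.2 + e'.2) _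
      rw [map_add, map_add, LinearMap.add_apply, LinearMap.add_apply, h2, h2']
  smul_mem' := by
    rintro c e ⟨h1, h2⟩
    refine ⟨?_, fun X => ?_⟩
    · change N.courant.anchor (f x) (c • e.2) = mfderiv M.I N.I f x (M.courant.anchor x (c • e.1))
      rw [map_smul, map_smul, map_smul, h1]
    · change s.cov x (c • e.1) X = t.cov (f x) (c • e.2) _
      rw [map_smul, map_smul, LinearMap.smul_apply, LinearMap.smul_apply, h2]

variable {s t} {f : M.carrier → N.carrier}

theorem mem_graphStr {x : M.carrier} {e : M.fiber x × N.fiber (f x)} : e ∈ graphStr s t f x ↔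
    N.courant.anchor (f x) e.2 = mfderiv M.I N.I f x (M.courant.anchor x e.1) ∧
    ∀ X : M.T x, s.cov x e.1 X = t.cov (f x) e.2 (mfderiv M.I N.I f x X) := Iff.rfl

variable (hf : ContMDiff M.I N.I ∞ f) {P : ProdSec M.toBundleMfd N.toBundleMfd}
  (hP : ∀ x, (P.fst (x, f x), P.snd (x, f x)) ∈ graphStr s t f x) (x : M.carrier)

include hf hP

/-- The product rule for the covector relation defining the graph structure, which holds at all
points of the graph near `x`. -/
theorem dAt_covFst_graph (X Z : M.T x) :
    dAt (fun x' => covFst s P x (x', f x')) x X Z =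
      t.covC (f x) (f x) (P.snd (x, f x)) (dAt (dMap f x) x X Z) +
      dAt (fun x' => covSnd t P (f x) (x', f x')) x X (dMap f x x Z) := by
  have hg : ContMDiffAt M.I (M.I.prod N.I) ∞ (fun x' => (x', f x')) x :=
    contMDiffAt_id.prodMk (hf x)
  have h1 : ContMDiffAt M.I 𝓘(ℝ, M.Coord →L[ℝ] ℝ) ∞ (fun x' => covFst s P x (x', f x')) x :=
    (contMDiffAt_covFst s P x (x, f x)).comp x hg
  have h2 : ContMDiffAt M.I 𝓘(ℝ, N.Coord →L[ℝ] ℝ) ∞ (fun x' => covSnd t P (f x) (x', f x')) x :=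
    (contMDiffAt_covSnd t P (f x) (x, f x)).comp x hg
  have h3 := contMDiffAt_dMap hf x
  have h4 : ContMDiffAt M.I 𝓘(ℝ, N.Coord) ∞ (fun x' => dMap f x x' Z) x :=
    h3.clm_apply contMDiffAt_const
  have h5 : (fun x' => covFst s P x (x', f x') Z) =ᶠ[𝓝 x]
      fun x' => covSnd t P (f x) (x', f x') (dMap f x x' Z) := by
    filter_upwards [dMap_eventually hf x, constField_eventually x,
      (hf.continuous.continuousAt (x := x)).eventually (constField_eventually (f x))]
      with x' a1 a2 a3
    change s.cov x' (P.fst (x', f x')) (constField x Z x') =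
      t.cov (f x') (P.snd (x', f x')) (constField (f x) (dMap f x x' Z) (f x'))
    rw [(hP x').2]
    refine congrArg (t.cov (f x') (P.snd (x', f x'))) ?_
    refine (a3.2.2.1 _).symm.trans ?_
    refine congrArg (fun v => constField (f x) v (f x')) ?_
    refine (a1 _).symm.trans ?_
    rw [a2.2.1]
  refine (dAt_apply_const h1 Z X).symm.trans ((DFunLike.congr_fun (dAt_congr h5) X).trans ?_)
  refine (dAt_clm_apply h2 h4 X).trans ?_
  exact congrArg (t.covC (f x) (f x) (P.snd (x, f x)) · + _) (dAt_apply_const h3 Z X)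

/-- The same for the relation between the vector parts. -/
theorem dAt_vecSnd_graph (X : M.T x) :
    dAt (fun x' => vecSnd P (f x) (x', f x')) x X =
      dMap f x x (dAt (fun x' => vecFst P x (x', f x')) x X) +
      dAt (dMap f x) x X (M.courant.anchor x (P.fst (x, f x))) := by
  have hg : ContMDiffAt M.I (M.I.prod N.I) ∞ (fun x' => (x', f x')) x :=
    contMDiffAt_id.prodMk (hf x)
  have h1 : ContMDiffAt M.I 𝓘(ℝ, M.Coord) ∞ (fun x' => vecFst P x (x', f x')) x :=
    ContMDiffAt.comp (g := vecFst P x) x (contMDiffAt_vecFst P (x, f x)) hg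
  have h5 : (fun x' => vecSnd P (f x) (x', f x')) =ᶠ[𝓝 x]
      fun x' => dMap f x x' (vecFst P x (x', f x')) := by
    filter_upwards [dMap_eventually hf x] with x' a1
    refine Eq.trans ?_ (a1 _).symm
    exact congrArg (coordT (f x) (f x')) (hP x').1
  refine (DFunLike.congr_fun (dAt_congr h5) X).trans
    ((dAt_clm_apply (contMDiffAt_dMap hf x) h1 X).trans ?_)
  exact congrArg (_ + dAt (dMap f x) x X ·) (coordT_self x _)

attribute [local irreducible] Splitting.twistForm dAt dMap Splitting.covC coordT

/-- The Loday bracket of two sections tangent to the graph structure, paired with an element of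
the graph structure. -/
theorem prodPairing_prodBracket {Q : ProdSec M.toBundleMfd N.toBundleMfd}
    (hQ : ∀ x, (Q.fst (x, f x), Q.snd (x, f x)) ∈ graphStr s t f x)
    {r : M.fiber x × N.fiber (f x)} (hr : r ∈ graphStr s t f x) :
    2 * prodPairing M.courant.reverse N.courant x (f x)
        (prodBracket M.courant.reverse N.courant P Q x (f x)) r =
      (FormField.pullback f t.twistForm - s.twistForm : FormField M.toBundleMfd 3) x
        ![M.courant.anchor x (P.fst (x, f x)), M.courant.anchor x (Q.fst (x, f x)),
          M.courant.anchor x r.1] := by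
  have h1 := two_mul_pairing_half s t P Q x (f x) r.1
  have h2 := two_mul_pairing_half t s P.swap Q.swap (f x) x r.2
  have hD : ∀ X : M.T x, mfderiv M.I N.I f x X = dMap f x x X := fun X => (dMap_self hf x X).symm
  -- Both components are brought to the shape of `two_mul_pairing_half`; the reversed pairing
  -- survives only as the overall minus sign of the first.
  have e0 : 2 * prodPairing M.courant.reverse N.courant x (f x)
        (prodBracket M.courant.reverse N.courant P Q x (f x)) r =
      -(2 * M.courant.pairing x (M.courant.bracket (P.sliceFst (f x)) (Q.sliceFst (f x)) x
      + fiberDeriv M.toBundleMfd N.toBundleMfd x (fun z => Q.fst (x, z)) (f x)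
          (N.courant.anchor (f x) (P.snd (x, f x)))
      - fiberDeriv M.toBundleMfd N.toBundleMfd x (fun z => P.fst (x, z)) (f x)
          (N.courant.anchor (f x) (Q.snd (x, f x)))
      - (2 : ℝ) • M.courant.coanchor x ((N.courant.pairing (f x)).flip (Q.snd (x, f x)) ∘ₗ
          fiberDeriv N.toBundleMfd M.toBundleMfd (f x) (fun z => P.snd (z, f x)) x)) r.1) +
      2 * N.courant.pairing (f x) (N.courant.bracket (P.swap.sliceFst x) (Q.swap.sliceFst x) (f x)
      + fiberDeriv N.toBundleMfd M.toBundleMfd (f x) (fun z => Q.swap.fst (f x, z)) x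
          (M.courant.anchor x (P.swap.snd (f x, x)))
      - fiberDeriv N.toBundleMfd M.toBundleMfd (f x) (fun z => P.swap.fst (f x, z)) x
          (M.courant.anchor x (Q.swap.snd (f x, x)))
      - (2 : ℝ) • N.courant.coanchor (f x) ((M.courant.pairing x).flip (Q.swap.snd (f x, x)) ∘ₗ
          fiberDeriv M.toBundleMfd N.toBundleMfd x (fun z => P.swap.snd (z, x)) (f x))) r.2 := by
    have a1 : ∀ ξ, (2 : ℝ) • M.courant.reverse.coanchor x ξ =
      -((2 : ℝ) • M.courant.coanchor x ξ) := fun ξ => by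
      rw [CourantAlgebroid.reverse_coanchor, smul_neg]
    have a2 : ∀ (v : M.fiber x) (G : N.T (f x) →ₗ[ℝ] M.fiber x),
        (2 : ℝ) • N.courant.coanchor (f x) ((M.courant.reverse.pairing x).flip v ∘ₗ G) =
        -((2 : ℝ) • N.courant.coanchor (f x) ((M.courant.pairing x).flip v ∘ₗ G)) := fun v G => by
      have : (M.courant.reverse.pairing x).flip v ∘ₗ G = -((M.courant.pairing x).flip v ∘ₗ G) := rfl
      rw [this, map_neg, smul_neg]
    have a3 : ∀ u v : M.fiber x, M.courant.reverse.pairing x u v = -M.courant.pairing x u v :=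
      fun _ _ => rfl
    simp only [prodPairing, prodBracket]
    rw [a1, a2, a3, ← sub_eq_add_neg, ← sub_eq_add_neg, mul_add, mul_neg]
    rfl
  rw [e0, h1, h2]
  -- All three elements are tangent to the graph, so their vector parts on `N` are images under
  -- `f_*` and partial derivatives add up to derivatives along the graph.
  have G : ∀ {F : Type} [NormedAddCommGroup F] [NormedSpace ℝ F] (g : M.carrier × N.carrier → F)
      (_ : ContMDiffAt (M.I.prod N.I) 𝓘(ℝ, F) ∞ g (x, f x)) {X : M.T x} {Y : N.T (f x)}
      (_ : Y = mfderiv M.I N.I f x X), dAt (fun x' => g (x', f x')) x X =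
        dAt (fun x' => g (x', f x)) x X + dAt (fun y => g (x, y)) (f x) Y := by
    intro F _ _ g hg X Y hY
    subst hY
    exact dAt_graph hf hg X
  have hPx := (hP x).1
  have hQx := (hQ x).1
  have hrx := hr.1
  have c1 := fun R => contMDiffAt_covFst s R x (x, f x)
  have c2 := fun R => contMDiffAt_covSnd t R (f x) (x, f x)
  have v1 := fun R : ProdSec M.toBundleMfd N.toBundleMfd => contMDiffAt_vecFst R (x, f x)
  have v2 := fun R : ProdSec M.toBundleMfd N.toBundleMfd => contMDiffAt_vecSnd R (x, f x)
  have hc : ∀ e ∈ graphStr s t f x, ∀ X : M.Coord,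
      s.covC x x e.1 X = t.covC (f x) (f x) e.2 (dMap f x x X) := fun e he X => by
    refine (s.covC_self x e.1 X).trans ((he.2 X).trans ?_)
    refine (t.covC_self (f x) e.2 _).symm.trans ?_
    exact congrArg (t.covC (f x) (f x) e.2) (hD X)
  have key := graph_terms_cancel (dMap f x x) (dAt (dMap f x) x)
    (fun X Y => dAt_dMap_symm hf x X Y) (hc _ (hQ x)) (hc _ hr)
    (dAt_covFst_graph hf hP x) (dAt_covFst_graph hf hQ x)
    (M.courant.anchor x (P.fst (x, f x))) (M.courant.anchor x (Q.fst (x, f x)))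
    (M.courant.anchor x r.1) (dAt_vecSnd_graph hf hP x) (dAt_vecSnd_graph hf hQ x)
  have eR : dMap f x x (M.courant.anchor x r.1) = N.courant.anchor (f x) r.2 :=
    (hD _).symm.trans hrx.symm
  have eQ : dMap f x x (M.courant.anchor x (Q.fst (x, f x))) =
    N.courant.anchor (f x) (Q.snd (x, f x)) := (hD _).symm.trans hQx.symm
  -- The derivatives in the direction of `r` have only one partial in each half. The missing ones,
  -- `m2`, `w2` and `m1`, `w1`, are the coanchor terms of the opposite half.
  have arith : ∀ {T1 T2 q1 q1x q1y p1 p1x p1y p1t p1R m2 qa1 q1aR w2 rb1 rbx rby ra1 rax ray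
      q2 q2x q2y p2 p2x p2y p2t p2R m1 qa2 q2aR w1 rb2 rb2x rb2y ra2 ra2x ra2y : ℝ},
      -(q1 - p1 + p1t + qa1 + rb1 - ra1) + (q2 - p2 + p2t + qa2 + rb2 - ra2) = 0 →
      q1 = q1x + q1y → p1 = p1x + p1y → p1t = p1R + m2 → qa1 = q1aR + w2 → rb1 = rbx + rby →
      ra1 = rax + ray → q2 = q2x + q2y → p2 = p2x + p2y → p2t = m1 + p2R → qa2 = w1 + q2aR →
      rb2 = rb2x + rb2y → ra2 = ra2x + ra2y →
      -(T1 + (q1x + q1y) - (p1x + p1y) + p1R + q1aR + (rbx + rby) - (rax + ray) - (m1 + w1)) +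
      (T2 + (q2y + q2x) - (p2y + p2x) + p2R + q2aR + (rb2y + rb2x) - (ra2y + ra2x) - (m2 + w2)) =
        T2 - T1 := by
    intros; linarith
  have hT : t.twistForm (f x) ![N.courant.anchor (f x) (P.snd (x, f x)),
      N.courant.anchor (f x) (Q.snd (x, f x)), N.courant.anchor (f x) r.2] =
      FormField.pullback f t.twistForm x ![M.courant.anchor x (P.fst (x, f x)),
        M.courant.anchor x (Q.fst (x, f x)), M.courant.anchor x r.1] := by
    rw [hPx, hQx, hrx]
    refine congrArg (t.twistForm (f x)) (funext fun i => ?_)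
    fin_cases i <;> rfl
  refine Eq.trans ?_ (congrArg (· - s.twistForm x ![M.courant.anchor x (P.fst (x, f x)),
        M.courant.anchor x (Q.fst (x, f x)), M.courant.anchor x r.1]) hT)
  refine arith key (DFunLike.congr_fun (G _ (c1 Q) hPx) _) (DFunLike.congr_fun (G _ (c1 P) hQx) _)
    (DFunLike.congr_fun (G _ (c1 P) hrx) _)
    ((congrArg (s.covC x x (Q.fst (x, f x))) (G _ (v1 P) hrx)).trans (map_add _ _ _))
    ((congrArg (s.covC x x r.1) (G _ (v1 Q) hPx)).trans (map_add _ _ _))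
    ((congrArg (s.covC x x r.1) (G _ (v1 P) hQx)).trans (map_add _ _ _))
    ?_ ?_ ?_
    ((congrArg (t.covC (f x) (f x) (Q.snd (x, f x))) (G _ (v2 P) hrx)).trans (map_add _ _ _))
    ((congrArg (t.covC (f x) (f x) r.2) (G _ (v2 Q) hPx)).trans (map_add _ _ _))
    ((congrArg (t.covC (f x) (f x) r.2) (G _ (v2 P) hQx)).trans (map_add _ _ _))
  · exact (congrArg _ eR).trans (DFunLike.congr_fun (G _ (c2 Q) hPx) _)
  · exact (congrArg _ eR).trans (DFunLike.congr_fun (G _ (c2 P) hQx) _)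
  · exact (congrArg _ eQ).trans (DFunLike.congr_fun (G _ (c2 P) hrx) _)

end Graph

end ExtGeom

/-! ### The graph structure is a smooth Lagrangian subbundle -/

namespace ExtGeom

open BundleMfd

theorem linearIndependent_and_span_of_injective {E F ι : Type*} [AddCommGroup E] [Module ℝ E]
    [AddCommGroup F] [Module ℝ F] (B : Module.Basis ι ℝ E) (Φ : E →ₗ[ℝ] F)
    (hΦ : Function.Injective Φ) {p : Submodule ℝ F} (hp : ∀ e, e ∈ p ↔ ∃ v, Φ v = e) :
    LinearIndependent ℝ (fun i => Φ (B i)) ∧ Submodule.span ℝ (Set.range fun i => Φ (B i)) = p := by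
  refine ⟨B.linearIndependent.map' Φ (LinearMap.ker_eq_bot.2 hΦ), ?_⟩
  have hr : Set.range (fun i => Φ (B i)) = Φ '' Set.range B := by
    rw [← Set.range_comp]; rfl
  rw [hr, Submodule.span_image, B.span_eq, Submodule.map_top]
  ext e
  rw [LinearMap.mem_range, hp]

section Graph

variable {M N : ExtMfd.{u}} {s : Splitting M} {t : Splitting N} {f : M.carrier → N.carrier}
  {x : M.carrier}

theorem mem_graphStr_of_parts (X : M.T x) (η : Module.Dual ℝ (N.T (f x))) :
    (s.toFun x X + M.courant.coanchor x (η ∘ₗ (mfderiv M.I N.I f x).toLinearMap),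
      t.toFun (f x) (mfderiv M.I N.I f x X) + N.courant.coanchor (f x) η) ∈ graphStr s t f x := by
  refine mem_graphStr.2 ⟨?_, fun Y => ?_⟩
  · change N.courant.anchor (f x) (t.toFun (f x) _ + _) =
      mfderiv M.I N.I f x (M.courant.anchor x (s.toFun x X + _))
    rw [map_add, map_add, s.anchor_apply, t.anchor_apply, M.anchor_coanchor, N.anchor_coanchor,
      add_zero, add_zero]
  · change s.cov x (s.toFun x X + _) Y = t.cov (f x) (t.toFun (f x) _ + _) _
    rw [map_add, map_add, s.cov_toFun, t.cov_toFun, s.cov_coanchor, t.cov_coanchor, zero_add,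
      zero_add]
    rfl

theorem mem_graphStr_iff {e : M.fiber x × N.fiber (f x)} : e ∈ graphStr s t f x ↔
    ∃ (X : M.T x) (η : Module.Dual ℝ (N.T (f x))),
      e.1 = s.toFun x X + M.courant.coanchor x (η ∘ₗ (mfderiv M.I N.I f x).toLinearMap) ∧
      e.2 = t.toFun (f x) (mfderiv M.I N.I f x X) + N.courant.coanchor (f x) η := by
  constructor
  · intro he
    refine ⟨M.courant.anchor x e.1, t.cov (f x) e.2, ?_, ?_⟩
    · have : t.cov (f x) e.2 ∘ₗ (mfderiv M.I N.I f x).toLinearMap = s.cov x e.1 :=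
        LinearMap.ext fun X => (he.2 X).symm
      rw [this]
      exact s.decomp x e.1
    · rw [← he.1]
      exact t.decomp (f x) e.2
  · rintro ⟨X, η, h1, h2⟩
    have := mem_graphStr_of_parts (s := s) (t := t) X η
    rwa [← h1, ← h2] at this

theorem two_mul_prodPairing (e e' : M.fiber x × N.fiber (f x)) :
    2 * prodPairing M.courant.reverse N.courant x (f x) e e' =
      -(s.cov x e.1 (M.courant.anchor x e'.1) + s.cov x e'.1 (M.courant.anchor x e.1)) +
      (t.cov (f x) e.2 (N.courant.anchor (f x) e'.2) +
        t.cov (f x) e'.2 (N.courant.anchor (f x) e.2)) := by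
  rw [← s.two_mul_pairing, ← t.two_mul_pairing]
  change 2 * (-M.courant.pairing x e.1 e'.1 + N.courant.pairing (f x) e.2 e'.2) = _
  ring

theorem prodPairing_graphStr {e e' : M.fiber x × N.fiber (f x)} (he : e ∈ graphStr s t f x)
    (he' : e' ∈ graphStr s t f x) :
    prodPairing M.courant.reverse N.courant x (f x) e e' = 0 := by
  have h := two_mul_prodPairing (s := s) (t := t) e e'
  rw [he.1, he'.1, he.2, he'.2] at h
  linarith

/-- Orthogonality to the elements with `X = 0` and arbitrary `η` says that `e` is tangent to the
graph. Orthogonality to those with `η = 0` and arbitrary `X` is the covector condition. -/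
theorem mem_graphStr_of_perp {e : M.fiber x × N.fiber (f x)}
    (h : ∀ e' ∈ graphStr s t f x, prodPairing M.courant.reverse N.courant x (f x) e e' = 0) :
    e ∈ graphStr s t f x := by
  refine mem_graphStr.2 ⟨?_, fun X => ?_⟩
  · refine sub_eq_zero.1 ((Module.forall_dual_apply_eq_zero_iff ℝ _).1 fun η => ?_)
    have h1 := h _ (mem_graphStr_of_parts (s := s) (t := t) 0 η)
    have h2 := two_mul_prodPairing (s := s) (t := t) e
      (s.toFun x 0 + M.courant.coanchor x (η ∘ₗ (mfderiv M.I N.I f x).toLinearMap),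
        t.toFun (f x) (mfderiv M.I N.I f x 0) + N.courant.coanchor (f x) η)
    rw [h1] at h2
    simp only [map_zero, zero_add, M.anchor_coanchor, N.anchor_coanchor, s.cov_coanchor,
      t.cov_coanchor, mul_zero] at h2
    rw [map_sub]
    have h3 : (η ∘ₗ (mfderiv M.I N.I f x).toLinearMap) (M.courant.anchor x e.1) =
      η (mfderiv M.I N.I f x (M.courant.anchor x e.1)) := rfl
    rw [h3] at h2
    linarith
  · have h1 := h _ (mem_graphStr_of_parts (s := s) (t := t) X 0)
    have h2 := two_mul_prodPairing (s := s) (t := t) e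
      (s.toFun x X + M.courant.coanchor x
        ((0 : Module.Dual ℝ (N.T (f x))) ∘ₗ (mfderiv M.I N.I f x).toLinearMap),
        t.toFun (f x) (mfderiv M.I N.I f x X) + N.courant.coanchor (f x) 0)
    rw [h1] at h2
    simp only [map_zero, add_zero, LinearMap.zero_comp, s.anchor_apply, t.anchor_apply,
      s.cov_toFun, t.cov_toFun, mul_zero, LinearMap.zero_apply] at h2
    linarith

/-- The graph structure is a smooth subbundle. -/
theorem isSmoothSubbundle_graphStr (hf : ContMDiff M.I N.I ∞ f) :
    IsSmoothSubbundle M.toBundleMfd N.toBundleMfd f (graphStr s t f) := by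
  intro x₀
  obtain ⟨κ, hκ, hκ'⟩ := exists_chartFun (f x₀)
  -- Covectors at `f x` are parametrized through the differential of the global function `κ`, so
  -- that `ξ x L` is defined and smooth everywhere while being bijective in `L` near `x₀`.
  let ξ : ∀ x, (N.Coord →L[ℝ] ℝ) →ₗ[ℝ] Module.Dual ℝ (N.T (f x)) := fun x =>
    { toFun := fun L => (L ∘L (dAt κ (f x) : N.T (f x) →L[ℝ] N.Coord)).toLinearMap
      map_add' := fun _ _ => rfl
      map_smul' := fun _ _ => rfl }
  let D : ∀ x, M.T x →ₗ[ℝ] N.T (f x) := fun x => (mfderiv M.I N.I f x).toLinearMap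
  let c : ∀ x, M.Coord →ₗ[ℝ] M.T x := fun x => SmoothBundle.frameAt M.I M.Coord M.T x₀ x
  let Φ : ∀ x, (M.Coord × (N.Coord →L[ℝ] ℝ)) →ₗ[ℝ] M.fiber x × N.fiber (f x) := fun x =>
    ((s.toFun x ∘ₗ c x).coprod (M.courant.coanchor x ∘ₗ (D x).dualMap ∘ₗ ξ x)).prod
      ((t.toFun (f x) ∘ₗ D x ∘ₗ c x).coprod (N.courant.coanchor (f x) ∘ₗ ξ x))
  have hΦ : ∀ x v L, Φ x (v, L) =
      (s.toFun x (constField x₀ v x) +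
        M.courant.coanchor x (ξ x L ∘ₗ (mfderiv M.I N.I f x).toLinearMap),
      t.toFun (f x) (mfderiv M.I N.I f x (constField x₀ v x)) +
        N.courant.coanchor (f x) (ξ x L)) := fun _ _ _ => rfl
  obtain ⟨U, hU, hUo, hxU⟩ := mem_nhds_iff.1 ((constField_eventually x₀).and
    ((hf.continuous.continuousAt (x := x₀)).eventually
      ((constField_eventually (f x₀)).and hκ')))
  let B := Module.finBasis ℝ (M.Coord × (N.Coord →L[ℝ] ℝ))
  refine ⟨U, hUo, hxU, _, fun i x => Φ x (B i), fun i => ?_, fun i => ?_, fun x hx => ?_⟩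
  · intro x _
    refine ContMDiffAt.contMDiffWithinAt ?_
    refine s.contMDiffAt_toFun_add_coanchor (g := id) (X := fun x => constField x₀ (B i).1 x)
      ((constField x₀ (B i).1).contMDiff_toFun x) fun Y => ?_
    exact (B i).2.contMDiff.contMDiffAt.comp x (contMDiffAt_dAt_along hκ
      (contMDiffAt_mfderiv_along (g := id) hf (Y.contMDiff_toFun x)))
  · intro x _
    refine ContMDiffAt.contMDiffWithinAt ?_
    refine t.contMDiffAt_toFun_add_coanchor (g := f)
      (X := fun x => mfderiv M.I N.I f x (constField x₀ (B i).1 x))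
      (contMDiffAt_mfderiv_along (g := id) hf ((constField x₀ (B i).1).contMDiff_toFun x))
      fun Y => ?_
    exact (B i).2.contMDiff.contMDiffAt.comp x (contMDiffAt_dAt_along hκ
      (Y.contMDiff_toFun.contMDiffAt.comp x (hf x)))
  · obtain ⟨h1, h2, h3⟩ := hU hx
    have hinj : Function.Injective (Φ x) := by
      rw [← LinearMap.ker_eq_bot, LinearMap.ker_eq_bot']
      rintro ⟨v, L⟩ h
      rw [hΦ] at h
      have a1 := congrArg (fun e => M.courant.anchor x e.1) h
      have a2 := congrArg (fun e => t.cov (f x) e.2) h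
      simp only [map_add, s.anchor_apply, M.anchor_coanchor, add_zero, Prod.fst_zero,
        map_zero, Prod.snd_zero, t.cov_toFun, t.cov_coanchor, zero_add] at a1 a2
      have b1 : v = 0 := by
        have := h1.2.1 v
        rw [a1] at this
        have h0 := h1.2.1 0
        rw [map_zero] at h0
        exact this.symm.trans h0
      have b2 : L = 0 := by
        ext w
        have := DFunLike.congr_fun a2 (constField (f x₀) w (f x))
        have h4 : ξ x L (constField (f x₀) w (f x)) = L w :=
          congrArg L ((h3 _).trans (h2.2.1 w))
        rw [h4] at this
        exact this
      rw [b1, b2]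
      rfl
    refine linearIndependent_and_span_of_injective B (Φ x) hinj fun e => ?_
    rw [mem_graphStr_iff]
    refine Iff.symm ?_
    constructor
    · rintro ⟨⟨v, L⟩, rfl⟩
      exact ⟨constField x₀ v x, ξ x L, congrArg Prod.fst (hΦ x v L), congrArg Prod.snd (hΦ x v L)⟩
    · rintro ⟨X, η, h4, h5⟩
      let L : N.Coord →L[ℝ] ℝ := LinearMap.toContinuousLinearMap
        (η ∘ₗ SmoothBundle.frameAt N.I N.Coord N.T (f x₀) (f x))
      have hL : ξ x L = η := by
        refine LinearMap.ext fun Y => ?_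
        change η (constField (f x₀) (dAt κ (f x) Y) (f x)) = η Y
        rw [h3, h2.2.2.1]
      refine ⟨(coordT x₀ x X, L), ?_⟩
      rw [hΦ, hL, h1.2.2.1]
      exact Prod.ext h4.symm h5.symm

end Graph

end ExtGeom

/-! ### Extending elements of a subbundle to sections over the product -/

namespace ExtGeom

open BundleMfd

section Extension

theorem BundleMfd.contMDiffAt_coord {V : BundleMfd.{u}} {ES HS S : Type*} [NormedAddCommGroup ES]
    [NormedSpace ℝ ES] [TopologicalSpace HS] {J : ModelWithCorners ℝ ES HS} [TopologicalSpace S]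
    [ChartedSpace HS S] {g : S → V.carrier} {s₀ : S} {σ : ∀ s, V.fiber (g s)}
    (hσ : ContMDiffAt J (V.I.prod 𝓘(ℝ, V.Model)) ∞
      (fun s => (⟨g s, σ s⟩ : TotalSpace V.Model V.fiber)) s₀) {y₀ : V.carrier}
    (hy : g s₀ ∈ (trivializationAt V.Model V.fiber y₀).baseSet) :
    ContMDiffAt J 𝓘(ℝ, V.Model) ∞
      (fun s => (trivializationAt V.Model V.fiber y₀ ⟨g s, σ s⟩).2) s₀ := by
  obtain ⟨h1, h2⟩ := contMDiffAt_totalSpace.1 hσ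
  exact ContMDiffWithinAt.change_section_trivialization
    (f := fun s => (⟨g s, σ s⟩ : TotalSpace V.Model V.fiber)) h1 h2
    ((Trivialization.mem_source _).2 (FiberBundle.mem_baseSet_trivializationAt _ _ _))
    ((Trivialization.mem_source _).2 hy)

/-- Frame sections with variable coefficients. The coefficients may depend on a parameter unrelated
to the base point, as needed over a product. -/
theorem CourantAlgebroid.contMDiffAt_frame {V : BundleMfd.{u}} (C : CourantAlgebroid V)
    {ES HS S : Type*} [NormedAddCommGroup ES]
    [NormedSpace ℝ ES] [TopologicalSpace HS] {J : ModelWithCorners ℝ ES HS} [TopologicalSpace S]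
    [ChartedSpace HS S] {g : S → V.carrier} {s₀ : S} {c : S → V.Model}
    (hg : ContMDiffAt J V.I ∞ g s₀) (hc : ContMDiffAt J 𝓘(ℝ, V.Model) ∞ c s₀) (y₀ : V.carrier) :
    ContMDiffAt J (V.I.prod 𝓘(ℝ, V.Model)) ∞ (fun s => (⟨g s,
      SmoothBundle.frame V.I V.Model V.fiber y₀ (c s) (g s)⟩ : TotalSpace V.Model V.fiber)) s₀ := by
  refine C.contMDiffAt_of_pairing hg fun A => ?_
  let K : S → V.Model →L[ℝ] ℝ := fun s => LinearMap.toContinuousLinearMap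
    ((C.pairing (g s)).flip (A (g s)) ∘ₗ SmoothBundle.frameAt V.I V.Model V.fiber y₀ (g s))
  have hK : ContMDiffAt J 𝓘(ℝ, V.Model →L[ℝ] ℝ) ∞ K s₀ :=
    SmoothBundle.contMDiffAt_clm_of_apply fun v => (C.pairing_smooth
      (SmoothBundle.frame V.I V.Model V.fiber y₀ v) A).contMDiffAt.comp s₀ hg
  exact hK.clm_apply hc

variable {M N : ExtMfd.{u}} {f : M.carrier → N.carrier}

/-- Every element of a smooth subbundle over the graph extends to a section over the product which
is tangent to the subbundle. -/
theorem exists_prodSec (hf : ContMDiff M.I N.I ∞ f)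
    {𝓔 : ∀ x, Submodule ℝ (M.fiber x × N.fiber (f x))}
    (h𝓔 : IsSmoothSubbundle M.toBundleMfd N.toBundleMfd f 𝓔) (x₀ : M.carrier)
    {e : M.fiber x₀ × N.fiber (f x₀)} (he : e ∈ 𝓔 x₀) :
    ∃ P : ProdSec M.toBundleMfd N.toBundleMfd, (∀ x, (P.fst (x, f x), P.snd (x, f x)) ∈ 𝓔 x) ∧
      (P.fst (x₀, f x₀), P.snd (x₀, f x₀)) = e := by
  obtain ⟨U, hUo, hxU, k, b, hb1, hb2, hb⟩ := h𝓔 x₀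
  obtain ⟨a, ha⟩ : ∃ a : Fin k → ℝ, ∑ i, a i • b i x₀ = e := by
    rw [← (hb x₀ hxU).2] at he
    exact (Submodule.mem_span_range_iff_exists_fun ℝ).1 he
  let y₀ := f x₀
  let tr := trivializationAt N.Model N.fiber y₀
  obtain ⟨χ, hχ, hχ1, hχs⟩ := SmoothBundle.exists_bump M.I
    (Filter.inter_mem (hUo.mem_nhds hxU) ((hf.continuous.continuousAt (x := x₀)).eventually
      ((SmoothBundle.frame_eventually N.I N.Model N.fiber y₀).and
        (SmoothBundle.frame_coord_eventually N.I N.Model N.fiber y₀))))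
  have hzero : ∀ x, x ∉ tsupport χ → ∀ᶠ z in 𝓝 x, χ z = 0 := fun x hx => by
    filter_upwards [(isClosed_tsupport χ).isOpen_compl.mem_nhds hx] with z hz
    exact image_eq_zero_of_notMem_tsupport hz
  let β₁ : ∀ x, M.fiber x := fun x => ∑ i, a i • (b i x).1
  let c : M.carrier → N.Model := fun x => χ x • ∑ i, a i • (tr ⟨f x, (b i x).2⟩).2
  have hc : ContMDiff M.I 𝓘(ℝ, N.Model) ∞ c := by
    intro x
    by_cases hx : x ∈ tsupport χ
    · refine (hχ x).smul (contMDiffAt_finsetSum fun i _ => ?_)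
      have hi : ContMDiffAt M.I 𝓘(ℝ, N.Model) ∞ (fun x => (tr ⟨f x, (b i x).2⟩).2) x :=
        contMDiffAt_coord ((hb2 i).contMDiffAt (hUo.mem_nhds (hχs hx).1)) (hχs hx).2.1.1
      have ha : ContMDiffAt M.I 𝓘(ℝ, ℝ) ∞ (fun _ : M.carrier => a i) x := contMDiffAt_const
      exact ha.smul hi
    · refine (contMDiffAt_const (c := (0 : N.Model))).congr_of_eventuallyEq ?_
      filter_upwards [hzero x hx] with z hz
      simp only [c, hz, zero_smul]
  have h1 : ContMDiff M.I (M.I.prod 𝓘(ℝ, M.Model)) ∞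
      (fun x => (⟨x, χ x • β₁ x⟩ : TotalSpace M.Model M.fiber)) := by
    intro x
    by_cases hx : x ∈ tsupport χ
    · refine (hχ x).smul_section (ContMDiffAt.sum_section fun i _ =>
        ContMDiffAt.const_smul_section ((hb1 i).contMDiffAt (hUo.mem_nhds (hχs hx).1)))
    · refine (contMDiff_zeroSection ℝ M.fiber (x := x)).congr_of_eventuallyEq ?_
      filter_upwards [hzero x hx] with z hz
      simp only [hz, zero_smul]
      rfl
  -- The first component ignores the point of `N`. The second takes coefficients from the point of
  -- `M` and is extended along `N` by the frame at `f x₀`. The support of `χ` lies where this frame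
  -- reproduces vectors over `f x`, so on the graph the result is `χ` times a combination of the
  -- local frame of `𝓔`.
  let P : ProdSec M.toBundleMfd N.toBundleMfd :=
    { fst := fun p => χ p.1 • β₁ p.1
      snd := fun p => SmoothBundle.frame N.I N.Model N.fiber y₀ (c p.1) p.2
      smooth_fst := h1.comp contMDiff_fst
      smooth_snd := fun p => N.courant.contMDiffAt_frame (g := Prod.snd) contMDiffAt_snd
        ((hc p.1).comp p contMDiffAt_fst) y₀ }
  have hP : ∀ x, (P.fst (x, f x), P.snd (x, f x)) = χ x • ∑ i, a i • b i x := by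
    intro x
    refine Prod.ext ?_ ?_
    · change χ x • ∑ i, a i • (b i x).1 = χ x • (∑ i, a i • b i x).1
      rw [Prod.fst_sum]
      rfl
    · change SmoothBundle.frameAt N.I N.Model N.fiber y₀ (f x)
        (χ x • ∑ i, a i • (tr ⟨f x, (b i x).2⟩).2) = χ x • (∑ i, a i • b i x).2
      rw [Prod.snd_sum, map_smul]
      by_cases hx : x ∈ tsupport χ
      · congr 1
        rw [map_sum]
        refine Finset.sum_congr rfl fun i _ => ?_
        rw [map_smul]
        exact congrArg (a i • ·) ((hχs hx).2.2 _)
      · rw [image_eq_zero_of_notMem_tsupport hx, zero_smul, zero_smul]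
  refine ⟨P, fun x => ?_, ?_⟩
  · rw [hP]
    by_cases hx : x ∈ tsupport χ
    · refine (𝓔 x).smul_mem _ (Submodule.sum_mem _ fun i _ => Submodule.smul_mem _ _ ?_)
      rw [← (hb x (hχs hx).1).2]
      exact Submodule.subset_span ⟨i, rfl⟩
    · rw [image_eq_zero_of_notMem_tsupport hx, zero_smul]
      exact zero_mem _
  · rw [hP, hχ1.self_of_nhds, one_smul, ha]

end Extension

end ExtGeom

/-! ### Involutivity, maximality and general isotropic structures -/

namespace ExtGeom

open BundleMfd

section

variable {M N : ExtMfd.{u}} {s : Splitting M} {t : Splitting N} {f : M.carrier → N.carrier}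

theorem prodPairing_sub_left (x : M.carrier) (y : N.carrier) (e e' r : M.fiber x × N.fiber y) :
    prodPairing M.courant.reverse N.courant x y (e - e') r =
      prodPairing M.courant.reverse N.courant x y e r -
        prodPairing M.courant.reverse N.courant x y e' r := by
  simp only [prodPairing, Prod.fst_sub, Prod.snd_sub, map_sub, LinearMap.sub_apply]
  ring

/-- The failure of involutivity of the graph structure. -/
theorem prodPairing_prodCourantBracket (hf : ContMDiff M.I N.I ∞ f)
    {P Q : ProdSec M.toBundleMfd N.toBundleMfd}
    (hP : ∀ x, (P.fst (x, f x), P.snd (x, f x)) ∈ graphStr s t f x)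
    (hQ : ∀ x, (Q.fst (x, f x), Q.snd (x, f x)) ∈ graphStr s t f x) (x : M.carrier)
    {r : M.fiber x × N.fiber (f x)} (hr : r ∈ graphStr s t f x) :
    prodPairing M.courant.reverse N.courant x (f x)
        (prodCourantBracket M.courant.reverse N.courant P Q x (f x)) r =
      (FormField.pullback f t.twistForm - s.twistForm : FormField M.toBundleMfd 3) x
        ![M.courant.anchor x (P.fst (x, f x)), M.courant.anchor x (Q.fst (x, f x)),
          M.courant.anchor x r.1] := by
  have h1 := prodPairing_prodBracket hf hP x hQ hr
  have h2 := prodPairing_prodBracket hf hQ x hP hr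
  -- Antisymmetry makes the two orders of the Loday bracket contribute equally, which cancels the
  -- factor 2.
  have h3 : ∀ (α : FormField M.toBundleMfd 3) (X Y Z : M.T x),
      α x ![Y, X, Z] = -α x ![X, Y, Z] := fun α X Y Z => by
    have h := (α x).map_swap ![X, Y, Z] (i := 0) (j := 1) (by simp)
    refine (congrArg (α x) ?_).trans h
    funext i
    fin_cases i <;> rfl
  rw [h3] at h2
  rw [prodCourantBracket, prodPairing_sub_left]
  linarith

/-- For involutivity, the bracket of two tangent sections is orthogonal to the graph structure when
the twisting forms agree, hence lies in it. -/
theorem isIsotropicExtended_graphStr (hf : ContMDiff M.I N.I ∞ f)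
    (h : s.twistForm = FormField.pullback f t.twistForm) :
    IsIsotropicExtended M N f (graphStr s t f) where
  subbundle := isSmoothSubbundle_graphStr hf
  tangent _ _ he := he.1
  surjective x X := ⟨_, mem_graphStr_of_parts (s := s) (t := t) X 0, by
    simp [s.anchor_apply]⟩
  isotropic _ _ he _ he' := prodPairing_graphStr he he'
  involutive P Q hP hQ x := mem_graphStr_of_perp fun r hr => by
    rw [prodPairing_prodCourantBracket hf hP hQ x hr, h, sub_self]
    rfl

theorem IsIsotropicExtended.le_graphStr {𝓔 : ∀ x, Submodule ℝ (M.fiber x × N.fiber (f x))}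
    (h : IsIsotropicExtended M N f 𝓔) (hle : graphStr s t f ≤ 𝓔) : 𝓔 ≤ graphStr s t f :=
  fun x _ he => mem_graphStr_of_perp fun e' he' => h.isotropic x _ he e' (hle x he')

theorem maximal_graphStr (hf : ContMDiff M.I N.I ∞ f)
    (h : s.twistForm = FormField.pullback f t.twistForm) :
    Maximal (IsIsotropicExtended M N f) (graphStr s t f) :=
  ⟨isIsotropicExtended_graphStr hf h, fun _ h' hle => h'.le_graphStr hle⟩

/-- Inclusion suffices: vectors lift to `𝓔`, lifts extend to sections tangent to `𝓔`, and their
bracket stays in the isotropic `𝓔`. The obstruction 3-form therefore vanishes on all triples, before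
`𝓔` is known to be maximal. -/
theorem IsIsotropicExtended.twistForm_eq {𝓔 : ∀ x, Submodule ℝ (M.fiber x × N.fiber (f x))}
    (h : IsIsotropicExtended M N f 𝓔) (hf : ContMDiff M.I N.I ∞ f) (hle : 𝓔 ≤ graphStr s t f) :
    s.twistForm = FormField.pullback f t.twistForm := by
  refine (sub_eq_zero.1 (funext fun x => ?_)).symm
  ext v
  have hv : v = ![v 0, v 1, v 2] := by
    funext i
    fin_cases i <;> rfl
  generalize v 0 = X, v 1 = Y, v 2 = Z at hv
  subst hv
  obtain ⟨eX, hX, rfl⟩ := h.surjective x X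
  obtain ⟨eY, hY, rfl⟩ := h.surjective x Y
  obtain ⟨eZ, hZ, rfl⟩ := h.surjective x Z
  obtain ⟨P, hP, rfl⟩ := exists_prodSec hf h.subbundle x hX
  obtain ⟨Q, hQ, rfl⟩ := exists_prodSec hf h.subbundle x hY
  refine (prodPairing_prodCourantBracket hf (fun x => hle x (hP x)) (fun x => hle x (hQ x)) x
    (hle x hZ)).symm.trans ?_
  exact h.isotropic x _ (h.involutive P Q hP hQ x) _ hZ

variable (s t)

/-- The obstruction `Y ↦ 2⟨e₁, s(Y)⟩ - 2⟨e₂, t(f_* Y)⟩` for an element to be in the graph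
structure. -/
def graphDefect (f : M.carrier → N.carrier) (x : M.carrier) :
    (M.fiber x × N.fiber (f x)) →ₗ[ℝ] Module.Dual ℝ (M.T x) :=
  s.cov x ∘ₗ LinearMap.fst ℝ _ _ -
    (mfderiv M.I N.I f x).toLinearMap.dualMap ∘ₗ t.cov (f x) ∘ₗ LinearMap.snd ℝ _ _

theorem graphDefect_apply (x : M.carrier) (e : M.fiber x × N.fiber (f x)) (Y : M.T x) :
    graphDefect s t f x e Y = s.cov x e.1 Y - t.cov (f x) e.2 (mfderiv M.I N.I f x Y) := rfl

variable {s t}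

/-- Isotropy written in parts, with the vector parts on `N` eliminated by tangency. -/
theorem IsIsotropicExtended.graphDefect_swap
    {𝓔 : ∀ x, Submodule ℝ (M.fiber x × N.fiber (f x))} (h : IsIsotropicExtended M N f 𝓔)
    {x : M.carrier} {e e' : M.fiber x × N.fiber (f x)} (he : e ∈ 𝓔 x) (he' : e' ∈ 𝓔 x) :
    graphDefect s t f x e (M.courant.anchor x e'.1) =
      -graphDefect s t f x e' (M.courant.anchor x e.1) := by
  have h1 := two_mul_prodPairing (s := s) (t := t) e e'
  rw [h.isotropic x e he e' he', h.tangent x e he, h.tangent x e' he'] at h1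
  rw [graphDefect_apply, graphDefect_apply]
  linarith

/-- The skew relation rewrites the defect of `e` on `a(e')` as an expression in which `e` enters
only through its vector part. As the anchor is onto, the defect factors through it. -/
theorem IsIsotropicExtended.exists_bilin {𝓔 : ∀ x, Submodule ℝ (M.fiber x × N.fiber (f x))}
    (h : IsIsotropicExtended M N f 𝓔) (x : M.carrier) :
    ∃ B : M.T x →ₗ[ℝ] Module.Dual ℝ (M.T x), (∀ X, B X X = 0) ∧
      ∀ e ∈ 𝓔 x, B (M.courant.anchor x e.1) = graphDefect s t f x e := by
  let A : 𝓔 x →ₗ[ℝ] M.T x := M.courant.anchor x ∘ₗ LinearMap.fst ℝ _ _ ∘ₗ (𝓔 x).subtype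
  have hA : Function.Surjective A := fun X => by
    obtain ⟨e, he, hX⟩ := h.surjective x X
    exact ⟨⟨e, he⟩, hX⟩
  obtain ⟨g, hg⟩ := A.exists_rightInverse_of_surjective (LinearMap.range_eq_top.2 hA)
  have hB : ∀ e ∈ 𝓔 x, graphDefect s t f x (g (M.courant.anchor x e.1)).1 =
      graphDefect s t f x e := by
    intro e he
    ext Y
    obtain ⟨eY, hY, rfl⟩ := h.surjective x Y
    rw [h.graphDefect_swap (g _).2 hY, h.graphDefect_swap he hY]
    have : M.courant.anchor x (g (M.courant.anchor x e.1)).1.1 = M.courant.anchor x e.1 :=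
      DFunLike.congr_fun hg (M.courant.anchor x e.1)
    rw [this]
  refine ⟨graphDefect s t f x ∘ₗ (𝓔 x).subtype ∘ₗ g, fun X => ?_, hB⟩
  obtain ⟨e, he, rfl⟩ := h.surjective x X
  have h1 := hB e he
  change graphDefect s t f x (g (M.courant.anchor x e.1)).1 (M.courant.anchor x e.1) = 0
  rw [h1]
  exact self_eq_neg.1 (h.graphDefect_swap he he)

theorem contMDiffAt_graphDefect (hf : ContMDiff M.I N.I ∞ f)
    {e : ∀ x, M.fiber x × N.fiber (f x)} {x₀ : M.carrier}
    (h1 : ContMDiffAt M.I (M.I.prod 𝓘(ℝ, M.Model)) ∞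
      (fun x => (⟨x, (e x).1⟩ : TotalSpace M.Model M.fiber)) x₀)
    (h2 : ContMDiffAt M.I (N.I.prod 𝓘(ℝ, N.Model)) ∞
      (fun x => (⟨f x, (e x).2⟩ : TotalSpace N.Model N.fiber)) x₀) (Y : M.VField) :
    ContMDiffAt M.I 𝓘(ℝ, ℝ) ∞ (fun x => graphDefect s t f x (e x) (Y x)) x₀ := by
  have hY := Y.contMDiff_toFun x₀
  have a1 := M.courant.contMDiffAt_pairing (g := id) h1
    (s.contMDiffAt_toFun_along (g := id) hY)
  have a2 := N.courant.contMDiffAt_pairing (g := f) h2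
    (t.contMDiffAt_toFun_along (g := f) (contMDiffAt_mfderiv_along (g := id) hf hY))
  have h2 : ContMDiffAt M.I 𝓘(ℝ, ℝ) ∞ (fun _ : M.carrier => (2 : ℝ)) x₀ := contMDiffAt_const
  exact (h2.mul a1).sub (h2.mul a2)

/-- Every isotropic extended structure is contained in a graph structure, after shifting one of
the splittings by a smooth 2-form. -/
theorem IsIsotropicExtended.exists_form {𝓔 : ∀ x, Submodule ℝ (M.fiber x × N.fiber (f x))}
    (h : IsIsotropicExtended M N f 𝓔) (hf : ContMDiff M.I N.I ∞ f) (s : Splitting M)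
    (t : Splitting N) : ∃ (b : FormField M.toBundleMfd 2) (hb : b.IsSmooth),
      𝓔 ≤ graphStr (s.shift b hb) t f := by
  choose B hB hB' using h.exists_bilin (s := s) (t := t)
  let b : FormField M.toBundleMfd 2 := fun x =>
    ContinuousAlternatingMap.ofBilinear (E := M.Coord) (B x) (hB x)
  have hbB : ∀ x X Y, b.contract x X Y = B x X Y := fun _ _ _ => rfl
  have hb : b.IsSmooth := by
    refine FormField.isSmooth_iff_const.2 fun x₀ v => ?_
    obtain ⟨U, hUo, hxU, k, β, hβ1, hβ2, hβ⟩ := h.subbundle x₀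
    have hβm : ∀ x ∈ U, ∀ i, β i x ∈ 𝓔 x := fun x hx i => by
      rw [← (hβ x hx).2]
      exact Submodule.subset_span ⟨i, rfl⟩
    -- Smoothness of `B` is known only on the vector parts of the frame `β`, which span but may be
    -- dependent. With a right inverse `R` of `A x₀`, the vectors `A x (R u)` form a smooth family
    -- equal to `u` at `x₀`, so `w` solves a smooth linear system which is the identity at `x₀`.
    let A : M.carrier → (Fin k → ℝ) →L[ℝ] M.Coord := fun x =>
      ∑ i, (ContinuousLinearMap.proj (R := ℝ) (φ := fun _ : Fin k => ℝ) i).smulRight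
        (coordT x₀ x (M.courant.anchor x (β i x).1))
    have hA : ∀ x c, A x c = ∑ i, c i • coordT x₀ x (M.courant.anchor x (β i x).1) := fun x c => by
      simp [A]
    have hAs : ∀ c, ContMDiffAt M.I 𝓘(ℝ, M.Coord) ∞ (fun x => A x c) x₀ := fun c => by
      simp only [hA]
      refine contMDiffAt_finsetSum fun i _ => ?_
      have hi : ContMDiffAt M.I 𝓘(ℝ, M.Coord) ∞
          (fun x => coordT x₀ x (M.courant.anchor x (β i x).1)) x₀ :=
        contMDiffAt_coordT_along (g := id) (M.courant.contMDiffAt_anchor (g := id)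
          ((hβ1 i).contMDiffAt (hUo.mem_nhds hxU)))
      have hc : ContMDiffAt M.I 𝓘(ℝ, ℝ) ∞ (fun _ : M.carrier => c i) x₀ := contMDiffAt_const
      exact hc.smul hi
    have hsurj : Function.Surjective (A x₀) := fun X => by
      obtain ⟨e, he, hX⟩ := h.surjective x₀ X
      rw [← (hβ x₀ hxU).2] at he
      obtain ⟨c, rfl⟩ := (Submodule.mem_span_range_iff_exists_fun ℝ).1 he
      refine ⟨c, (hA x₀ c).trans (Eq.trans ?_ hX)⟩
      rw [Prod.fst_sum, map_sum]
      refine Finset.sum_congr rfl fun i _ => ?_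
      rw [coordT_self]
      exact (map_smul (M.courant.anchor x₀) (c i) (β i x₀).1).symm
    obtain ⟨R, hR⟩ := (A x₀).toLinearMap.exists_rightInverse_of_surjective
      (LinearMap.range_eq_top.2 hsurj)
    let R' : M.Coord →L[ℝ] (Fin k → ℝ) := LinearMap.toContinuousLinearMap R
    let L : M.carrier → (M.Coord →L[ℝ] ℝ) →L[ℝ] (M.Coord →L[ℝ] ℝ) := fun x =>
      (ContinuousLinearMap.compL ℝ M.Coord M.Coord ℝ).flip (A x ∘L R')
    have hL : ∀ x w v, L x w v = w (A x (R v)) := fun _ _ _ => rfl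
    let w : M.carrier → M.Coord →L[ℝ] ℝ := fun x => LinearMap.toContinuousLinearMap
      ((B x).flip (constField x₀ (v 1) x) ∘ₗ SmoothBundle.frameAt M.I M.Coord M.T x₀ x)
    have hw : ∀ x u, w x u = B x (constField x₀ u x) (constField x₀ (v 1) x) := fun _ _ => rfl
    have key : ContMDiffAt M.I 𝓘(ℝ, M.Coord →L[ℝ] ℝ) ∞ w x₀ := by
      refine SmoothBundle.contMDiffAt_of_clm_apply (L := L) ?_ ?_ ?_
      · refine SmoothBundle.contMDiffAt_clm_of_apply fun w =>
          SmoothBundle.contMDiffAt_clm_of_apply fun v => ?_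
        exact w.contMDiff.contMDiffAt.comp x₀ (hAs (R v))
      · have : L x₀ = ContinuousLinearMap.id ℝ _ := by
          ext w v
          rw [hL]
          exact congrArg w (DFunLike.congr_fun hR v)
        rw [this]
        exact Function.bijective_id
      · refine SmoothBundle.contMDiffAt_clm_of_apply fun u => ?_
        have h3 : ContMDiffAt M.I 𝓘(ℝ, ℝ) ∞ (fun x => ∑ i, R u i •
            graphDefect s t f x (β i x) (constField x₀ (v 1) x)) x₀ := by
          refine contMDiffAt_finsetSum fun i _ => ?_
          have hi := contMDiffAt_graphDefect (s := s) (t := t) hf (e := β i)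
            ((hβ1 i).contMDiffAt (hUo.mem_nhds hxU)) ((hβ2 i).contMDiffAt (hUo.mem_nhds hxU))
            (constField x₀ (v 1))
          have hc : ContMDiffAt M.I 𝓘(ℝ, ℝ) ∞ (fun _ : M.carrier => R u i) x₀ := contMDiffAt_const
          exact hc.smul hi
        refine h3.congr_of_eventuallyEq ?_
        filter_upwards [constField_eventually x₀, hUo.mem_nhds hxU] with x hx hxU
        rw [hL, hA, map_sum]
        refine Finset.sum_congr rfl fun i _ => ?_
        rw [map_smul, hw, hx.2.2.1, hB' x _ (hβm x hxU i)]
    have h4 := key.clm_apply (contMDiffAt_const (c := (v 0 : M.Coord)))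
    exact h4
  refine ⟨b, hb, fun x e he => mem_graphStr.2 ⟨h.tangent x e he, fun Y => ?_⟩⟩
  have h1 := DFunLike.congr_fun (hB' x e he) Y
  rw [graphDefect_apply] at h1
  rw [s.shift_cov, b.contract_swap, hbB, h1]
  ring

end

end ExtGeom

/-! ### Existence of splittings -/

namespace ExtGeom

open BundleMfd

variable (M : ExtMfd.{u})

/-- Near a point, a coordinate field lifts to a section of the extended tangent bundle. -/
theorem exists_lift_constField (x₀ : M.carrier) (v : M.Coord) :
    ∃ A : M.Sec, ∀ᶠ x in 𝓝 x₀, M.courant.anchor x (A x) = constField x₀ v x := by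
  obtain ⟨κ, hκ, hκ'⟩ := exists_chartFun (V := M.toBundleMfd) x₀
  let φ := SmoothBundle.frame M.I M.Model M.fiber x₀
  let A : M.carrier → M.Model →L[ℝ] M.Coord := fun x => LinearMap.toContinuousLinearMap
    ((dAt κ x).toLinearMap ∘ₗ M.courant.anchor x ∘ₗ
      SmoothBundle.frameAt M.I M.Model M.fiber x₀ x)
  have hA : ∀ x u, A x u = dAt κ x (M.courant.anchor x (φ u x)) := fun _ _ => rfl
  have hAs : ∀ u, ContMDiff M.I 𝓘(ℝ, M.Coord) ∞ fun x => A x u := fun u x =>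
    contMDiffAt_dAt_along (g := id) hκ ((M.courant.anchorField (φ u)).contMDiff_toFun x)
  have hsurj : Function.Surjective (A x₀) := fun X => by
    obtain ⟨e, he⟩ := M.anchor_surjective x₀ X
    obtain ⟨u, hu⟩ :=
      (SmoothBundle.frameAt_bijective_eventually M.I M.Model M.fiber x₀).self_of_nhds.2 e
    refine ⟨u, ?_⟩
    have h1 : M.courant.anchor x₀ (φ u x₀) = X := (congrArg _ hu).trans he
    exact (hκ'.self_of_nhds _).trans ((coordT_self _ _).trans h1)
  obtain ⟨R, hR⟩ := (A x₀).toLinearMap.exists_rightInverse_of_surjective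
    (LinearMap.range_eq_top.2 hsurj)
  let R' : M.Coord →L[ℝ] M.Model := LinearMap.toContinuousLinearMap R
  let L : M.carrier → M.Coord →L[ℝ] M.Coord := fun x => A x ∘L R'
  have hL : ContMDiff M.I 𝓘(ℝ, M.Coord →L[ℝ] M.Coord) ∞ L := fun x =>
    SmoothBundle.contMDiffAt_clm_of_apply fun u => hAs (R u) x
  have hL0 : L x₀ = 1 := by
    ext1 u
    exact DFunLike.congr_fun hR u
  have hU : IsOpen {x | IsUnit (L x)} := Units.isOpen.preimage hL.continuous
  -- `Ring.inverse` is 0 where `L x` is not invertible, so `w` may be discontinuous there; the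
  -- cut-off `χ` is supported where `L` is invertible.
  let w : M.carrier → M.Coord := fun x => Ring.inverse (L x) v
  have hLw : ∀ x, IsUnit (L x) → L x (w x) = v := fun x hx =>
    DFunLike.congr_fun (Ring.mul_inverse_cancel (L x) hx) v
  have hw : ∀ x, IsUnit (L x) → ContMDiffAt M.I 𝓘(ℝ, M.Coord) ∞ w x := fun x hx => by
    refine SmoothBundle.contMDiffAt_of_clm_apply (hL x) ?_
      ((contMDiffAt_const (c := v)).congr_of_eventuallyEq ?_)
    · obtain ⟨a, ha⟩ := hx
      rw [← ha]
      exact (ContinuousLinearEquiv.ofUnit a).bijective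
    · filter_upwards [hU.mem_nhds hx] with z hz
      exact hLw z hz
  obtain ⟨χ, hχ, hχ1, hχs⟩ := SmoothBundle.exists_bump M.I (hU.mem_nhds (x := x₀) (by
    change IsUnit (L x₀)
    rw [hL0]
    exact isUnit_one))
  have hχw : ContMDiff M.I 𝓘(ℝ, M.Coord) ∞ fun x => χ x • w x := by
    intro x
    by_cases hx : x ∈ tsupport χ
    · exact (hχ x).smul (hw x (hχs hx))
    · refine (contMDiffAt_const (c := (0 : M.Coord))).congr_of_eventuallyEq ?_
      filter_upwards [(isClosed_tsupport χ).isOpen_compl.mem_nhds hx] with z hz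
      simp [image_eq_zero_of_notMem_tsupport hz]
  let S : M.Sec :=
    { toFun := fun x => SmoothBundle.frame M.I M.Model M.fiber x₀ (R' (χ x • w x)) x
      contMDiff_toFun := fun x => M.courant.contMDiffAt_frame (g := id) contMDiffAt_id
        ((R'.contMDiff.comp hχw) x) x₀ }
  refine ⟨S, ?_⟩
  filter_upwards [hχ1, hκ', constField_eventually x₀, hU.mem_nhds (x := x₀) (by
    change IsUnit (L x₀)
    rw [hL0]
    exact isUnit_one)] with x h1 h2 h3 h4
  have h5 : coordT x₀ x (M.courant.anchor x (S x)) = v := by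
    have h6 : S x = φ (R' (w x)) x := by
      change φ (R' (χ x • w x)) x = _
      rw [h1, one_smul]
    rw [h6]
    exact (h2 _).symm.trans (hLw x h4)
  rw [← h3.2.2.1 (M.courant.anchor x (S x)), h5]

/-- Combine lifts of the coordinate fields with coefficients from the differential of a chart
function. Smoothness is expressed by scalar functions so that local solutions can be summed with a
partition of unity. -/
theorem exists_local_splitting (x₀ : M.carrier) :
    ∃ σ : ∀ x, M.T x →ₗ[ℝ] M.fiber x,
      (∀ A : M.Sec, ContMDiff M.I.tangent 𝓘(ℝ, ℝ) ∞ fun v : TangentBundle M.I M.carrier =>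
        M.courant.pairing v.1 (σ v.1 v.2) (A v.1)) ∧
      ∀ᶠ x in 𝓝 x₀, ∀ X, M.courant.anchor x (σ x X) = X := by
  obtain ⟨κ, hκ, hκ'⟩ := exists_chartFun (V := M.toBundleMfd) x₀
  let B := Module.finBasis ℝ M.Coord
  choose S hS using fun i => exists_lift_constField M x₀ (B i)
  let σ : ∀ x, M.T x →ₗ[ℝ] M.fiber x := fun x =>
    ∑ i, ((B.coord i) ∘ₗ (dAt κ x).toLinearMap).smulRight (S i x)
  have hσ : ∀ x X, σ x X = ∑ i, B.coord i (dAt κ x X) • S i x := fun x X => by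
    simp [σ, LinearMap.sum_apply]
  refine ⟨σ, fun A v => ?_, ?_⟩
  · have h : (fun v : TangentBundle M.I M.carrier => M.courant.pairing v.1 (σ v.1 v.2) (A v.1)) =
        fun v => ∑ i, LinearMap.toContinuousLinearMap (B.coord i) (dAt κ v.1 v.2) *
          M.courant.pairing v.1 (S i v.1) (A v.1) := by
      funext v
      rw [hσ, map_sum, LinearMap.sum_apply]
      refine Finset.sum_congr rfl fun i _ => ?_
      rw [map_smul]
      rfl
    rw [h]
    have hid : ContMDiffAt M.I.tangent M.I.tangent ∞
        (fun v : TangentBundle M.I M.carrier => (⟨v.1, v.2⟩ : TangentBundle M.I M.carrier)) v :=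
      contMDiffAt_id
    refine contMDiffAt_finsetSum fun i _ => ContMDiffAt.mul ?_ ?_
    · exact (ContinuousLinearMap.contMDiff _).contMDiffAt.comp v
        (contMDiffAt_dAt_along (g := fun v : TangentBundle M.I M.carrier => v.1) hκ hid)
    · exact (M.courant.pairing_smooth (S i) A v.1).comp v (contMDiffAt_totalSpace.1 hid).1
  · filter_upwards [hκ', constField_eventually x₀, eventually_all.2 hS] with x h1 h2 h3 X
    rw [hσ, map_sum]
    have h4 : ∑ i, M.courant.anchor x (B.coord i (dAt κ x X) • S i x) =
        SmoothBundle.frameAt M.I M.Coord M.T x₀ x (∑ i, B.coord i (dAt κ x X) • B i) := by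
      rw [map_sum]
      refine Finset.sum_congr rfl fun i _ => ?_
      rw [map_smul, map_smul, h3]
      rfl
    rw [h4]
    have h5 : ∑ i, B.coord i (dAt κ x X) • B i = dAt κ x X := B.sum_repr _
    rw [h5, h1]
    exact h2.2.2.1 X

/-- Being a right inverse of the anchor is an affine condition, hence preserved by locally finite
averages with weights of sum 1. -/
theorem exists_smooth_section_of_anchor :
    ∃ σ : ∀ x, M.T x →ₗ[ℝ] M.fiber x,
      (∀ A : M.Sec, ContMDiff M.I.tangent 𝓘(ℝ, ℝ) ∞ fun v : TangentBundle M.I M.carrier =>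
        M.courant.pairing v.1 (σ v.1 v.2) (A v.1)) ∧
      ∀ x X, M.courant.anchor x (σ x X) = X := by
  choose σ hσ ha using exists_local_splitting M
  choose U hU hUo hxU using fun x₀ => mem_nhds_iff.1 (ha x₀)
  have : LocallyCompactSpace M.carrier := Manifold.locallyCompact_of_finiteDimensional M.I
  obtain ⟨ρ, hρ⟩ := SmoothPartitionOfUnity.exists_isSubordinate M.I
    (isClosed_univ : IsClosed (Set.univ : Set M.carrier)) U hUo
    (fun x _ => Set.mem_iUnion.2 ⟨x, hxU x⟩)
  let τ : ∀ x, M.T x →ₗ[ℝ] M.fiber x := fun x => ∑ᶠ i, ρ i x • σ i x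
  have hfin : ∀ x, (Function.support fun i => ρ i x • σ i x).Finite := fun x => by
    refine (ρ.locallyFinite.point_finite x).subset fun i hi => ?_
    intro h0
    exact hi (by simp only [h0, zero_smul])
  have hτ : ∀ (x : M.carrier) (Λ : (M.T x →ₗ[ℝ] M.fiber x) →ₗ[ℝ] ℝ),
      Λ (τ x) = ∑ᶠ i, ρ i x • Λ (σ i x) := fun x Λ =>
    (map_finsum Λ (hfin x)).trans (finsum_congr fun i => map_smul Λ _ _)
  refine ⟨τ, fun A => ?_, fun x X => ?_⟩
  · have h : (fun v : TangentBundle M.I M.carrier => M.courant.pairing v.1 (τ v.1 v.2) (A v.1)) =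
        fun v => ∑ᶠ i, ρ i v.1 • M.courant.pairing v.1 (σ i v.1 v.2) (A v.1) := by
      funext v
      exact hτ v.1 ((M.courant.pairing v.1).flip (A v.1) ∘ₗ LinearMap.applyₗ v.2)
    have hpr : ContMDiff M.I.tangent M.I ∞ (fun v : TangentBundle M.I M.carrier => v.1) :=
      Bundle.contMDiff_proj M.T
    rw [h]
    refine contMDiff_finsum (fun i => ((ρ i).contMDiff.comp hpr).smul (hσ i A)) ?_
    refine (ρ.locallyFinite.preimage_continuous hpr.continuous).subset fun i v hv => ?_
    intro h0
    exact hv (by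
      change ρ i v.1 = 0 at h0
      change ρ i v.1 • _ = 0
      rw [h0, zero_smul])
  · refine sub_eq_zero.1 ((Module.forall_dual_apply_eq_zero_iff ℝ _).1 fun η => ?_)
    have h1 := hτ x (η ∘ₗ M.courant.anchor x ∘ₗ LinearMap.applyₗ X)
    have h2 : ∀ i, ρ i x • η (M.courant.anchor x (σ i x X)) = ρ i x * η X := fun i => by
      by_cases hi : ρ i x = 0
      · rw [hi, zero_smul, zero_mul]
      · rw [hU i (hρ i (subset_tsupport _ hi)) X, smul_eq_mul]
    rw [map_sub, sub_eq_zero]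
    refine h1.trans ((finsum_congr h2).trans ?_)
    rw [← finsum_mul' _ _ (ρ.locallyFinite.point_finite x), ρ.sum_eq_one (Set.mem_univ x), one_mul]

/-- Every extended manifold has an isotropic splitting. -/
theorem nonempty_splitting : Nonempty (Splitting M) := by
  obtain ⟨σ, hσ, ha⟩ := exists_smooth_section_of_anchor M
  have hs : ∀ v : TangentBundle M.I M.carrier,
      ContMDiffAt M.I.tangent (M.I.prod 𝓘(ℝ, M.Model)) ∞
        (fun v : TangentBundle M.I M.carrier =>
          (⟨v.1, σ v.1 v.2⟩ : TotalSpace M.Model M.fiber)) v := fun v =>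
    M.courant.contMDiffAt_of_pairing (Bundle.contMDiff_proj M.T v) fun A => hσ A v
  -- Subtracting the covector `g(X)` removes half of `⟨σ(X), σ(Y)⟩` from each argument of the
  -- pairing; covectors are isotropic, so the result is zero.
  let g : ∀ x, M.T x →ₗ[ℝ] Module.Dual ℝ (M.T x) := fun x =>
    (σ x).dualMap ∘ₗ M.courant.pairing x ∘ₗ σ x
  have hg : ∀ x X Y, g x X Y = M.courant.pairing x (σ x X) (σ x Y) := fun _ _ _ => rfl
  refine ⟨⟨fun x => σ x - M.courant.coanchor x ∘ₗ g x, fun v => ?_, fun x X => ?_,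
    fun x X Y => ?_⟩⟩
  · refine M.courant.contMDiffAt_of_pairing (Bundle.contMDiff_proj M.T v) fun A => ?_
    have h1 := hσ (⟨fun x => σ x (M.courant.anchor x (A x)), fun x =>
      (hs _).comp x ((M.courant.anchorField A).contMDiff_toFun x)⟩) v
    have h0 : ContMDiffAt M.I.tangent 𝓘(ℝ, ℝ) ∞
      (fun _ : TangentBundle M.I M.carrier => (1 / 2 : ℝ)) v := contMDiffAt_const
    refine ((hσ A v).sub (h0.mul h1)).congr_of_eventuallyEq (Eventually.of_forall fun v => ?_)
    have h2 := M.pairing_coanchor v.1 (g v.1 v.2) (A v.1)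
    change M.courant.pairing v.1 (σ v.1 v.2 - M.courant.coanchor v.1 (g v.1 v.2)) (A v.1) =
      M.courant.pairing v.1 (σ v.1 v.2) (A v.1) - 1 / 2 * g v.1 v.2 (M.courant.anchor v.1 (A v.1))
    rw [map_sub, LinearMap.sub_apply, ← h2]
    ring
  · simp [ha]
  · have h1 := M.pairing_coanchor x (g x X) (σ x Y)
    have h2 := M.pairing_coanchor x (g x Y) (σ x X)
    have h3 := M.pairing_coanchor x (g x X) (M.courant.coanchor x (g x Y))
    rw [ha, hg] at h1 h2
    rw [M.anchor_coanchor, map_zero] at h3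
    have h4 := M.courant.pairing_symm x (σ x X) (σ x Y)
    have h5 := M.courant.pairing_symm x (σ x X) (M.courant.coanchor x (g x Y))
    change M.courant.pairing x (σ x X - M.courant.coanchor x (g x X))
      (σ x Y - M.courant.coanchor x (g x Y)) = 0
    simp only [map_sub, LinearMap.sub_apply]
    linarith

end ExtGeom

/-! ### Morphisms and 2-forms -/

namespace ExtGeom

open BundleMfd

namespace Morph

section Two

variable {M N : ExtMfd.{u}} {φ ψ : Morph M N} {sM : Splitting M} {sN : Splitting N}
  {b c : FormField M.toBundleMfd 2}

/-- Absorbing `b` into the splitting of the source reduces statements about 2-forms to the untwisted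
graph structure. -/
theorem isGivenBy_iff (hb : b.IsSmooth) :
    φ.IsGivenBy sM sN b ↔ φ.str = graphStr (sM.shift b hb) sN φ.map := by
  have key : ∀ (x : M.carrier) (e : M.fiber x × N.fiber (φ.map x)),
      e ∈ graphStr (sM.shift b hb) sN φ.map x ↔
      ∃ (X : M.T x) (η : Module.Dual ℝ (N.T (φ.map x))),
      e.1 = sM.toFun x X
        + M.courant.coanchor x (η ∘ₗ (mfderiv M.I N.I φ.map x).toLinearMap)
        + M.courant.coanchor x (b.contract x X) ∧
      e.2 = sN.toFun (φ.map x) (mfderiv M.I N.I φ.map x X) + N.courant.coanchor (φ.map x) η := by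
    intro x e
    rw [mem_graphStr_iff]
    refine exists_congr fun X => exists_congr fun η => and_congr_left fun _ => ?_
    rw [sM.shift_toFun, add_right_comm]
  constructor
  · intro h
    funext x
    ext e
    rw [h.2, key]
  · intro h
    refine ⟨hb, fun x e => ?_⟩
    rw [h, key]

theorem exists_isGivenBy (φ : Morph M N) (sM : Splitting M) (sN : Splitting N) :
    ∃ b, φ.IsGivenBy sM sN b := by
  obtain ⟨b, hb, hle⟩ := φ.maximal.1.exists_form φ.smooth sM sN
  refine ⟨b, (isGivenBy_iff hb).2 (le_antisymm hle ?_)⟩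
  -- The inclusion makes the twisting forms agree, so the graph structure is an admissible
  -- competitor and maximality of `φ.str` applies.
  exact φ.maximal.2 (isIsotropicExtended_graphStr φ.smooth
    (φ.maximal.1.twistForm_eq φ.smooth hle)) hle

/-- The element with `η = 0` built from `b` must satisfy the covector condition for `c`, which
compares `ι_X b` with `ι_X c`. -/
theorem IsGivenBy.form_unique (h : φ.IsGivenBy sM sN b) (h' : φ.IsGivenBy sM sN c) : b = c := by
  refine FormField.contract_injective fun x X => LinearMap.ext fun Y => ?_
  have hb := h.1
  have hc := h'.1
  have h1 := (isGivenBy_iff hb).1 h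
  have h2 := (isGivenBy_iff hc).1 h'
  have h3 := mem_graphStr_of_parts (s := sM.shift b hb) (t := sN) (f := φ.map) X 0
  rw [← h1, h2] at h3
  have h4 := h3.2 Y
  rw [sM.shift_cov] at h4
  simp only [LinearMap.zero_comp, map_zero, add_zero, Splitting.cov_toFun, LinearMap.zero_apply,
    Splitting.anchor_apply, sM.shift_toFun, map_add, Splitting.cov_coanchor,
    zero_add, M.anchor_coanchor] at h4
  rw [c.contract_swap x Y X] at h4
  linarith

theorem IsGivenBy.twistForm_eq (h : φ.IsGivenBy sM sN b) :
    sM.twistForm + b.d = FormField.pullback φ.map sN.twistForm := by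
  rw [← (sM.isShift_shift b h.1).twistForm_eq h.1]
  exact φ.maximal.1.twistForm_eq φ.smooth ((isGivenBy_iff h.1).1 h).le

/-- The type of the structure depends on the map. Expressing both structures as one function `G` of
the map lets the maps be identified first. -/
theorem eq_of_str_eq {G : ∀ (f : M.carrier → N.carrier) (x : M.carrier),
    Submodule ℝ (M.fiber x × N.fiber (f x))} (h : φ.str = G φ.map) (h' : ψ.str = G ψ.map)
    (hm : φ.map = ψ.map) : φ = ψ := by
  obtain ⟨f, 𝓔, hf, hmax⟩ := φ
  obtain ⟨g, 𝓕, hg, hmax'⟩ := ψ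
  simp only at hm h h'
  subst hm
  exact Morph.ext rfl (heq_of_eq (h.trans h'.symm))

theorem IsGivenBy.morph_unique (h : φ.IsGivenBy sM sN b) (h' : ψ.IsGivenBy sM sN b)
    (hm : φ.map = ψ.map) : φ = ψ := by
  exact eq_of_str_eq (G := graphStr (sM.shift b h.1) sN) ((isGivenBy_iff h.1).1 h)
    ((isGivenBy_iff h.1).1 h') hm

/-- The morphism given by a 2-form. -/
def ofForm {f : M.carrier → N.carrier} (hf : ContMDiff M.I N.I ∞ f) (hb : b.IsSmooth)
    (h : sM.twistForm + b.d = FormField.pullback f sN.twistForm) : Morph M N where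
  map := f
  str := graphStr (sM.shift b hb) sN f
  smooth := hf
  maximal := maximal_graphStr hf (((sM.isShift_shift b hb).twistForm_eq hb).trans h)

theorem isGivenBy_ofForm {f : M.carrier → N.carrier} (hf : ContMDiff M.I N.I ∞ f)
    (hb : b.IsSmooth) (h : sM.twistForm + b.d = FormField.pullback f sN.twistForm) :
    (ofForm hf hb h).IsGivenBy sM sN b :=
  (isGivenBy_iff hb).2 rfl

theorem IsGivenBy.change {sM' : Splitting M} {sN' : Splitting N}
    {BM : FormField M.toBundleMfd 2} {BN : FormField N.toBundleMfd 2} (hBM : BM.IsSmooth)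
    (hBN : BN.IsSmooth) (hM : sM.IsShift BM sM') (hN : sN.IsShift BN sN')
    (h : φ.IsGivenBy sM sN b) :
    φ.IsGivenBy sM' sN' (b - BM + FormField.pullback φ.map BN) := by
  refine ⟨(h.1.sub hBM).add (hBN.pullback φ.smooth), fun x e => (h.2 x e).trans ?_⟩
  have hc : ∀ X : M.T x, FormField.contract (b - BM + FormField.pullback φ.map BN) x X =
      b.contract x X - BM.contract x X + BN.contract (φ.map x) (mfderiv M.I N.I φ.map x X) ∘ₗ
        (mfderiv M.I N.I φ.map x).toLinearMap := fun X => by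
    rw [FormField.contract_form_add, FormField.contract_form_sub, FormField.contract_pullback]
  constructor
  · rintro ⟨X, η, h1, h2⟩
    -- The change of `s_N` is absorbed in `η`; its pullback then reappears on `M` as the summand
    -- `f^*B_N`.
    refine ⟨X, η - BN.contract (φ.map x) (mfderiv M.I N.I φ.map x X), ?_, ?_⟩
    · rw [h1, hc, hM x X, LinearMap.sub_comp]
      simp only [map_add, map_sub]
      abel
    · rw [h2, hN _ _, map_sub]
      abel
  · rintro ⟨X, η, h1, h2⟩
    refine ⟨X, η + BN.contract (φ.map x) (mfderiv M.I N.I φ.map x X), ?_, ?_⟩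
    · rw [h1, hc, hM x X, LinearMap.add_comp]
      simp only [map_add, map_sub]
      abel
    · rw [h2, hN _ _, map_add]
      abel

end Two

/-! ### Composition -/

section Comp

variable {M N P : ExtMfd.{u}}

/-- The composition of the structures of two morphisms, as relations. -/
def compStr (φ : Morph M N) (ψ : Morph N P) (x : M.carrier) :
    Submodule ℝ (M.fiber x × P.fiber ((ψ.map ∘ φ.map) x)) where
  carrier := {e | ∃ e' : N.fiber (φ.map x), (e.1, e') ∈ φ.str x ∧ (e', e.2) ∈ ψ.str (φ.map x)}
  zero_mem' := ⟨0, (φ.str x).zero_mem, (ψ.str (φ.map x)).zero_mem⟩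
  add_mem' := by
    rintro e f ⟨e', h1, h2⟩ ⟨f', h3, h4⟩
    exact ⟨e' + f', (φ.str x).add_mem h1 h3, (ψ.str (φ.map x)).add_mem h2 h4⟩
  smul_mem' := by
    rintro c e ⟨e', h1, h2⟩
    exact ⟨c • e', (φ.str x).smul_mem c h1, (ψ.str (φ.map x)).smul_mem c h2⟩

theorem mem_compStr {φ : Morph M N} {ψ : Morph N P} {x : M.carrier}
    {e : M.fiber x × P.fiber ((ψ.map ∘ φ.map) x)} : e ∈ compStr φ ψ x ↔
    ∃ e' : N.fiber (φ.map x), (e.1, e') ∈ φ.str x ∧ (e', e.2) ∈ ψ.str (φ.map x) := Iff.rfl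

variable {φ : Morph M N} {ψ : Morph N P} {sM : Splitting M} {sN : Splitting N} {sP : Splitting P}
  {b : FormField M.toBundleMfd 2} {c : FormField N.toBundleMfd 2}

/-- Eliminating the middle element composes the tangent maps and, in the covector conditions, adds
`f^*c` to `b`. -/
theorem compStr_eq_graphStr (hb : φ.IsGivenBy sM sN b) (hc : ψ.IsGivenBy sN sP c)
    (hbc : FormField.IsSmooth (b + FormField.pullback φ.map c)) :
    compStr φ ψ = graphStr (sM.shift (b + FormField.pullback φ.map c) hbc) sP (ψ.map ∘ φ.map) := by
  funext x
  have hD : ∀ X : M.T x, mfderiv M.I P.I (ψ.map ∘ φ.map) x X =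
      mfderiv N.I P.I ψ.map (φ.map x) (mfderiv M.I N.I φ.map x X) := fun X =>
    DFunLike.congr_fun (mfderiv_comp x ((ψ.smooth _).mdifferentiableAt (by simp))
      ((φ.smooth _).mdifferentiableAt (by simp))) X
  have h1 := fun e => by
    have := congrFun ((isGivenBy_iff hb.1).1 hb) x
    exact (iff_of_eq (congrArg (e ∈ ·) this)).trans mem_graphStr
  have h2 := fun e => by
    have := congrFun ((isGivenBy_iff hc.1).1 hc) (φ.map x)
    exact (iff_of_eq (congrArg (e ∈ ·) this)).trans mem_graphStr
  have hcc : ∀ X Y : M.T x, FormField.contract (b + FormField.pullback φ.map c) x X Y =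
      b.contract x X Y + c.contract (φ.map x) (mfderiv M.I N.I φ.map x X)
        (mfderiv M.I N.I φ.map x Y) := fun X Y => by
    rw [FormField.contract_form_add, FormField.contract_pullback]
    rfl
  ext e
  rw [mem_compStr]
  constructor
  · rintro ⟨e', h3, h4⟩
    obtain ⟨a1, a2⟩ := (h1 _).1 h3
    obtain ⟨a3, a4⟩ := (h2 _).1 h4
    simp only [sM.shift_cov, sN.shift_cov] at a1 a2 a3 a4
    refine mem_graphStr.2 ⟨?_, fun Y => ?_⟩
    · rw [hD, ← a1]
      exact a3
    · rw [sM.shift_cov, hcc, ← add_assoc, a2, ← a1, hD]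
      exact a4 _
  · intro he
    obtain ⟨a1, a2⟩ := mem_graphStr.1 he
    -- The middle element is forced: tangency fixes its vector part, and the condition from `ψ`
    -- fixes its covector part, with `ι c` undoing the shift of `s_N`.
    refine ⟨sN.toFun (φ.map x) (mfderiv M.I N.I φ.map x (M.courant.anchor x e.1)) +
      N.courant.coanchor (φ.map x) (sP.cov (ψ.map (φ.map x)) e.2 ∘ₗ
        (mfderiv N.I P.I ψ.map (φ.map x)).toLinearMap +
          c.contract (φ.map x) (mfderiv M.I N.I φ.map x (M.courant.anchor x e.1))), ?_, ?_⟩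
    · refine (h1 _).2 ⟨?_, fun Y => ?_⟩
      · simp only [map_add, sN.anchor_apply, N.anchor_coanchor, add_zero]
      · have a3 := a2 Y
        rw [sM.shift_cov, hcc, hD] at a3
        simp only [sM.shift_cov]
        rw [map_add, sN.cov_toFun, zero_add, sN.cov_coanchor, LinearMap.add_apply,
          c.contract_swap]
        have a4 : (sP.cov (ψ.map (φ.map x)) e.2 ∘ₗ
          (mfderiv N.I P.I ψ.map (φ.map x)).toLinearMap) (mfderiv M.I N.I φ.map x Y) =
          sP.cov (ψ.map (φ.map x)) e.2 (mfderiv N.I P.I ψ.map (φ.map x)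
            (mfderiv M.I N.I φ.map x Y)) := rfl
        rw [a4]
        have a5 : sM.cov x e.1 Y + (b.contract x Y (M.courant.anchor x e.1) +
          c.contract (φ.map x) (mfderiv M.I N.I φ.map x Y)
            (mfderiv M.I N.I φ.map x (M.courant.anchor x e.1))) =
          sP.cov (ψ.map (φ.map x)) e.2 (mfderiv N.I P.I ψ.map (φ.map x)
            (mfderiv M.I N.I φ.map x Y)) := a3
        rw [← a5]
        ring
    · refine (h2 _).2 ⟨?_, fun Y => ?_⟩
      · simp only [map_add, sN.anchor_apply, N.anchor_coanchor, add_zero]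
        exact a1.trans (hD _)
      · simp only [sN.shift_cov]
        simp only [map_add, sN.anchor_apply, N.anchor_coanchor, add_zero, sN.cov_toFun, zero_add,
          sN.cov_coanchor, LinearMap.add_apply]
        rw [c.contract_swap _ Y]
        exact add_neg_cancel_right _ _

theorem isSmooth_comp_form (hb : φ.IsGivenBy sM sN b) (hc : ψ.IsGivenBy sN sP c) :
    FormField.IsSmooth (b + FormField.pullback φ.map c) :=
  hb.1.add (hc.1.pullback φ.smooth)

variable (φ ψ) in
/-- The composition of morphisms. -/
def comp : Morph M P where
  map := ψ.map ∘ φ.map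
  str := compStr φ ψ
  smooth := ψ.smooth.comp φ.smooth
  maximal := by
    obtain ⟨sM⟩ := nonempty_splitting M
    obtain ⟨sN⟩ := nonempty_splitting N
    obtain ⟨sP⟩ := nonempty_splitting P
    obtain ⟨b, hb⟩ := φ.exists_isGivenBy sM sN
    obtain ⟨c, hc⟩ := ψ.exists_isGivenBy sN sP
    have hbc := isSmooth_comp_form hb hc
    rw [compStr_eq_graphStr hb hc hbc]
    refine maximal_graphStr (ψ.smooth.comp φ.smooth) ?_
    -- The equation for the composite is that of `φ` plus the pullback under `φ` of that of `ψ`.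
    rw [(sM.isShift_shift _ hbc).twistForm_eq hbc, FormField.d_add hb.1 (hc.1.pullback φ.smooth),
      FormField.d_pullback φ.smooth hc.1, FormField.pullback_comp φ.smooth ψ.smooth,
      ← hc.twistForm_eq, FormField.pullback_add, ← hb.twistForm_eq, add_assoc]

theorem isGivenBy_comp (hb : φ.IsGivenBy sM sN b) (hc : ψ.IsGivenBy sN sP c) :
    (comp φ ψ).IsGivenBy sM sP (b + FormField.pullback φ.map c) :=
  (isGivenBy_iff (isSmooth_comp_form hb hc)).2 (compStr_eq_graphStr hb hc _)

/-- Forms for `φ` and `ψ` always exist, so the condition is never vacuous and determines `χ`. The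
right side involves no splitting, which is the independence claim. -/
theorem isCompositeFor_iff (sM : Splitting M) (sN : Splitting N) (sP : Splitting P)
    (χ : Morph M P) : IsCompositeFor sM sN sP φ ψ χ ↔ χ = comp φ ψ := by
  constructor
  · rintro ⟨h1, h2⟩
    obtain ⟨b, hb⟩ := φ.exists_isGivenBy sM sN
    obtain ⟨c, hc⟩ := ψ.exists_isGivenBy sN sP
    exact (h2 b c hb hc).morph_unique (isGivenBy_comp hb hc) h1
  · rintro rfl
    exact ⟨rfl, fun _ _ hb hc => isGivenBy_comp hb hc⟩

end Comp

/-! ### Identities and the category laws -/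

section Ident

/-- The diagonal. -/
def identStr (M : ExtMfd.{u}) (x : M.carrier) : Submodule ℝ (M.fiber x × M.fiber (id x)) where
  carrier := {e | e.1 = e.2}
  zero_mem' := rfl
  add_mem' := fun h h' => congrArg₂ (· + ·) h h'
  smul_mem' := fun c _ h => congrArg (c • ·) h

theorem mem_identStr {M : ExtMfd.{u}} {x : M.carrier} {e : M.fiber x × M.fiber (id x)} :
    e ∈ identStr M x ↔ e.1 = e.2 := Iff.rfl

/-- For `f = id` and `b = 0` membership says that the two components have equal vector and covector
parts, whichever splitting is used. -/
theorem identStr_eq_graphStr {M : ExtMfd.{u}} (s : Splitting M) :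
    identStr M = graphStr (s.shift 0 FormField.isSmooth_zero) s id := by
  funext x
  have hD : ∀ X : M.T x, mfderiv M.I M.I id x X = X := fun X => by rw [mfderiv_id]; rfl
  have h0 : ∀ X : M.T x, FormField.contract (0 : FormField M.toBundleMfd 2) x X = 0 := fun _ => rfl
  ext e
  rw [mem_identStr, mem_graphStr]
  constructor
  · intro h
    refine ⟨?_, fun X => ?_⟩
    · rw [hD, h]; rfl
    · rw [hD, s.shift_cov, h0, LinearMap.zero_apply, add_zero, h]; rfl
  · rintro ⟨h1, h2⟩
    rw [hD] at h1
    refine s.ext_parts h1.symm (LinearMap.ext fun X => ?_)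
    have h3 := h2 X
    rw [hD, s.shift_cov, h0, LinearMap.zero_apply, add_zero] at h3
    exact h3

/-- The identity morphism. -/
def ident (M : ExtMfd.{u}) : Morph M M where
  map := id
  str := identStr M
  smooth := contMDiff_id
  maximal := by
    obtain ⟨s⟩ := nonempty_splitting M
    rw [identStr_eq_graphStr s]
    refine maximal_graphStr contMDiff_id ?_
    rw [(s.isShift_shift _ FormField.isSmooth_zero).twistForm_eq FormField.isSmooth_zero,
      FormField.d_zero, add_zero, FormField.pullback_id]

theorem isGivenBy_ident {M : ExtMfd.{u}} (s : Splitting M) : (ident M).IsGivenBy s s 0 :=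
  (isGivenBy_iff FormField.isSmooth_zero).2 (identStr_eq_graphStr s)

theorem ident_comp {M N : ExtMfd.{u}} (φ : Morph M N) : comp (ident M) φ = φ := by
  refine Morph.ext rfl (heq_of_eq (funext fun x => Submodule.ext fun e => ?_))
  refine (mem_compStr (φ := ident M) (ψ := φ)).trans ⟨?_, fun h => ⟨e.1, rfl, h⟩⟩
  rintro ⟨e', h1, h2⟩
  have h3 : e.1 = e' := h1
  subst h3
  exact h2

theorem comp_ident {M N : ExtMfd.{u}} (φ : Morph M N) : comp φ (ident N) = φ := by
  refine Morph.ext rfl (heq_of_eq (funext fun x => Submodule.ext fun e => ?_))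
  refine (mem_compStr (φ := φ) (ψ := ident N)).trans ⟨?_, fun h => ⟨e.2, h, rfl⟩⟩
  rintro ⟨e', h1, h2⟩
  have h3 : e' = e.2 := h2
  subst h3
  exact h1

/-- Composition of relations is associative by regrouping the intermediate elements; no 2-forms are
involved. -/
theorem comp_assoc {M N P Q : ExtMfd.{u}} (φ : Morph M N) (ψ : Morph N P) (χ : Morph P Q) :
    comp (comp φ ψ) χ = comp φ (comp ψ χ) := by
  refine Morph.ext rfl (heq_of_eq (funext fun x => Submodule.ext fun e => ?_))
  constructor
  · rintro ⟨e₂, ⟨e₁, h1, h2⟩, h3⟩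
    exact ⟨e₁, h1, e₂, h2, h3⟩
  · rintro ⟨e₁, h1, e₂, h2, h3⟩
    exact ⟨e₂, ⟨e₁, h1, h2⟩, h3⟩

end Ident

end Morph

end ExtGeom

end

theorem mainTheorem9 :
    -- splittings exist, can be shifted by 2-forms, and have a well-defined twisting form
    (∀ M : ExtMfd.{u}, Nonempty (ExtGeom.Splitting M)) ∧
    (∀ (M : ExtMfd.{u}) (s : ExtGeom.Splitting M) (B : ExtGeom.FormField M.toBundleMfd 2),
      B.IsSmooth → ∃! s' : ExtGeom.Splitting M, s.IsShift B s') ∧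
    (∀ (M : ExtMfd.{u}) (s : ExtGeom.Splitting M),
      ∃! H : ExtGeom.FormField M.toBundleMfd 3, s.IsTwistingForm H) ∧
    -- given splittings, morphisms extending `f` correspond to 2-forms with `H_M = f^* H_N - db`
    (∀ (M N : ExtMfd.{u}) (sM : ExtGeom.Splitting M) (sN : ExtGeom.Splitting N)
      (HM : ExtGeom.FormField M.toBundleMfd 3) (HN : ExtGeom.FormField N.toBundleMfd 3),
      sM.IsTwistingForm HM → sN.IsTwistingForm HN →
      (∀ φ : ExtGeom.Morph M N,
        (∃! b : ExtGeom.FormField M.toBundleMfd 2, φ.IsGivenBy sM sN b) ∧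
        ∀ b : ExtGeom.FormField M.toBundleMfd 2, φ.IsGivenBy sM sN b →
          HM = ExtGeom.FormField.pullback φ.map HN - b.d) ∧
      (∀ (f : M.carrier → N.carrier) (b : ExtGeom.FormField M.toBundleMfd 2),
        ContMDiff M.I N.I ∞ f → b.IsSmooth → HM = ExtGeom.FormField.pullback f HN - b.d →
        ∃! φ : ExtGeom.Morph M N, φ.map = f ∧ φ.IsGivenBy sM sN b)) ∧
    -- change of splittings
    (∀ (M N : ExtMfd.{u}) (sM sM' : ExtGeom.Splitting M) (sN sN' : ExtGeom.Splitting N)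
      (BM : ExtGeom.FormField M.toBundleMfd 2) (BN : ExtGeom.FormField N.toBundleMfd 2),
      BM.IsSmooth → BN.IsSmooth → sM.IsShift BM sM' → sN.IsShift BN sN' →
      ∀ (φ : ExtGeom.Morph M N) (b : ExtGeom.FormField M.toBundleMfd 2),
        φ.IsGivenBy sM sN b →
        φ.IsGivenBy sM' sN' (b - BM + ExtGeom.FormField.pullback φ.map BN)) ∧
    -- for each choice of splittings the composition exists, and it does not depend on the choice
    (∀ (M N P : ExtMfd.{u}) (φ : ExtGeom.Morph M N) (ψ : ExtGeom.Morph N P),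
      ∃ χ : ExtGeom.Morph M P,
        ∀ (sM : ExtGeom.Splitting M) (sN : ExtGeom.Splitting N) (sP : ExtGeom.Splitting P)
          (χ' : ExtGeom.Morph M P),
          ExtGeom.Morph.IsCompositeFor sM sN sP φ ψ χ' ↔ χ' = χ) ∧
    -- extended manifolds, morphisms and this composition form a category, with the morphism
    -- extending `id` and given by the 2-form `0` (the diagonal) as identity
    (∃ (ident : ∀ M : ExtMfd.{u}, ExtGeom.Morph M M)
      (comp : ∀ {M N P : ExtMfd.{u}}, ExtGeom.Morph M N → ExtGeom.Morph N P → ExtGeom.Morph M P),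
      (∀ (M : ExtMfd.{u}) (s : ExtGeom.Splitting M),
        (ident M).map = id ∧ (ident M).IsGivenBy s s 0) ∧
      (∀ (M N P : ExtMfd.{u}) (sM : ExtGeom.Splitting M) (sN : ExtGeom.Splitting N)
        (sP : ExtGeom.Splitting P) (φ : ExtGeom.Morph M N) (ψ : ExtGeom.Morph N P),
        ExtGeom.Morph.IsCompositeFor sM sN sP φ ψ (comp φ ψ)) ∧
      ∃ C : CategoryTheory.Category.{u, u + 1} ExtMfd.{u},
        C.toCategoryStruct =
          { Hom := ExtGeom.Morph
            id := ident
            comp := fun φ ψ => comp φ ψ }) := by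
  refine ⟨ExtGeom.nonempty_splitting, ?_, ?_, ?_, ?_, ?_, ?_⟩
  · exact fun M s B hB => ⟨s.shift B hB, s.isShift_shift B hB, fun s' h => h.eq hB⟩
  · exact fun M s => ⟨s.twistForm, s.isTwistingForm_twistForm, fun H h => h.eq⟩
  · intro M N sM sN HM HN hM hN
    obtain rfl := hM.eq
    obtain rfl := hN.eq
    refine ⟨fun φ => ⟨?_, fun b hb => eq_sub_of_add_eq hb.twistForm_eq⟩, fun f b hf hb h => ?_⟩
    · obtain ⟨b, hb⟩ := φ.exists_isGivenBy sM sN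
      exact ⟨b, hb, fun c hc => hc.form_unique hb⟩
    · have h' := eq_sub_iff_add_eq.1 h
      exact ⟨ExtGeom.Morph.ofForm hf hb h', ⟨rfl, ExtGeom.Morph.isGivenBy_ofForm hf hb h'⟩,
        fun ψ hψ => hψ.2.morph_unique (ExtGeom.Morph.isGivenBy_ofForm hf hb h') hψ.1⟩
  · exact fun M N sM sM' sN sN' BM BN hBM hBN hM hN φ b hb => hb.change hBM hBN hM hN
  · exact fun M N P φ ψ => ⟨φ.comp ψ, fun sM sN sP χ =>
      ExtGeom.Morph.isCompositeFor_iff sM sN sP χ⟩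
  · refine ⟨ExtGeom.Morph.ident, fun φ ψ => φ.comp ψ,
      fun M s => ⟨rfl, ExtGeom.Morph.isGivenBy_ident s⟩,
      fun M N P sM sN sP φ ψ => (ExtGeom.Morph.isCompositeFor_iff sM sN sP _).2 rfl,
      { Hom := ExtGeom.Morph
        id := ExtGeom.Morph.ident
        comp := fun φ ψ => φ.comp ψ
        id_comp := ExtGeom.Morph.ident_comp
        comp_id := ExtGeom.Morph.comp_ident
        assoc := ExtGeom.Morph.comp_assoc }, rfl⟩
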